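/- Let $\Theta_0:=\inf_{\alpha\in\mathbb R}\inf\{\int_0^\infty(|u'|^2+(t+\alpha)^2|u|^2)\,dt:\ \|u\|_{L^2(0,\infty)}=1\}$, the inner infimum being over $u\in H^1(0,\infty)$ with $tu\in L^2(0,\infty)$. For $b,c_0,\varepsilon>0$ with $\varepsilon<1$ put $t_\varepsilon:=c_0|\log\varepsilon|$ and $I_\varepsilon:=[0,t_\varepsilon]$, and for $k,\alpha\in\mathbb R$ and real-valued $f\in H^1(I_\varepsilon)$ put $$\mathcal E_{k,\alpha}[f]:=\int_0^{t_\varepsilon}(1-\varepsilon kt)\Big\{|f'|^2+\frac{(t+\alpha-\frac12\varepsilon kt^2)^2}{(1-\varepsilon kt)^2}f^2-\frac1{2b}(2f^2-f^4)\Big\}\,dt .$$ Let $E(k,\alpha):=\inf_{f\in H^1(I_\varepsilon)}\mathcal E_{k,\alpha}[f]$ and $E^{1D}_\star(k):=\inf_{\alpha\ge -t_\varepsilon/2}E(k,\alpha)$. An optimal phase $\alpha(k)$ is an $\alpha\ge -t_\varepsilon/2$ with $E(k,\alpha)=E^{1D}_\star(k)$, and an optimal density $f_k$ is a nonnegative minimizer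 of $\mathcal E_{k,\alpha(k)}$ in $H^1(I_\varepsilon)$. (The restriction $\alpha\ge -t_\varepsilon/2$ excludes only the mirror images, under $t\mapsto t_\varepsilon-t$, of states localized near the physical boundary $t=0$.) Let $1<b<\Theta_0^{-1}$. If the constant $c_0$ is large enough (depending on $b$), then for every $M>0$ there is $\varepsilon_0\in(0,1)$ such that the following holds for all $0<\varepsilon<\varepsilon_0$ and all $k,k'\in[-M,M]$. An optimal phase $\alpha(k)$ and an optimal density $f_k$ exist, and every optimal density is smooth on $I_\varepsilon$; if $k>0$, then $E(k,\beta)>E^{1D}_\star(k)$ for every $\beta<-t_\varepsilon/2$, so that $E^{1D}_\star(k)$ and $\alpha(k)$ are also obtained by minimizing over all $\alpha\in\mathbb R$. Moreover, for every choice of optimal phases $\alpha(k),\alpha(k')$ and of optimal densities $f_k,f_{k'}$, $$|E^{1D}_\star(k)-E^{1D}_\star(k')|\le C\,\varepsilon|k-k'|\,|\log\varepsilon|^a,\qquad |\alpha(k)-\alpha(k')|\le C\,(\varepsilon|k-k'|)^{1/2}|\log\varepsilon|^a,$$ and for every integer $n\ge0$ $$\|f_k^{(n)}-f_{k'}^{(n)}\|_{L^\infty(I_\varepsilon)}\le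 C_n\,(\varepsilon|k-k'|)^{1/2}|\log\varepsilon|^{a_n}.$$ Here $C,a>0$ depend only on $b,c_0,M$, and $C_n,a_n>0$ depend only on $b,c_0,M,n$; none of them depends on $\varepsilon,k,k'$. (The case $k=k'$ gives uniqueness of $\alpha(k)$ and $f_k$.) -/

import Mathlib

open Set MeasureTheory
open scoped ContDiff

namespace SurfaceSC

noncomputable section

/-- `u` (a continuous representative) is in the form domain of `-∂ₜ² + (t + α)²` on the half-line
`(0, ∞)`: `u ∈ H¹(0, ∞)` and `(t + α) u ∈ L²(0, ∞)`. -/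
def HalfLineDomain (α : ℝ) (u : ℝ → ℝ) : Prop :=
  (∀ R : ℝ, 0 < R → AbsolutelyContinuousOnInterval u 0 R) ∧
  MemLp u 2 (volume.restrict (Ioi 0)) ∧
  MemLp (deriv u) 2 (volume.restrict (Ioi 0)) ∧
  MemLp (fun t => (t + α) * u t) 2 (volume.restrict (Ioi 0))

/-- The spectral constant `Θ₀`: the infimum over the shift `α ∈ ℝ` of the ground state energy of the
shifted harmonic oscillator on the half-line. -/
def Theta0 : ℝ :=
  sInf {E : ℝ | ∃ (α : ℝ) (u : ℝ → ℝ), HalfLineDomain α u ∧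
    (∫ t in Ioi (0 : ℝ), u t ^ 2) = 1 ∧
    E = ∫ t in Ioi (0 : ℝ), (deriv u t ^ 2 + (t + α) ^ 2 * u t ^ 2)}

/-- The length `t_ε = c₀ |log ε|` of the interval. -/
def tEps (c₀ ε : ℝ) : ℝ := c₀ * |Real.log ε|

/-- The interval `I_ε = [0, c₀ |log ε|]`. -/
def IEps (c₀ ε : ℝ) : Set ℝ := Icc 0 (tEps c₀ ε)

/-- `f ∈ H¹(I_ε)`, through its continuous representative: `f` is absolutely continuous on `I_ε`
and its (almost everywhere defined) derivative is square integrable. -/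
def H1 (c₀ ε : ℝ) (f : ℝ → ℝ) : Prop :=
  AbsolutelyContinuousOnInterval f 0 (tEps c₀ ε) ∧
  MemLp (deriv f) 2 (volume.restrict (IEps c₀ ε))

/-- The potential `V_{k,α}`. -/
def V (ε k α t : ℝ) : ℝ :=
  (t + α - 1 / 2 * ε * k * t ^ 2) ^ 2 / (1 - ε * k * t) ^ 2

/-- The one-dimensional functional with curvature `k` and phase `α`. -/
def energy (b c₀ ε k α : ℝ) (f : ℝ → ℝ) : ℝ :=
  ∫ t in (0 : ℝ)..(tEps c₀ ε), (1 - ε * k * t) *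
    (deriv f t ^ 2 + V ε k α t * f t ^ 2 - 1 / (2 * b) * (2 * f t ^ 2 - f t ^ 4))

/-- The ground state energy at fixed curvature and phase: infimum of the functional over
`H¹(I_ε)`. -/
def E1D (b c₀ ε k α : ℝ) : ℝ :=
  sInf (energy b c₀ ε k α '' {f | H1 c₀ ε f})

/-- The admissible phases: those `α` for which the point `t = -α`, where the potential is centred,
does not lie in the half of `I_ε` far away from the physical boundary `t = 0`.
(The reflection `t ↦ t_ε - t` maps the functional with parameters `(k, α)` to `1 - ε k t_ε` times
the functional with parameters `(k', α')`, `k' = -k / (1 - ε k t_ε)`, where `α < -t_ε / 2` if and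
only if `α' > -t_ε / 2`. The phases left out are thus those of mirror states, that live
at the artificial end point `t = t_ε`.) -/
def phases (c₀ ε : ℝ) : Set ℝ := Ici (-(tEps c₀ ε) / 2)

/-- The optimal energy `E_⋆(k)`, obtained by minimizing also over the phase. -/
def EStar (b c₀ ε k : ℝ) : ℝ :=
  sInf (E1D b c₀ ε k '' phases c₀ ε)

/-- `α` is an optimal phase `α(k)`. -/
def IsOptimalPhase (b c₀ ε k α : ℝ) : Prop :=
  α ∈ phases c₀ ε ∧ E1D b c₀ ε k α = EStar b c₀ ε k

/-- `f` is an optimal density `f_{k,α}` at fixed curvature and phase: a nonnegative minimizer of the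
functional in `H¹(I_ε)`. -/
def IsOptimalDensity (b c₀ ε k α : ℝ) (f : ℝ → ℝ) : Prop :=
  H1 c₀ ε f ∧ (∀ t ∈ IEps c₀ ε, 0 ≤ f t) ∧ energy b c₀ ε k α f = E1D b c₀ ε k α

/-- `(α, f)` is an optimal pair `(α(k), f_k)` for the curvature `k`. -/
def IsOptimalPair (b c₀ ε k α : ℝ) (f : ℝ → ℝ) : Prop :=
  IsOptimalPhase b c₀ ε k α ∧ IsOptimalDensity b c₀ ε k α f

end

end SurfaceSC

namespace SurfaceSC

/-! ### The functional on `[0, T]` in terms of the single parameter `σ = ε k` -/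

noncomputable section

/-! Write `σ = ε k`, `T = t_ε`, `w = 1 - σ t` and `A = t + α - σ t² / 2`, so that `A' = w`. The main
lower bounds rest on one device. For a `C¹` multiplier `φ`, integrating `(φ g²)'` and completing the
square turns the functional into boundary terms, a weighted square and an integral free of `g'`
(`J_eq`, `J_ge`). If `φ = p / f` is the logarithmic derivative of a positive Neumann solution `f` of
the Euler-Lagrange equation, the Riccati equation leaves exactly `J g - J f ≥ ∫ w / (2 b) (f² -
g²)²` (`Sol.le_J_sub`). A positive solution is therefore the unique nonnegative minimizer, and
existence needs no direct method: shooting yields a solution as soon as `J` takes a negative value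
(`exists_sol`). Negativity at the optimal phase, uniformly in `T` and `σ`, comes from cutting a
half-line trial function of energy below `1 / b` (`exists_Est_le`). Explicit multipliers confine
phases of negative energy to `(-X, 2)`.

To compare phases, let `F` be the primitive of the current `2 A f² / w` with `F 0 = 0`; at an
optimal phase the total current vanishes, so `F T = 0`. The multiplier `p / f + δ F / f²` bounds
`J_{α+δ} g - J_α f` below by the defect above plus `δ² ∫ (1 - (F / f²)²) g² / w`
(`Sol.le_J_add_phase_sub`). Coercivity in the phase is thus the pointwise inequality `-F < f²`, with
a margin. Without curvature `F` equals, up to a constant, the explicit quantity `-p² + A² f² - (2 f²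
- f⁴) / (2 b)`. At an interior critical point of `f²` plus this quantity one has `p = -A f`, and the
value is `(1 - 1 / b) f² + f⁴ / (2 b) > 0`; this is where `b > 1` enters (`Ctrl.neg_bern_le`). With
curvature the argument survives on `[0, T / 2]` with relative margin of order `T⁻²`; on `[T / 2, T]`
only a polynomial bound on `F / f²` is available, but there `g²` is exponentially small. The outcome
is `Ctrl.coercive`.

The uniform bounds behind this (decay, Harnack inequality, positivity near the boundary, collected
in `Ctrl`) come from Wronskian comparison with hyperbolic cosines, exponentials and Gaussians. Using
the optimizer for `σ'` as a trial state for `σ` makes the optimal energy Lipschitz in `σ`, and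
coercivity turns this into bounds of order `|σ - σ'|` on squared distances, whence the square root.
The linear system for the difference of two solutions upgrades the integral bound to a uniform one,
and differentiating the equations repeatedly gives all derivatives (`OptPair.close_sol`). Phases
below `-T / 2` are handled by the reflection `t ↦ T - t`. Every loss is a power of `1 + T`, that is,
of `|log ε|`. -/

/-- The metric weight `1 - σ t`. -/
def wt (σ t : ℝ) : ℝ := 1 - σ * t

/-- The shifted momentum `t + α - σ t² / 2`. -/
def mom (σ α t : ℝ) : ℝ := t + α - σ * t ^ 2 / 2

/-- The one-dimensional functional on `[0, T]`, with `σ = ε k`. -/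
def J (b T σ α : ℝ) (f : ℝ → ℝ) : ℝ :=
  ∫ t in (0 : ℝ)..T, wt σ t * (deriv f t ^ 2 + mom σ α t ^ 2 / wt σ t ^ 2 * f t ^ 2
    - 1 / (2 * b) * (2 * f t ^ 2 - f t ^ 4))

/-- `H¹(0, T)`. -/
def H1on (T : ℝ) (f : ℝ → ℝ) : Prop :=
  AbsolutelyContinuousOnInterval f 0 T ∧ MemLp (deriv f) 2 (volume.restrict (Icc 0 T))

theorem energy_eq_J (b c₀ ε k α : ℝ) (f : ℝ → ℝ) :
    energy b c₀ ε k α f = J b (tEps c₀ ε) (ε * k) α f := by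
  unfold energy J V wt mom
  congr 1
  ext t
  ring_nf

theorem hasDerivAt_wt (σ t : ℝ) : HasDerivAt (wt σ) (-σ) t := by
  unfold wt
  simpa using ((hasDerivAt_id t).const_mul σ).const_sub 1

theorem hasDerivAt_mom (σ α t : ℝ) : HasDerivAt (mom σ α) (wt σ t) t := by
  unfold mom wt
  have := ((hasDerivAt_id t).add_const α).sub (((hasDerivAt_pow 2 t).const_mul σ).div_const 2)
  convert! this using 1
  simp
  ring

theorem continuous_wt (σ : ℝ) : Continuous (wt σ) := by unfold wt; fun_prop

theorem continuous_mom (σ α : ℝ) : Continuous (mom σ α) := by unfold mom; fun_prop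

/-! ### `H¹` functions, integration by parts and completing the square -/

section H1

variable {T : ℝ} {g : ℝ → ℝ}

theorem H1on.continuousOn (hT : 0 ≤ T) (hg : H1on T g) : ContinuousOn g (Icc 0 T) := by
  simpa [uIcc_of_le hT] using hg.1.continuousOn

theorem H1on.intervalIntegrable_deriv_sq (hT : 0 ≤ T) (hg : H1on T g) :
    IntervalIntegrable (fun t => deriv g t ^ 2) volume 0 T := by
  rw [intervalIntegrable_iff_integrableOn_Icc_of_le hT]
  exact hg.2.integrable_sq

theorem H1on.intervalIntegrable_deriv (hg : H1on T g) :
    IntervalIntegrable (deriv g) volume 0 T := hg.1.intervalIntegrable_deriv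

theorem intervalIntegrable_of_continuousOn_Icc (hT : 0 ≤ T) {φ : ℝ → ℝ}
    (hφ : ContinuousOn φ (Icc 0 T)) : IntervalIntegrable φ volume 0 T :=
  ContinuousOn.intervalIntegrable (by simpa [uIcc_of_le hT] using hφ)

theorem IntervalIntegrable.mul_continuousOn_Icc (hT : 0 ≤ T) {φ ψ : ℝ → ℝ}
    (hφ : IntervalIntegrable φ volume 0 T) (hψ : ContinuousOn ψ (Icc 0 T)) :
    IntervalIntegrable (fun t => φ t * ψ t) volume 0 T :=
  hφ.mul_continuousOn (by simpa [uIcc_of_le hT] using hψ)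

theorem contDiffOn_of_hasDerivAt (hT : 0 < T) {φ φ' : ℝ → ℝ}
    (hφ : ∀ t ∈ Icc 0 T, HasDerivAt φ (φ' t) t) (hφ' : ContinuousOn φ' (Icc 0 T)) :
    ContDiffOn ℝ 1 φ (Icc 0 T) := by
  rw [contDiffOn_one_iff_derivWithin (uniqueDiffOn_Icc hT)]
  refine ⟨fun t ht => (hφ t ht).differentiableAt.differentiableWithinAt, hφ'.congr ?_⟩
  intro t ht
  exact ((hφ t ht).hasDerivWithinAt).derivWithin (uniqueDiffOn_Icc hT t ht)

theorem H1on_of_hasDerivAt (hT : 0 < T) {φ φ' : ℝ → ℝ}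
    (hφ : ∀ t ∈ Icc 0 T, HasDerivAt φ (φ' t) t) (hφ' : ContinuousOn φ' (Icc 0 T)) :
    H1on T φ := by
  refine ⟨ContDiffOn.absolutelyContinuousOnInterval
    (by simpa [uIcc_of_le hT.le] using contDiffOn_of_hasDerivAt hT hφ hφ'), ?_⟩
  have h1 : MemLp φ' 2 (volume.restrict (Icc 0 T)) := by
    obtain ⟨C, hC⟩ := isCompact_Icc.exists_bound_of_continuousOn hφ'
    refine MemLp.of_bound (hφ'.aestronglyMeasurable measurableSet_Icc) C ?_
    filter_upwards [ae_restrict_mem measurableSet_Icc] with t ht using hC t ht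
  refine h1.ae_eq ?_
  filter_upwards [ae_restrict_mem measurableSet_Icc] with t ht using ((hφ t ht).deriv).symm

/-- Integration by parts for `φ g²`, `φ` of class `C¹` and `g` absolutely continuous. -/
theorem integral_deriv_mul_sq (hT : 0 < T) (hg : H1on T g) {φ φ' : ℝ → ℝ}
    (hφ : ∀ t ∈ Icc 0 T, HasDerivAt φ (φ' t) t) (hφ' : ContinuousOn φ' (Icc 0 T)) :
    ∫ t in (0 : ℝ)..T, (φ' t * g t ^ 2 + 2 * φ t * g t * deriv g t)
      = φ T * g T ^ 2 - φ 0 * g 0 ^ 2 := by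
  have hφa := (H1on_of_hasDerivAt hT hφ hφ').1
  have hg2 := hg.1.mul hg.1
  have key := (hφa.mul hg2).integral_deriv_eq_sub
  rw [show φ T * g T ^ 2 - φ 0 * g 0 ^ 2 = φ T * (g T * g T) - φ 0 * (g 0 * g 0) by ring]
  have e : ∀ x, (φ * (g * g)) x = φ x * (g x * g x) := fun x => rfl
  rw [← e, ← e, ← key]
  apply intervalIntegral.integral_congr_ae
  have had := hg.1.ae_differentiableAt
  rw [uIcc_of_le hT.le] at had
  rw [uIoc_of_le hT.le]
  filter_upwards [had] with t h1 ht
  have h2 := (h1 (Ioc_subset_Icc_self ht)).hasDerivAt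
  have h3 := (hφ t (Ioc_subset_Icc_self ht)).mul (h2.mul h2)
  rw [h3.deriv]
  simp only [Pi.mul_apply]
  ring

theorem J_integrable (b σ α : ℝ) (hT : 0 ≤ T) (hw : ∀ t ∈ Icc 0 T, 0 < wt σ t) (hg : H1on T g) :
    IntervalIntegrable (fun t => wt σ t * (deriv g t ^ 2 + mom σ α t ^ 2 / wt σ t ^ 2 * g t ^ 2
    - 1 / (2 * b) * (2 * g t ^ 2 - g t ^ 4))) volume 0 T := by
  have hgc := hg.continuousOn hT
  have c1 := (continuous_wt σ).continuousOn (s := Icc 0 T)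
  have c2 := (continuous_mom σ α).continuousOn (s := Icc 0 T)
  have i1 : IntervalIntegrable (fun t => deriv g t ^ 2 * wt σ t) volume 0 T :=
    IntervalIntegrable.mul_continuousOn_Icc hT (hg.intervalIntegrable_deriv_sq hT) c1
  have i2 : IntervalIntegrable (fun t => wt σ t * (mom σ α t ^ 2 / wt σ t ^ 2 * g t ^ 2
    - 1 / (2 * b) * (2 * g t ^ 2 - g t ^ 4))) volume 0 T := by
    apply intervalIntegrable_of_continuousOn_Icc hT
    refine c1.mul (((c2.pow 2).div (c1.pow 2) ?_ |>.mul (hgc.pow 2)).sub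
      (continuousOn_const.mul ((continuousOn_const.mul (hgc.pow 2)).sub (hgc.pow 4))))
    intro t ht
    exact pow_ne_zero _ (hw t ht).ne'
  refine (i1.add i2).congr fun t _ => ?_
  ring

/-- Completing the square in the functional with the help of a multiplier `φ`. -/
theorem J_eq {b σ α : ℝ} (hT : 0 < T) (hw : ∀ t ∈ Icc 0 T, 0 < wt σ t) (hg : H1on T g)
    {φ φ' : ℝ → ℝ} (hφ : ∀ t ∈ Icc 0 T, HasDerivAt φ (φ' t) t)
    (hφ' : ContinuousOn φ' (Icc 0 T)) :
    J b T σ α g = φ T * g T ^ 2 - φ 0 * g 0 ^ 2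
      + (∫ t in (0 : ℝ)..T, wt σ t * (deriv g t - φ t * g t / wt σ t) ^ 2)
      + ∫ t in (0 : ℝ)..T, ((mom σ α t ^ 2 / wt σ t - wt σ t / b - φ' t - φ t ^ 2 / wt σ t) * g t ^ 2
          + wt σ t / (2 * b) * g t ^ 4) := by
  have hgc := hg.continuousOn hT.le
  have hφc : ContinuousOn φ (Icc 0 T) := fun t ht => (hφ t ht).continuousAt.continuousWithinAt
  have c1 := (continuous_wt σ).continuousOn (s := Icc 0 T)
  have c2 := (continuous_mom σ α).continuousOn (s := Icc 0 T)
  have hw' : ∀ t ∈ Icc 0 T, wt σ t ≠ 0 := fun t ht => (hw t ht).ne'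
  have i0 : IntervalIntegrable (fun t => φ' t * g t ^ 2 + 2 * φ t * g t * deriv g t) volume 0 T := by
    apply IntervalIntegrable.add
    · exact intervalIntegrable_of_continuousOn_Icc hT.le (hφ'.mul (hgc.pow 2))
    · have := IntervalIntegrable.mul_continuousOn_Icc hT.le hg.intervalIntegrable_deriv
        ((continuousOn_const.mul hφc).mul hgc (f := fun t => 2 * φ t))
      refine this.congr fun t _ => ?_
      simp only [Pi.mul_apply]
      ring
  have i1 : IntervalIntegrable (fun t => wt σ t * (deriv g t - φ t * g t / wt σ t) ^ 2)
      volume 0 T := by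
    have a1 : IntervalIntegrable (fun t => deriv g t ^ 2 * wt σ t) volume 0 T :=
      IntervalIntegrable.mul_continuousOn_Icc hT.le (hg.intervalIntegrable_deriv_sq hT.le) c1
    have a2 := IntervalIntegrable.mul_continuousOn_Icc hT.le hg.intervalIntegrable_deriv
        ((continuousOn_const.mul hφc).mul hgc (f := fun t => -2 * φ t))
    have a3 : IntervalIntegrable (fun t => φ t ^ 2 * g t ^ 2 / wt σ t) volume 0 T :=
      intervalIntegrable_of_continuousOn_Icc hT.le (((hφc.pow 2).mul (hgc.pow 2)).div c1 hw')
    refine ((a1.add a2).add a3).congr ?_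
    intro t ht
    rw [uIoc_of_le hT.le] at ht
    have := hw' t (Ioc_subset_Icc_self ht)
    simp only [Pi.mul_apply]
    field_simp
    ring
  have i2 : IntervalIntegrable (fun t => ((mom σ α t ^ 2 / wt σ t - wt σ t / b - φ' t
      - φ t ^ 2 / wt σ t) * g t ^ 2 + wt σ t / (2 * b) * g t ^ 4)) volume 0 T := by
    apply intervalIntegrable_of_continuousOn_Icc hT.le
    exact ((((((c2.pow 2).div c1 hw').sub (c1.div_const b)).sub hφ').sub
      ((hφc.pow 2).div c1 hw')).mul (hgc.pow 2)).add ((c1.div_const (2 * b)).mul (hgc.pow 4))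
  rw [← integral_deriv_mul_sq hT hg hφ hφ', ← intervalIntegral.integral_add i0 i1,
    ← intervalIntegral.integral_add (i0.add i1) i2]
  apply intervalIntegral.integral_congr
  intro t ht
  rw [uIcc_of_le hT.le] at ht
  have := hw' t ht
  simp only
  field_simp
  ring

/-- The square and both boundary terms are nonnegative and are dropped. The main lower bounds below
are choices of `φ`: zero, a truncated Gaussian logarithmic derivative, the logarithmic derivative of
a solution, and the latter corrected by the current. -/
theorem J_ge {b σ α : ℝ} (hT : 0 < T) (hw : ∀ t ∈ Icc 0 T, 0 < wt σ t) (hg : H1on T g)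
    {φ φ' : ℝ → ℝ} (hφ : ∀ t ∈ Icc 0 T, HasDerivAt φ (φ' t) t)
    (hφ' : ContinuousOn φ' (Icc 0 T)) (h0 : φ 0 ≤ 0) (h1 : 0 ≤ φ T) :
    ∫ t in (0 : ℝ)..T, ((mom σ α t ^ 2 / wt σ t - wt σ t / b - φ' t - φ t ^ 2 / wt σ t) * g t ^ 2
          + wt σ t / (2 * b) * g t ^ 4) ≤ J b T σ α g := by
  rw [J_eq hT hw hg hφ hφ']
  have : 0 ≤ ∫ t in (0 : ℝ)..T, wt σ t * (deriv g t - φ t * g t / wt σ t) ^ 2 := by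
    apply intervalIntegral.integral_nonneg hT.le
    intro t ht
    have := (hw t ht).le
    positivity
  nlinarith [mul_nonneg h1 (sq_nonneg (g T)), mul_nonneg (neg_nonneg.2 h0) (sq_nonneg (g 0))]

end H1

end

noncomputable section

/-! ### The flow of the truncated Euler-Lagrange system -/

section Flow

/-- Truncation of a real number to `[-R, R]`. -/
def clip (R x : ℝ) : ℝ := max (-R) (min x R)

theorem abs_clip_le {R : ℝ} (hR : 0 ≤ R) (x : ℝ) : |clip R x| ≤ R := by
  unfold clip
  rw [abs_le]
  exact ⟨le_max_left _ _, max_le (by linarith) (min_le_right _ _)⟩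

theorem abs_clip_sub_clip_le (R x y : ℝ) : |clip R x - clip R y| ≤ |x - y| := by
  unfold clip
  refine (abs_max_sub_max_le_max _ _ _ _).trans ?_
  simp only [sub_self, abs_zero]
  refine max_le (abs_nonneg _) ((abs_min_sub_min_le_max _ _ _ _).trans ?_)
  simp

theorem clip_eq_self {R x : ℝ} (h : |x| ≤ R) : clip R x = x := by
  rw [abs_le] at h
  unfold clip
  rw [min_eq_left h.2, max_eq_right h.1]

theorem clip_one_of_one_le {x : ℝ} (h : 1 ≤ x) : clip 1 x = 1 := by
  unfold clip
  rw [min_eq_right h]; norm_num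

/-- Solutions of `f' = p / W`, `p' = H t f` with `f 0 = s`, `p 0 = 0`, where `H` is bounded and
Lipschitz: existence on `[0, T]` and Lipschitz dependence on `s`. -/
theorem exists_flow {T Q : ℝ} (hT : 0 < T) {W : ℝ → ℝ} {H : ℝ → ℝ → ℝ}
    (hW : Continuous W) (hW1 : ∀ t, 1 / 2 ≤ W t) (hH : ∀ x, Continuous fun t => H t x)
    (hHQ : ∀ t x, |H t x| ≤ Q) (hHL : ∀ t x y, |H t x - H t y| ≤ Q * |x - y|)
    (hH0 : ∀ t, H t 0 = 0) :
    ∃ (E : ℝ) (f p : ℝ → ℝ → ℝ), 1 ≤ E ∧ (∀ s, f s 0 = s) ∧ (∀ s, p s 0 = 0) ∧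
      (∀ s, ∀ t ∈ Icc 0 T, HasDerivAt (f s) (p s t / W t) t) ∧
      (∀ s, ∀ t ∈ Icc 0 T, HasDerivAt (p s) (H t (f s t)) t) ∧
      (∀ s s', ∀ t ∈ Icc 0 T, |f s t - f s' t| ≤ |s - s'| * E ∧ |p s t - p s' t| ≤ |s - s'| * E) ∧
      (∀ s, ∀ t ∈ Icc 0 T, |f s t| ≤ |s| * E) ∧
      (∀ s, ∀ t ∈ Icc 0 T, f s t = 0 → p s t = 0 → s = 0) ∧
      (∀ s, ∀ t ∈ Icc 0 T, |p s t| ≤ Q * T) := by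
  have hQ : 0 ≤ Q := (abs_nonneg _).trans (hHQ 0 0)
  set R : ℝ := Q * T with hR
  have hR0 : 0 ≤ R := by positivity
  -- Truncating `p` makes the field bounded, so that Picard-Lindelöf applies on the whole interval
  -- at once. The truncation is never active: `p' = H` with `|H| ≤ Q` and `p 0 = 0` give `|p| ≤ Q T
  -- = R`.
  let v : ℝ → ℝ × ℝ → ℝ × ℝ := fun t x => (clip R x.2 / W t, H t x.1)
  have hv : ∀ t, LipschitzWith (Real.toNNReal (Q + 2)) (v t) := by
    intro t
    refine LipschitzWith.of_dist_le_mul fun x y => ?_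
    rw [Real.coe_toNNReal _ (by positivity)]
    have hx1 : |x.1 - y.1| ≤ dist x y := by rw [← Real.dist_eq]; exact le_max_left _ _
    have hx2 : |x.2 - y.2| ≤ dist x y := by rw [← Real.dist_eq]; exact le_max_right _ _
    have hd : 0 ≤ dist x y := dist_nonneg
    rw [Prod.dist_eq]
    refine max_le ?_ ?_
    · simp only [v]
      rw [Real.dist_eq, ← sub_div, abs_div, abs_of_pos (by linarith [hW1 t] : 0 < W t),
        div_le_iff₀ (by linarith [hW1 t])]
      have h1 := abs_clip_sub_clip_le R x.2 y.2
      have h2 := hW1 t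
      have h3 : dist x y ≤ 2 * dist x y * W t := by nlinarith
      nlinarith [mul_nonneg hQ (mul_nonneg hd (by linarith : 0 ≤ W t))]
    · simp only [v]
      rw [Real.dist_eq]
      have := hHL t x.1 y.1
      nlinarith
  have hb : ∀ t x, ‖v t x‖ ≤ 2 * R + Q := by
    intro t x
    rw [Prod.norm_def]
    refine max_le ?_ ?_
    · simp only [v]
      rw [Real.norm_eq_abs, abs_div, abs_of_pos (by linarith [hW1 t] : 0 < W t),
        div_le_iff₀ (by linarith [hW1 t])]
      have h1 := abs_clip_le hR0 x.2
      have h2 := hW1 t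
      nlinarith
    · simp only [v]
      rw [Real.norm_eq_abs]
      linarith [hHQ t x.1]
  have ex : ∀ s : ℝ, ∃ X : ℝ → ℝ × ℝ, X 0 = (s, 0) ∧
      ∀ t ∈ Icc 0 T, HasDerivAt X (v t (X t)) t := by
    intro s
    -- Solving on `[-1, T + 1]` gives two-sided derivatives at `0` and `T`.
    have h0 : (0 : ℝ) ∈ Icc (-1 : ℝ) (T + 1) := ⟨by norm_num, by linarith⟩
    have hPL : IsPicardLindelof v (⟨0, h0⟩ : Icc (-1 : ℝ) (T + 1)) ((s, 0) : ℝ × ℝ)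
        (Real.toNNReal ((2 * R + Q) * (T + 1))) 0 (Real.toNNReal (2 * R + Q))
        (Real.toNNReal (Q + 2)) := by
      refine ⟨fun t _ => (hv t).lipschitzOnWith, ?_, ?_, ?_⟩
      · intro x _
        refine Continuous.continuousOn ?_
        exact (continuous_const.div hW fun t => by linarith [hW1 t]).prodMk (hH x.1)
      · intro t _ x _
        rw [Real.coe_toNNReal _ (by positivity)]
        exact hb t x
      · rw [Real.coe_toNNReal _ (by positivity), Real.coe_toNNReal _ (by positivity)]
        simp only [sub_zero, zero_sub, neg_neg, NNReal.coe_zero]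
        rw [max_eq_left (by linarith)]
    obtain ⟨X, hX0, hX⟩ := hPL.exists_eq_forall_mem_Icc_hasDerivWithinAt₀
    refine ⟨X, hX0, fun t ht => (hX t ⟨by linarith [ht.1], by linarith [ht.2]⟩).hasDerivAt ?_⟩
    exact Icc_mem_nhds (by linarith [ht.1]) (by linarith [ht.2])
  choose X hX0 hX using ex
  have hXc : ∀ s, ContinuousOn (X s) (Icc 0 T) := fun s t ht =>
    (hX s t ht).continuousAt.continuousWithinAt
  have hd1 : ∀ s, ∀ t ∈ Icc 0 T, HasDerivAt (fun t => (X s t).1) (clip R (X s t).2 / W t) t :=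
    fun s t ht => (ContinuousLinearMap.fst ℝ ℝ ℝ).hasFDerivAt.comp_hasDerivAt t (hX s t ht)
  have hd2 : ∀ s, ∀ t ∈ Icc 0 T, HasDerivAt (fun t => (X s t).2) (H t (X s t).1) t :=
    fun s t ht => (ContinuousLinearMap.snd ℝ ℝ ℝ).hasFDerivAt.comp_hasDerivAt t (hX s t ht)
  have hv0 : ∀ t, v t 0 = 0 := by
    intro t
    simp only [v, Prod.fst_zero, Prod.snd_zero, hH0]
    rw [clip_eq_self (by simpa using hR0)]
    simp
  have hpb : ∀ s, ∀ t ∈ Icc 0 T, |(X s t).2| ≤ Q * T := by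
    intro s t ht
    have := norm_image_sub_le_of_norm_deriv_le_segment' (f := fun t => (X s t).2)
      (fun x hx => (hd2 s x hx).hasDerivWithinAt) (C := Q) (fun x _ => hHQ _ _) t ht
    simp only [hX0, sub_zero, Real.norm_eq_abs] at this
    exact this.trans (mul_le_mul_of_nonneg_left ht.2 hQ)
  have hE : (1 : ℝ) ≤ Real.exp ((Q + 2) * T) := Real.one_le_exp (by positivity)
  have gron : ∀ (Y Z : ℝ → ℝ × ℝ), (∀ t ∈ Icc 0 T, HasDerivAt Y (v t (Y t)) t) →
      (∀ t ∈ Icc 0 T, HasDerivAt Z (v t (Z t)) t) → ∀ t ∈ Icc 0 T,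
      dist (Y t) (Z t) ≤ dist (Y 0) (Z 0) * Real.exp ((Q + 2) * T) := by
    intro Y Z hY hZ t ht
    have := dist_le_of_trajectories_ODE (a := 0) (b := T) hv
      (fun t ht => (hY t ht).continuousAt.continuousWithinAt)
      (fun t ht => (hY t (Ico_subset_Icc_self ht)).hasDerivWithinAt)
      (fun t ht => (hZ t ht).continuousAt.continuousWithinAt)
      (fun t ht => (hZ t (Ico_subset_Icc_self ht)).hasDerivWithinAt) le_rfl t ht
    refine this.trans (mul_le_mul_of_nonneg_left (Real.exp_le_exp.2 ?_) dist_nonneg)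
    rw [Real.coe_toNNReal _ (by positivity), sub_zero]
    exact mul_le_mul_of_nonneg_left ht.2 (by positivity)
  have zero_sol : ∀ t ∈ Icc 0 T, HasDerivAt (fun _ : ℝ => (0 : ℝ × ℝ)) (v t 0) t := by
    intro t _
    rw [hv0]
    exact hasDerivAt_const _ _
  refine ⟨Real.exp ((Q + 2) * T), fun s t => (X s t).1, fun s t => (X s t).2, hE,
    fun s => by simp [hX0], fun s => by simp [hX0], ?_, hd2, ?_, ?_, ?_, hpb⟩
  · intro s t ht
    have := hd1 s t ht
    rwa [clip_eq_self (hpb s t ht)] at this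
  · intro s s' t ht
    have h1 := gron (X s) (X s') (hX s) (hX s') t ht
    have h2 : dist (X s 0) (X s' 0) = |s - s'| := by
      rw [hX0, hX0, Prod.dist_eq]; simp [Real.dist_eq]
    rw [h2] at h1
    exact ⟨by rw [← Real.dist_eq]; exact (le_max_left _ _).trans h1,
      by rw [← Real.dist_eq]; exact (le_max_right _ _).trans h1⟩
  · intro s t ht
    have h1 := gron (X s) (fun _ => 0) (hX s) zero_sol t ht
    have h2 : dist (X s 0) (0 : ℝ × ℝ) = |s| := by
      rw [hX0, Prod.dist_eq]; simp
    simp only [h2] at h1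
    have h3 : |(X s t).1| ≤ dist (X s t) 0 := by
      rw [Prod.dist_eq]
      simp
    exact h3.trans h1
  · intro s t ht h1 h2
    have hXt : X s t = 0 := Prod.ext h1 h2
    -- Uniqueness backwards in time: a solution that reaches the origin at `t` is identically zero
    -- on `[0, t]`.
    have := ODE_solution_unique_of_mem_Icc_left (a := 0) (b := t) (f := X s)
      (g := fun _ => (0 : ℝ × ℝ)) (v := v) (s := fun _ => univ) (K := Real.toNNReal (Q + 2))
      (fun t _ => (hv t).lipschitzOnWith)
      ((hXc s).mono (Icc_subset_Icc_right ht.2))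
      (fun x hx => (hX s x ⟨hx.1.le, hx.2.trans ht.2⟩).hasDerivWithinAt) (fun _ _ => trivial)
      continuousOn_const
      (fun x hx => (zero_sol x ⟨hx.1.le, hx.2.trans ht.2⟩).hasDerivWithinAt) (fun _ _ => trivial)
      hXt
    have h0 := this (left_mem_Icc.2 ht.1)
    rw [hX0] at h0
    simpa using congrArg Prod.fst h0

end Flow

end

/-! ### Positive Neumann solutions by shooting -/

noncomputable section

/-- `f` is a positive solution, bounded by one, of the Euler-Lagrange equation with Neumann
conditions on `[0, T]`, and `p = (1 - σ t) f'`. -/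
structure Sol (b T σ α : ℝ) (f p : ℝ → ℝ) : Prop where
  hf : ∀ t ∈ Icc 0 T, HasDerivAt f (p t / wt σ t) t
  hp : ∀ t ∈ Icc 0 T, HasDerivAt p
    ((mom σ α t ^ 2 / wt σ t - wt σ t / b * (1 - f t ^ 2)) * f t) t
  p0 : p 0 = 0
  pT : p T = 0
  pos : ∀ t ∈ Icc 0 T, 0 < f t
  le_one : ∀ t ∈ Icc 0 T, f t ≤ 1

/-- The positive part becomes `C¹` once squared. The proof of `f ≤ 1` and the bulk multiplier use
squared truncations for this reason. -/
theorem hasDerivAt_max_zero_sq (x : ℝ) :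
    HasDerivAt (fun y : ℝ => max 0 y ^ 2) (2 * max 0 x) x := by
  rcases lt_trichotomy x 0 with h | rfl | h
  · rw [max_eq_left h.le, mul_zero]
    refine (hasDerivAt_const x (0 : ℝ)).congr_of_eventuallyEq ?_
    filter_upwards [Iio_mem_nhds h] with y hy
    rw [max_eq_left (le_of_lt hy)]; simp
  · have : (fun y : ℝ => max 0 y ^ 2) =O[nhds 0] fun y => ‖y - 0‖ ^ 2 := by
      refine Asymptotics.IsBigO.of_bound 1 (Filter.Eventually.of_forall fun y => ?_)
      simp only [sub_zero, norm_pow, Real.norm_eq_abs, abs_abs, one_mul]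
      refine pow_le_pow_left₀ (abs_nonneg _) ?_ 2
      rw [abs_of_nonneg (le_max_left _ _)]
      exact max_le (abs_nonneg _) (le_abs_self _)
    simpa using (this.hasFDerivAt (by norm_num)).hasDerivAt
  · rw [max_eq_right h.le]
    have := (hasDerivAt_pow 2 x)
    refine (HasDerivAt.congr_of_eventuallyEq (by simpa using this) ?_)
    filter_upwards [Ioi_mem_nhds h] with y hy
    rw [max_eq_right (le_of_lt hy)]

/-- The logarithmic derivative satisfies a Riccati equation. -/
theorem hasDerivAt_ratio {f p : ℝ → ℝ} {w q t : ℝ} (hw : w ≠ 0) (h0 : f t ≠ 0)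
    (hf : HasDerivAt f (p t / w) t) (hp : HasDerivAt p (q * f t) t) :
    HasDerivAt (fun t => p t / f t) (q - (p t / f t) ^ 2 / w) t := by
  convert! hp.div hf h0 using 1
  field_simp

/-- A positive sub-solution type comparison for the functional. -/
theorem J_ge_of_pos {b T σ α : ℝ} (hT : 0 < T) (hw : ∀ t ∈ Icc 0 T, 0 < wt σ t)
    {f p : ℝ → ℝ} (hf : ∀ t ∈ Icc 0 T, HasDerivAt f (p t / wt σ t) t)
    (hp : ∀ t ∈ Icc 0 T, HasDerivAt p
      ((mom σ α t ^ 2 / wt σ t - wt σ t / b * (1 - f t ^ 2)) * f t) t)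
    (h0 : p 0 = 0) (h1 : 0 ≤ p T) (hpos : ∀ t ∈ Icc 0 T, 0 < f t)
    {g : ℝ → ℝ} (hg : H1on T g) :
    ∫ t in (0 : ℝ)..T, (wt σ t / (2 * b) * g t ^ 4 - wt σ t / b * f t ^ 2 * g t ^ 2)
      ≤ J b T σ α g := by
  have hfc : ContinuousOn f (Icc 0 T) := fun t ht => (hf t ht).continuousAt.continuousWithinAt
  have hpc : ContinuousOn p (Icc 0 T) := fun t ht => (hp t ht).continuousAt.continuousWithinAt
  have c1 := (continuous_wt σ).continuousOn (s := Icc 0 T)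
  have c2 := (continuous_mom σ α).continuousOn (s := Icc 0 T)
  have hw' : ∀ t ∈ Icc 0 T, wt σ t ≠ 0 := fun t ht => (hw t ht).ne'
  have hf' : ∀ t ∈ Icc 0 T, f t ≠ 0 := fun t ht => (hpos t ht).ne'
  have hT' : T ∈ Icc 0 T := right_mem_Icc.2 hT.le
  refine le_trans (le_of_eq ?_) (J_ge hT hw hg (φ := fun t => p t / f t)
    (fun t ht => hasDerivAt_ratio (hw' t ht) (hf' t ht) (hf t ht) (hp t ht)) ?_ ?_ ?_)
  · apply intervalIntegral.integral_congr
    intro t ht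
    rw [uIcc_of_le hT.le] at ht
    have := hw' t ht
    have := hf' t ht
    simp only
    ring
  · exact (((c2.pow 2).div c1 hw').sub ((c1.div_const b).mul
      (continuousOn_const.sub (hfc.pow 2)))).sub (((hpc.div hfc hf').pow 2).div c1 hw')
  · simp [h0]
  · exact div_nonneg h1 (hpos T hT').le

/-- If the functional takes negative values, the Euler-Lagrange equation has a positive
solution. -/
theorem exists_sol {b T σ α : ℝ} (hb : 1 < b) (hT : 0 < T)
    (hw : ∀ t ∈ Icc 0 T, 1 / 2 ≤ wt σ t ∧ wt σ t ≤ 2) {g : ℝ → ℝ} (hg : H1on T g)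
    (hJ : J b T σ α g < 0) : ∃ f p, Sol b T σ α f p := by
  have hw0 : ∀ t ∈ Icc 0 T, 0 < wt σ t := fun t ht => by linarith [(hw t ht).1]
  obtain ⟨B, hB⟩ := isCompact_Icc.exists_bound_of_continuousOn
    ((continuous_mom σ α).continuousOn (s := Icc 0 T))
  have hB0 : 0 ≤ B := (norm_nonneg _).trans (hB 0 (left_mem_Icc.2 hT.le))
  -- The bounds on the coefficients hold only on `[0, T]`, whereas `exists_flow` asks for them on
  -- the whole line; composing with the projection onto `[0, T]` supplies them.
  set cl : ℝ → ℝ := fun t => max 0 (min t T) with hcl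
  have hclm : ∀ t, cl t ∈ Icc 0 T := fun t =>
    ⟨le_max_left _ _, max_le hT.le (min_le_right _ _)⟩
  have hcle : ∀ t ∈ Icc 0 T, cl t = t := by
    intro t ht
    simp only [hcl]
    rw [min_eq_left ht.2, max_eq_right ht.1]
  have hclc : Continuous cl := by fun_prop
  set W : ℝ → ℝ := fun t => wt σ (cl t) with hWdef
  set A : ℝ → ℝ := fun t => mom σ α (cl t) with hAdef
  have hWc : Continuous W := (continuous_wt σ).comp hclc
  have hAc : Continuous A := (continuous_mom σ α).comp hclc
  have hW1 : ∀ t, 1 / 2 ≤ W t := fun t => (hw _ (hclm t)).1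
  have hW2 : ∀ t, W t ≤ 2 := fun t => (hw _ (hclm t)).2
  have hA2 : ∀ t, A t ^ 2 ≤ B ^ 2 := fun t => sq_le_sq' (by
    have := hB _ (hclm t); rw [Real.norm_eq_abs, abs_le] at this; exact this.1) (by
    have := hB _ (hclm t); rw [Real.norm_eq_abs, abs_le] at this; exact this.2)
  have hAW : ∀ t, 0 ≤ A t ^ 2 / W t ∧ A t ^ 2 / W t ≤ 2 * B ^ 2 := by
    intro t
    have h1 := hW1 t
    have h2 := hA2 t
    refine ⟨div_nonneg (sq_nonneg _) (by linarith), ?_⟩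
    rw [div_le_iff₀ (by linarith)]
    nlinarith [sq_nonneg B]
  have hWb : ∀ t, 0 ≤ W t / b ∧ W t / b ≤ 2 := by
    intro t
    refine ⟨div_nonneg (by linarith [hW1 t]) (by linarith), ?_⟩
    rw [div_le_iff₀ (by linarith)]
    nlinarith [hW2 t]
  -- For `0 ≤ x ≤ 1` this is the true right-hand side. For `x ≥ 1` the nonlinear part vanishes,
  -- since `clip 1 x = 1`, and the nonnegative value `A² / W` remains; this drives both the start of
  -- the shooting and the bound `f ≤ 1`.
  set H : ℝ → ℝ → ℝ := fun t x => A t ^ 2 / W t * clip 1 x - W t / b * (clip 1 x - clip 1 x ^ 3)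
    with hHdef
  set Q : ℝ := 2 * B ^ 2 + 4 with hQdef
  have hcl1 : ∀ x, -1 ≤ clip 1 x ∧ clip 1 x ≤ 1 := fun x => abs_le.1 (abs_clip_le zero_le_one x)
  have hHQ : ∀ t x, |H t x| ≤ Q := by
    intro t x
    obtain ⟨y1, y2⟩ := hcl1 x
    simp only [hHdef]
    generalize clip 1 x = y at y1 y2
    refine (abs_sub _ _).trans ?_
    rw [abs_mul, abs_mul, abs_of_nonneg (hAW t).1, abs_of_nonneg (hWb t).1]
    have e1 : |y| ≤ 1 := abs_le.2 ⟨y1, y2⟩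
    have e2 : |y - y ^ 3| ≤ 2 := abs_le.2 ⟨by nlinarith [sq_nonneg y], by nlinarith [sq_nonneg y]⟩
    have := mul_le_mul (hAW t).2 e1 (abs_nonneg _) (by positivity)
    have := mul_le_mul (hWb t).2 e2 (abs_nonneg _) (by positivity)
    linarith
  have hHL : ∀ t x y, |H t x - H t y| ≤ Q * |x - y| := by
    intro t x y
    have hxy := abs_clip_sub_clip_le 1 x y
    obtain ⟨x1, x2⟩ := hcl1 x
    obtain ⟨y1, y2⟩ := hcl1 y
    simp only [hHdef]
    generalize clip 1 x = u at *
    generalize clip 1 y = v at *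
    have e : A t ^ 2 / W t * u - W t / b * (u - u ^ 3) - (A t ^ 2 / W t * v - W t / b * (v - v ^ 3))
        = (A t ^ 2 / W t - W t / b * (1 - (u ^ 2 + u * v + v ^ 2))) * (u - v) := by ring
    rw [e, abs_mul]
    refine mul_le_mul ?_ hxy (abs_nonneg _) (by positivity)
    refine (abs_sub _ _).trans ?_
    rw [abs_mul, abs_of_nonneg (hAW t).1, abs_of_nonneg (hWb t).1]
    have e2 : |1 - (u ^ 2 + u * v + v ^ 2)| ≤ 2 :=
      abs_le.2 ⟨by nlinarith, by nlinarith [sq_nonneg (u + v), sq_nonneg (u - v)]⟩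
    have := mul_le_mul (hWb t).2 e2 (abs_nonneg _) (by positivity)
    linarith [(hAW t).2]
  have hHc : ∀ x, Continuous fun t => H t x := by
    intro x
    exact (((hAc.pow 2).div hWc fun t => by linarith [hW1 t]).mul continuous_const).sub
      ((hWc.div_const b).mul continuous_const)
  have hH0 : ∀ t, H t 0 = 0 := by
    intro t
    simp only [hHdef]
    rw [clip_eq_self (by simp)]
    simp
  have hHin : ∀ t x, 0 ≤ x → x ≤ 1 → H t x = (A t ^ 2 / W t - W t / b * (1 - x ^ 2)) * x := by
    intro t x h0 h1
    simp only [hHdef]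
    rw [clip_eq_self (abs_le.2 ⟨by linarith, h1⟩)]
    ring
  have hHout : ∀ t x, 1 ≤ x → H t x = A t ^ 2 / W t := by
    intro t x h1
    simp only [hHdef]
    rw [clip_one_of_one_le h1]
    ring
  obtain ⟨E, f, p, hE, hf0, hp0, hf, hp, hlip, hbd, huniq, hpb⟩ :=
    exists_flow hT hWc hW1 hHc hHQ hHL hH0
  have hTm : T ∈ Icc 0 T := right_mem_Icc.2 hT.le
  have h0m : (0 : ℝ) ∈ Icc 0 T := left_mem_Icc.2 hT.le
  have hE0 : 0 < E := by linarith
  -- The shooting set: initial values whose trajectory stays positive and arrives with nonnegative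
  -- slope. Its infimum will give the Neumann condition at `T`.
  set S : Set ℝ := {s | 0 < s ∧ (∀ t ∈ Icc 0 T, 0 < f s t) ∧ 0 ≤ p s T} with hS
  -- large initial values belong to `S`
  have hSne : S.Nonempty := by
    -- As `|f'| = |p / W| ≤ 2 Q T`, starting from this height keeps `f ≥ 1` throughout, where `p' =
    -- A² / W ≥ 0`.
    set s := 1 + 2 * (Q * T) * T with hs
    have hQ0 : 0 ≤ Q := by positivity
    have hfl : ∀ t ∈ Icc 0 T, 1 ≤ f s t := by
      intro t ht
      have := norm_image_sub_le_of_norm_deriv_le_segment' (f := f s)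
        (fun x hx => (hf s x hx).hasDerivWithinAt) (C := 2 * (Q * T)) (fun x hx => by
          rw [Real.norm_eq_abs, abs_div, abs_of_pos (by linarith [hW1 x] : 0 < W x),
            div_le_iff₀ (by linarith [hW1 x])]
          have h1 := hpb s x (Ico_subset_Icc_self hx)
          have h2 := hW1 x
          have : 0 ≤ Q * T := by positivity
          nlinarith) t ht
      rw [hf0, Real.norm_eq_abs, abs_le] at this
      have h3 : 2 * (Q * T) * (t - 0) ≤ 2 * (Q * T) * T :=
        mul_le_mul_of_nonneg_left (by linarith [ht.2]) (by positivity)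
      linarith [this.1]
    have hmono : MonotoneOn (p s) (Icc 0 T) := by
      apply monotoneOn_of_deriv_nonneg (convex_Icc _ _)
      · exact fun t ht => (hp s t ht).continuousAt.continuousWithinAt
      · intro t ht
        rw [interior_Icc] at ht
        exact (hp s t (Ioo_subset_Icc_self ht)).differentiableAt.differentiableWithinAt
      · intro t ht
        rw [interior_Icc] at ht
        rw [(hp s t (Ioo_subset_Icc_self ht)).deriv, hHout t _ (hfl t (Ioo_subset_Icc_self ht))]
        exact (hAW t).1
    refine ⟨s, by positivity, fun t ht => by linarith [hfl t ht], ?_⟩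
    have := hmono h0m hTm hT.le
    rwa [hp0] at this
  -- small initial values do not
  obtain ⟨δ, hδ, hSδ⟩ : ∃ δ > 0, ∀ s ∈ S, δ ≤ s := by
    set G := ∫ t in (0 : ℝ)..T, g t ^ 2 with hG
    have hG0 : 0 ≤ G := intervalIntegral.integral_nonneg hT.le fun t _ => sq_nonneg _
    -- If `s ∈ S` were below both values, then `f s ≤ s E < 1`, so the cutoff is inactive and
    -- `J_ge_of_pos` applies to `f s`. It gives `J g ≥ -2 (s E)² G`, which exceeds the given
    -- negative value `J g`.
    refine ⟨min (1 / E) (-J b T σ α g / (2 * E ^ 2 * G + 1)), lt_min (by positivity)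
      (div_pos (by linarith) (by positivity)), fun s hs => ?_⟩
    by_contra! hlt
    obtain ⟨hs0, hsp, hsT⟩ := hs
    have hs1 : s * E < 1 := by
      have := hlt.trans_le (min_le_left _ _)
      rwa [lt_div_iff₀ hE0] at this
    have hs2 := hlt.trans_le (min_le_right _ _)
    rw [lt_div_iff₀ (by positivity)] at hs2
    have hfs : ∀ t ∈ Icc 0 T, f s t ≤ s * E := fun t ht => by
      have := hbd s t ht
      rw [abs_of_pos hs0] at this
      exact (le_abs_self _).trans this
    have key := J_ge_of_pos (b := b) (α := α) hT hw0 (f := f s) (p := p s)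
      (fun t ht => by have := hf s t ht; simp only [hWdef, hcle t ht] at this; exact this)
      (fun t ht => by
        have := hp s t ht
        rw [hHin t _ (hsp t ht).le ((hfs t ht).trans hs1.le)] at this
        simp only [hWdef, hAdef, hcle t ht] at this; exact this)
      (hp0 s) hsT hsp hg
    have hgc := hg.continuousOn hT.le
    have hfc : ContinuousOn (f s) (Icc 0 T) :=
      fun t ht => (hf s t ht).continuousAt.continuousWithinAt
    have c1 := (continuous_wt σ).continuousOn (s := Icc 0 T)
    have : ∫ t in (0 : ℝ)..T, (-(2 * (s * E) ^ 2)) * g t ^ 2 ≤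
        ∫ t in (0 : ℝ)..T, (wt σ t / (2 * b) * g t ^ 4 - wt σ t / b * f s t ^ 2 * g t ^ 2) := by
      apply intervalIntegral.integral_mono_on hT.le
      · exact intervalIntegrable_of_continuousOn_Icc hT.le (continuousOn_const.mul (hgc.pow 2))
      · exact intervalIntegrable_of_continuousOn_Icc hT.le
          (((c1.div_const _).mul (hgc.pow 4)).sub
            (((c1.div_const _).mul (hfc.pow 2)).mul (hgc.pow 2)))
      · intro t ht
        have h1 : 0 ≤ wt σ t / (2 * b) * g t ^ 4 := by
          have := (hw0 t ht).le
          positivity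
        have h2 : wt σ t / b ≤ 2 := by
          rw [div_le_iff₀ (by linarith)]; nlinarith [(hw t ht).2]
        have h2' : 0 ≤ wt σ t / b := div_nonneg (hw0 t ht).le (by linarith)
        have h3 : f s t ^ 2 ≤ (s * E) ^ 2 := pow_le_pow_left₀ (hsp t ht).le (hfs t ht) 2
        have h4 : wt σ t / b * f s t ^ 2 ≤ 2 * (s * E) ^ 2 :=
          mul_le_mul h2 h3 (sq_nonneg _) (by norm_num)
        nlinarith [mul_le_mul_of_nonneg_right h4 (sq_nonneg (g t))]
    rw [intervalIntegral.integral_const_mul, ← hG] at this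
    have hsl : s ≤ 1 := by nlinarith
    have : (s * E) ^ 2 * G ≤ s * (E ^ 2 * G) := by
      have : 0 ≤ E ^ 2 * G := by positivity
      nlinarith [mul_nonneg hs0.le this]
    nlinarith
  have hSbdd : BddBelow S := ⟨δ, hSδ⟩
  set s := sInf S with hs
  have hsδ : δ ≤ s := le_csInf hSne hSδ
  have hs0 : 0 < s := hδ.trans_le hsδ
  have happrox : ∀ η > 0, ∃ s' ∈ S, s ≤ s' ∧ s' < s + η := by
    intro η hη
    obtain ⟨s', h1, h2⟩ := Real.lt_sInf_add_pos hSne hη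
    exact ⟨s', h1, csInf_le hSbdd h1, h2⟩
  have hge : ∀ t ∈ Icc 0 T, 0 ≤ f s t := by
    intro t ht
    by_contra! hneg
    obtain ⟨s', h1, h2, h3⟩ := happrox (-f s t / E) (div_pos (by linarith) hE0)
    have h4 := (hlip s' s t ht).1
    rw [abs_of_nonneg (by linarith : 0 ≤ s' - s), abs_le] at h4
    have h5 : (s' - s) * E < -f s t := by
      rw [← lt_div_iff₀ hE0]; linarith
    linarith [h1.2.1 t ht, h4.2]
  have hpT : 0 ≤ p s T := by
    by_contra! hneg
    obtain ⟨s', h1, h2, h3⟩ := happrox (-p s T / E) (div_pos (by linarith) hE0)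
    have h4 := (hlip s' s T hTm).2
    rw [abs_of_nonneg (by linarith : 0 ≤ s' - s), abs_le] at h4
    have h5 : (s' - s) * E < -p s T := by
      rw [← lt_div_iff₀ hE0]; linarith
    linarith [h1.2.2, h4.2]
  -- A zero of the limit trajectory is a minimum. In the interior this forces `p = 0`; at `T` the
  -- one-sided minimum gives `p ≤ 0`, against `p T ≥ 0`. Either way `f = p = 0` there, and the
  -- trajectory would start at `s = 0`.
  have hpos : ∀ t ∈ Icc 0 T, 0 < f s t := by
    intro t ht
    refine (hge t ht).lt_of_ne fun h0 => ?_
    have ht0 : 0 < t := by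
      refine ht.1.lt_of_ne ?_
      rintro rfl
      rw [hf0] at h0
      exact hs0.ne h0
    refine hs0.ne' (huniq s t ht h0.symm ?_)
    have hWt : 0 < W t := by linarith [hW1 t]
    rcases ht.2.lt_or_eq with htT | rfl
    · have hmin : IsLocalMin (f s) t := by
        filter_upwards [Icc_mem_nhds ht0 htT] with x hx
        rw [← h0]
        exact hge x hx
      have := hmin.hasDerivAt_eq_zero (hf s t ht)
      rw [div_eq_zero_iff] at this
      exact this.resolve_right hWt.ne'
    · refine le_antisymm ?_ hpT
      have hmin : IsLocalMinOn (f s) (Icc 0 t) t := by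
        filter_upwards [self_mem_nhdsWithin] with x hx
        rw [← h0]
        exact hge x hx
      have := hmin.hasFDerivWithinAt_nonneg (hf s t ht).hasFDerivAt.hasFDerivWithinAt
        (y := 0 - t) (sub_mem_posTangentConeAt_of_segment_subset (by
          rw [segment_symm, segment_eq_Icc ht0.le]))
      simp only [ContinuousLinearMap.toSpanSingleton_apply, smul_eq_mul, zero_sub] at this
      have h1 : p s t / W t ≤ 0 := by nlinarith
      by_contra! h2
      linarith [div_pos h2 hWt]
  -- If `p T > 0`, positivity of `f` and of `p T` would survive a slightly smaller initial value,
  -- contradicting the infimum.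
  have hpT0 : p s T = 0 := by
    refine le_antisymm ?_ hpT
    by_contra! hgt
    have hfc : ContinuousOn (f s) (Icc 0 T) :=
      fun t ht => (hf s t ht).continuousAt.continuousWithinAt
    obtain ⟨tm, htm, hmin⟩ := isCompact_Icc.exists_isMinOn ⟨0, h0m⟩ hfc
    set m := min (min (f s tm) (p s T)) (s * E) with hm
    have hm0 : 0 < m := lt_min (lt_min (hpos tm htm) hgt) (by positivity)
    set s' := s - m / (2 * E) with hs'
    have hd : 0 < m / (2 * E) := by positivity
    have hdE : m / (2 * E) * E = m / 2 := by field_simp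
    have hdd : |s' - s| * E = m / 2 := by
      rw [hs', sub_sub_cancel_left, abs_neg, abs_of_pos hd, hdE]
    have : s' ∈ S := by
      refine ⟨?_, ?_, ?_⟩
      · have : m / (2 * E) < s := by
          rw [div_lt_iff₀ (by positivity)]
          have : m ≤ s * E := min_le_right _ _
          nlinarith
        linarith
      · intro t ht
        have h1 := (hlip s' s t ht).1
        rw [hdd, abs_le] at h1
        have h2 : f s tm ≤ f s t := hmin ht
        have h3 : m ≤ f s tm := (min_le_left _ _).trans (min_le_left _ _)
        linarith [h1.1]
      · have h1 := (hlip s' s T hTm).2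
        rw [hdd, abs_le] at h1
        have h3 : m ≤ p s T := (min_le_left _ _).trans (min_le_right _ _)
        linarith [h1.1]
    have := csInf_le hSbdd this
    linarith
  have hle : ∀ t ∈ Icc 0 T, f s t ≤ 1 := by
    -- the function `p ((f - 1)₊)²` is nondecreasing and vanishes at both ends
    have hsq : ∀ x : ℝ, HasDerivAt (fun y : ℝ => max 0 (y - 1) ^ 2) (2 * max 0 (x - 1)) x := by
      intro x
      have := (hasDerivAt_max_zero_sq (x - 1)).comp x ((hasDerivAt_id x).sub_const 1)
      rw [mul_one] at this
      exact this
    set I : ℝ → ℝ := fun t => p s t * max 0 (f s t - 1) ^ 2 with hI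
    have hId : ∀ t ∈ Icc 0 T, HasDerivAt I (H t (f s t) * max 0 (f s t - 1) ^ 2
        + p s t * (2 * max 0 (f s t - 1) * (p s t / W t))) t := by
      intro t ht
      exact (hp s t ht).mul ((hsq (f s t)).comp t (hf s t ht))
    have hterm1 : ∀ t, 0 ≤ H t (f s t) * max 0 (f s t - 1) ^ 2 := by
      intro t
      rcases le_total (f s t) 1 with h | h
      · rw [max_eq_left (by linarith)]; simp
      · rw [hHout t _ h]
        exact mul_nonneg (hAW t).1 (sq_nonneg _)
    have hterm2 : ∀ t, 0 ≤ p s t * (2 * max 0 (f s t - 1) * (p s t / W t)) := by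
      intro t
      have h1 : 0 ≤ max 0 (f s t - 1) := le_max_left _ _
      have h2 : 0 < W t := by linarith [hW1 t]
      rw [show p s t * (2 * max 0 (f s t - 1) * (p s t / W t))
        = 2 * max 0 (f s t - 1) * (p s t ^ 2 / W t) by ring]
      positivity
    have hmono : MonotoneOn I (Icc 0 T) := by
      apply monotoneOn_of_deriv_nonneg (convex_Icc _ _)
      · exact fun t ht => (hId t ht).continuousAt.continuousWithinAt
      · intro t ht
        rw [interior_Icc] at ht
        exact (hId t (Ioo_subset_Icc_self ht)).differentiableAt.differentiableWithinAt
      · intro t ht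
        rw [interior_Icc] at ht
        rw [(hId t (Ioo_subset_Icc_self ht)).deriv]
        exact add_nonneg (hterm1 t) (hterm2 t)
    have hIz : ∀ t ∈ Icc 0 T, I t = 0 := by
      intro t ht
      have h1 := hmono h0m ht ht.1
      have h2 := hmono ht hTm ht.2
      simp only [hI, hp0, hpT0, zero_mul] at h1 h2
      exact le_antisymm h2 h1
    -- The monotone function `I` vanishes at both ends, hence identically, so both nonnegative terms
    -- of its derivative vanish. Where `f > 1` this forces `A = 0`, impossible at two points since
    -- `mom` is strictly increasing.
    have hAz : ∀ t ∈ Ioo 0 T, 1 < f s t → A t = 0 := by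
      intro t ht h1
      have h2 : HasDerivAt I 0 t := by
        refine (hasDerivAt_const t (0 : ℝ)).congr_of_eventuallyEq ?_
        filter_upwards [Ioo_mem_nhds ht.1 ht.2] with x hx using hIz x (Ioo_subset_Icc_self hx)
      have h3 := (hId t (Ioo_subset_Icc_self ht)).unique h2
      have h4 : H t (f s t) * max 0 (f s t - 1) ^ 2 = 0 := by
        linarith [hterm1 t, hterm2 t]
      rw [hHout t _ h1.le, max_eq_right (by linarith)] at h4
      have h5 : (f s t - 1) ^ 2 ≠ 0 := pow_ne_zero _ (by linarith)
      have h6 : W t ≠ 0 := by linarith [hW1 t]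
      have h7 := (mul_eq_zero.1 h4).resolve_right h5
      rw [div_eq_zero_iff] at h7
      exact pow_eq_zero_iff (two_ne_zero) |>.1 (h7.resolve_right h6)
    intro t ht
    by_contra! hgt
    have hfc : ContinuousOn (f s) (Icc 0 T) :=
      fun t ht => (hf s t ht).continuousAt.continuousWithinAt
    obtain ⟨η, hη, hball⟩ := Metric.mem_nhdsWithin_iff.1 ((hfc t ht).preimage_mem_nhdsWithin
      (Ioi_mem_nhds hgt))
    obtain ⟨x, y, hx, hy, hxy, hxt, hyt⟩ : ∃ x y, x ∈ Ioo 0 T ∧ y ∈ Ioo 0 T ∧ x < y ∧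
        |x - t| < η ∧ |y - t| < η := by
      rcases lt_or_ge t T with h | h
      · have hm : 0 < min η (T - t) := lt_min hη (by linarith)
        have hm1 := min_le_left η (T - t)
        have hm2 := min_le_right η (T - t)
        refine ⟨t + min η (T - t) / 3, t + min η (T - t) / 2, ⟨?_, ?_⟩, ⟨?_, ?_⟩, ?_, ?_, ?_⟩ <;>
          first | linarith [ht.1] | (rw [abs_lt]; constructor <;> linarith)
      · have hm : 0 < min η t := lt_min hη (by linarith)
        have hm1 := min_le_left η t
        have hm2 := min_le_right η t
        refine ⟨t - min η t / 2, t - min η t / 3, ⟨?_, ?_⟩, ⟨?_, ?_⟩, ?_, ?_, ?_⟩ <;>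
          first | linarith [ht.2] | (rw [abs_lt]; constructor <;> linarith)
    have hAx := hAz x hx (hball ⟨by rwa [Metric.mem_ball, Real.dist_eq], Ioo_subset_Icc_self hx⟩)
    have hAy := hAz y hy (hball ⟨by rwa [Metric.mem_ball, Real.dist_eq], Ioo_subset_Icc_self hy⟩)
    have hstrict : StrictMonoOn (mom σ α) (Icc 0 T) := by
      apply strictMonoOn_of_deriv_pos (convex_Icc _ _) (continuous_mom σ α).continuousOn
      intro x hx
      rw [interior_Icc] at hx
      rw [(hasDerivAt_mom σ α x).deriv]
      exact hw0 x (Ioo_subset_Icc_self hx)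
    have := hstrict (Ioo_subset_Icc_self hx) (Ioo_subset_Icc_self hy) hxy
    simp only [hAdef, hcle x (Ioo_subset_Icc_self hx), hcle y (Ioo_subset_Icc_self hy)] at hAx hAy
    linarith
  refine ⟨f s, p s, ?_, ?_, hp0 s, hpT0, hpos, hle⟩
  · intro t ht
    have := hf s t ht
    simp only [hWdef, hcle t ht] at this
    exact this
  · intro t ht
    have := hp s t ht
    rw [hHin t _ (hpos t ht).le (hle t ht)] at this
    simp only [hWdef, hAdef, hcle t ht] at this
    exact this

end

/-! ### Energy at fixed phase: uniqueness, splitting, and the current -/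

noncomputable section

/-- A primitive, differentiable on both sides of the end points. -/
theorem exists_primitive {T : ℝ} (hT : 0 < T) {φ : ℝ → ℝ} (hφ : ContinuousOn φ (Icc 0 T)) :
    ∃ F : ℝ → ℝ, F 0 = 0 ∧ (∀ t ∈ Icc 0 T, HasDerivAt F (φ t) t) ∧
      F T = ∫ t in (0 : ℝ)..T, φ t := by
  set ψ : ℝ → ℝ := fun t => IccExtend hT.le ((Icc 0 T).domRestrict φ) t with hψ
  have hc : Continuous ψ := (continuousOn_iff_continuous_domRestrict.1 hφ).Icc_extend'
  have he : ∀ t ∈ Icc 0 T, ψ t = φ t := fun t ht => by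
    simp only [hψ]; rw [IccExtend_of_mem hT.le _ ht]; rfl
  refine ⟨fun t => ∫ s in (0 : ℝ)..t, ψ s, by simp, fun t ht => ?_, ?_⟩
  · rw [← he t ht]
    exact (hc.integral_hasStrictDerivAt 0 t).hasDerivAt
  · apply intervalIntegral.integral_congr
    intro t ht
    rw [uIcc_of_le hT.le] at ht
    exact he t ht

/-- The ground state energy at fixed phase. -/
def Emin (b T σ α : ℝ) : ℝ := sInf (J b T σ α '' {f | H1on T f})

theorem E1D_eq_Emin (b c₀ ε k α : ℝ) :
    E1D b c₀ ε k α = Emin b (tEps c₀ ε) (ε * k) α := by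
  unfold E1D Emin
  congr 1
  ext x
  simp only [mem_image, energy_eq_J]
  rfl

section

variable {b T σ α : ℝ}

theorem J_lower_bound (hb : 1 < b) (hT : 0 < T)
    (hw : ∀ t ∈ Icc 0 T, 1 / 2 ≤ wt σ t ∧ wt σ t ≤ 2) {g : ℝ → ℝ} (hg : H1on T g) :
    -T ≤ J b T σ α g := by
  have hw0 : ∀ t ∈ Icc 0 T, 0 < wt σ t := fun t ht => by linarith [(hw t ht).1]
  have h1 : ∫ t in (0 : ℝ)..T, (-1 : ℝ) = -T := by simp
  rw [← h1]
  apply intervalIntegral.integral_mono_on hT.le (by simp) (J_integrable b σ α hT.le hw0 hg)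
  intro t ht
  have h2 := (hw t ht)
  have h3 : 0 ≤ mom σ α t ^ 2 / wt σ t ^ 2 * g t ^ 2 := by positivity
  have h4 : 1 / (2 * b) * (2 * g t ^ 2 - g t ^ 4) ≤ 1 / 2 := by
    have e1 : 2 * g t ^ 2 - g t ^ 4 ≤ 1 := by nlinarith [sq_nonneg (g t ^ 2 - 1)]
    have e2 : 1 / (2 * b) ≤ 1 / 2 := by
      apply one_div_le_one_div_of_le <;> linarith
    have e3 : 0 < 1 / (2 * b) := by positivity
    nlinarith
  nlinarith [sq_nonneg (deriv g t), mul_nonneg (by linarith : 0 ≤ wt σ t)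
    (add_nonneg (sq_nonneg (deriv g t)) h3)]

theorem bddBelow_J (hb : 1 < b) (hT : 0 < T)
    (hw : ∀ t ∈ Icc 0 T, 1 / 2 ≤ wt σ t ∧ wt σ t ≤ 2) :
    BddBelow (J b T σ α '' {f | H1on T f}) :=
  ⟨-T, by rintro _ ⟨g, hg, rfl⟩; exact J_lower_bound hb hT hw hg⟩

theorem H1on_zero (hT : 0 < T) : H1on T (fun _ => 0) :=
  H1on_of_hasDerivAt hT (φ' := fun _ => 0) (fun t _ => hasDerivAt_const t 0) continuousOn_const

theorem J_zero : J b T σ α (fun _ => 0) = 0 := by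
  simp [J]

theorem Emin_le (hb : 1 < b) (hT : 0 < T)
    (hw : ∀ t ∈ Icc 0 T, 1 / 2 ≤ wt σ t ∧ wt σ t ≤ 2) {g : ℝ → ℝ} (hg : H1on T g) :
    Emin b T σ α ≤ J b T σ α g := csInf_le (bddBelow_J hb hT hw) ⟨g, hg, rfl⟩

theorem le_Emin (hT : 0 < T) {x : ℝ} (h : ∀ g, H1on T g → x ≤ J b T σ α g) :
    x ≤ Emin b T σ α := by
  refine le_csInf ⟨_, _, H1on_zero hT, rfl⟩ ?_
  rintro _ ⟨g, hg, rfl⟩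
  exact h g hg

/-- Dependence of the functional on the phase. -/
theorem J_add_phase (hT : 0 < T) (hw : ∀ t ∈ Icc 0 T, 0 < wt σ t) {g : ℝ → ℝ} (hg : H1on T g)
    (δ : ℝ) : J b T σ (α + δ) g = J b T σ α g + δ * (∫ t in (0 : ℝ)..T, 2 * mom σ α t / wt σ t * g t ^ 2)
      + δ ^ 2 * ∫ t in (0 : ℝ)..T, g t ^ 2 / wt σ t := by
  have hgc := hg.continuousOn hT.le
  have c1 := (continuous_wt σ).continuousOn (s := Icc 0 T)
  have c2 := (continuous_mom σ α).continuousOn (s := Icc 0 T)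
  have hw' : ∀ t ∈ Icc 0 T, wt σ t ≠ 0 := fun t ht => (hw t ht).ne'
  have i1 : IntervalIntegrable (fun t => δ * (2 * mom σ α t / wt σ t * g t ^ 2)) volume 0 T :=
    intervalIntegrable_of_continuousOn_Icc hT.le
      (continuousOn_const.mul (((continuousOn_const.mul c2).div c1 hw').mul (hgc.pow 2)))
  have i2 : IntervalIntegrable (fun t => δ ^ 2 * (g t ^ 2 / wt σ t)) volume 0 T :=
    intervalIntegrable_of_continuousOn_Icc hT.le
      (continuousOn_const.mul ((hgc.pow 2).div c1 hw'))
  rw [← intervalIntegral.integral_const_mul, ← intervalIntegral.integral_const_mul]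
  unfold J
  rw [← intervalIntegral.integral_add (J_integrable b σ α hT.le hw hg) i1,
    ← intervalIntegral.integral_add ((J_integrable b σ α hT.le hw hg).add i1) i2]
  apply intervalIntegral.integral_congr
  intro t ht
  rw [uIcc_of_le hT.le] at ht
  have := hw' t ht
  have e : mom σ (α + δ) t = mom σ α t + δ := by unfold mom; ring
  simp only [e]
  field_simp
  ring

namespace Sol

variable {f p : ℝ → ℝ}

theorem continuousOn_f (h : Sol b T σ α f p) : ContinuousOn f (Icc 0 T) :=
  fun t ht => (h.hf t ht).continuousAt.continuousWithinAt

theorem continuousOn_p (h : Sol b T σ α f p) : ContinuousOn p (Icc 0 T) :=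
  fun t ht => (h.hp t ht).continuousAt.continuousWithinAt

theorem h1on (h : Sol b T σ α f p) (hT : 0 < T) (hw : ∀ t ∈ Icc 0 T, 0 < wt σ t) : H1on T f :=
  H1on_of_hasDerivAt hT h.hf (h.continuousOn_p.div (continuous_wt σ).continuousOn
    fun t ht => (hw t ht).ne')

/-- The energy of a solution of the Euler-Lagrange equation. -/
theorem J_self (h : Sol b T σ α f p) (hT : 0 < T) (hw : ∀ t ∈ Icc 0 T, 0 < wt σ t) :
    J b T σ α f = -∫ t in (0 : ℝ)..T, wt σ t / (2 * b) * f t ^ 4 := by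
  have hw' : ∀ t ∈ Icc 0 T, wt σ t ≠ 0 := fun t ht => (hw t ht).ne'
  have hf' : ∀ t ∈ Icc 0 T, f t ≠ 0 := fun t ht => (h.pos t ht).ne'
  have c1 := (continuous_wt σ).continuousOn (s := Icc 0 T)
  have c2 := (continuous_mom σ α).continuousOn (s := Icc 0 T)
  have hfc := h.continuousOn_f
  have hpc := h.continuousOn_p
  rw [J_eq hT hw (h.h1on hT hw) (φ := fun t => p t / f t)
    (fun t ht => hasDerivAt_ratio (hw' t ht) (hf' t ht) (h.hf t ht) (h.hp t ht))
    ((((c2.pow 2).div c1 hw').sub ((c1.div_const b).mul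
      (continuousOn_const.sub (hfc.pow 2)))).sub (((hpc.div hfc hf').pow 2).div c1 hw'))]
  have e1 : ∫ t in (0 : ℝ)..T, wt σ t * (deriv f t - p t / f t * f t / wt σ t) ^ 2 = 0 := by
    rw [intervalIntegral.integral_congr (g := fun _ => 0), intervalIntegral.integral_zero]
    intro t ht
    rw [uIcc_of_le hT.le] at ht
    have := hf' t ht
    simp only [(h.hf t ht).deriv]
    rw [div_mul_cancel₀ _ this]
    simp
  rw [e1, h.p0, h.pT, ← intervalIntegral.integral_neg]
  simp only [zero_div, zero_mul, sub_zero, zero_add]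
  apply intervalIntegral.integral_congr
  intro t ht
  rw [uIcc_of_le hT.le] at ht
  have := hf' t ht
  simp only
  ring

theorem integrable_defect (h : Sol b T σ α f p) (hT : 0 < T) {g : ℝ → ℝ} (hg : H1on T g) :
    IntervalIntegrable (fun t => wt σ t / (2 * b) * (f t ^ 2 - g t ^ 2) ^ 2) volume 0 T := by
  have c1 := (continuous_wt σ).continuousOn (s := Icc 0 T)
  exact intervalIntegrable_of_continuousOn_Icc hT.le ((c1.div_const _).mul
    (((h.continuousOn_f.pow 2).sub ((hg.continuousOn hT.le).pow 2)).pow 2))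

/-- The quartic terms of `J_ge_of_pos` and `J_self` combine to a perfect square: the functional is
uniformly convex in `g²`. Minimality and uniqueness both follow, and the defect term is what later
measures the distance between densities. -/
theorem le_J_sub (h : Sol b T σ α f p) (hT : 0 < T) (hw : ∀ t ∈ Icc 0 T, 0 < wt σ t)
    {g : ℝ → ℝ} (hg : H1on T g) :
    ∫ t in (0 : ℝ)..T, wt σ t / (2 * b) * (f t ^ 2 - g t ^ 2) ^ 2
      ≤ J b T σ α g - J b T σ α f := by
  have key := J_ge_of_pos hT hw h.hf h.hp h.p0 h.pT.ge h.pos hg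
  have c1 := (continuous_wt σ).continuousOn (s := Icc 0 T)
  have hgc := hg.continuousOn hT.le
  have hfc := h.continuousOn_f
  rw [h.J_self hT hw, sub_neg_eq_add]
  have e : ∫ t in (0 : ℝ)..T, wt σ t / (2 * b) * (f t ^ 2 - g t ^ 2) ^ 2 =
      (∫ t in (0 : ℝ)..T, (wt σ t / (2 * b) * g t ^ 4 - wt σ t / b * f t ^ 2 * g t ^ 2))
      + ∫ t in (0 : ℝ)..T, wt σ t / (2 * b) * f t ^ 4 := by
    rw [← intervalIntegral.integral_add]
    · apply intervalIntegral.integral_congr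
      intro t _
      simp only
      ring
    · exact intervalIntegrable_of_continuousOn_Icc hT.le
        (((c1.div_const _).mul (hgc.pow 4)).sub
          (((c1.div_const _).mul (hfc.pow 2)).mul (hgc.pow 2)))
    · exact intervalIntegrable_of_continuousOn_Icc hT.le ((c1.div_const _).mul (hfc.pow 4))
  rw [e]
  linarith

theorem Emin_eq (h : Sol b T σ α f p) (hb : 1 < b) (hT : 0 < T)
    (hw : ∀ t ∈ Icc 0 T, 1 / 2 ≤ wt σ t ∧ wt σ t ≤ 2) : Emin b T σ α = J b T σ α f := by
  have hw0 : ∀ t ∈ Icc 0 T, 0 < wt σ t := fun t ht => by linarith [(hw t ht).1]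
  refine le_antisymm (Emin_le hb hT hw (h.h1on hT hw0)) (le_Emin hT fun g hg => ?_)
  have h1 := h.le_J_sub hT hw0 hg
  have h2 : 0 ≤ ∫ t in (0 : ℝ)..T, wt σ t / (2 * b) * (f t ^ 2 - g t ^ 2) ^ 2 :=
    intervalIntegral.integral_nonneg hT.le fun t ht => by
      have := (hw0 t ht).le
      positivity
  linarith

/-- Uniqueness of nonnegative minimizers. -/
theorem eq_of_J_le (h : Sol b T σ α f p) (hb : 1 < b) (hT : 0 < T)
    (hw : ∀ t ∈ Icc 0 T, 1 / 2 ≤ wt σ t ∧ wt σ t ≤ 2) {g : ℝ → ℝ} (hg : H1on T g)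
    (hg0 : ∀ t ∈ Icc 0 T, 0 ≤ g t) (hJ : J b T σ α g ≤ J b T σ α f) :
    ∀ t ∈ Icc 0 T, g t = f t := by
  have hw0 : ∀ t ∈ Icc 0 T, 0 < wt σ t := fun t ht => by linarith [(hw t ht).1]
  have h1 := h.le_J_sub hT hw0 hg
  intro t ht
  by_contra hne
  have hgc := hg.continuousOn hT.le
  have hfc := h.continuousOn_f
  have c1 := (continuous_wt σ).continuousOn (s := Icc 0 T)
  have : 0 < ∫ t in (0 : ℝ)..T, wt σ t / (2 * b) * (f t ^ 2 - g t ^ 2) ^ 2 := by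
    apply intervalIntegral.integral_pos hT
    · exact (c1.div_const _).mul (((hfc.pow 2).sub (hgc.pow 2)).pow 2)
    · intro s hs
      have := (hw0 s (Ioc_subset_Icc_self hs)).le
      positivity
    · refine ⟨t, ht, mul_pos (div_pos (hw0 t ht) (by linarith)) (sq_pos_of_ne_zero ?_)⟩
      intro h0
      apply hne
      have h2 : (f t - g t) * (f t + g t) = 0 := by linarith
      rcases mul_eq_zero.1 h2 with h3 | h3
      · linarith
      · linarith [h.pos t ht, hg0 t ht]
  linarith

/-- The splitting of the energy, for two different phases, in terms of the potential function `F`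
of the current. -/
theorem le_J_add_phase_sub (h : Sol b T σ α f p) (hT : 0 < T) (hw : ∀ t ∈ Icc 0 T, 0 < wt σ t)
    {g : ℝ → ℝ} (hg : H1on T g) (δ : ℝ) {F : ℝ → ℝ} (hF0 : F 0 = 0) (hFT : F T = 0)
    (hF : ∀ t ∈ Icc 0 T, HasDerivAt F (2 * mom σ α t / wt σ t * f t ^ 2) t) :
    (∫ t in (0 : ℝ)..T, δ ^ 2 / wt σ t * (1 - (F t / f t ^ 2) ^ 2) * g t ^ 2) +
      (∫ t in (0 : ℝ)..T, wt σ t / (2 * b) * (f t ^ 2 - g t ^ 2) ^ 2)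
      ≤ J b T σ (α + δ) g - J b T σ α f := by
  have hw' : ∀ t ∈ Icc 0 T, wt σ t ≠ 0 := fun t ht => (hw t ht).ne'
  have hf' : ∀ t ∈ Icc 0 T, f t ≠ 0 := fun t ht => (h.pos t ht).ne'
  have c1 := (continuous_wt σ).continuousOn (s := Icc 0 T)
  have c2 := (continuous_mom σ α).continuousOn (s := Icc 0 T)
  have hfc := h.continuousOn_f
  have hpc := h.continuousOn_p
  have hgc := hg.continuousOn hT.le
  have hFc : ContinuousOn F (Icc 0 T) := fun t ht => (hF t ht).continuousAt.continuousWithinAt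
  have hq : ContinuousOn (fun t => F t / f t ^ 2) (Icc 0 T) :=
    hFc.div (hfc.pow 2) fun t ht => pow_ne_zero _ (hf' t ht)
  have hr : ContinuousOn (fun t => p t / f t) (Icc 0 T) := hpc.div hfc hf'
  have hd : ∀ t ∈ Icc 0 T, HasDerivAt (fun t => F t / f t ^ 2)
      (2 * mom σ α t / wt σ t - 2 * (F t / f t ^ 2) * (p t / f t) / wt σ t) t := by
    intro t ht
    have h0 := hf' t ht
    have h1 := hw' t ht
    convert! (hF t ht).div ((h.hf t ht).pow 2) (pow_ne_zero 2 h0) using 1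
    simp only [Nat.cast_ofNat, Nat.add_one_sub_one, pow_one, Pi.pow_apply]
    field_simp
  -- The term `2 δ mom / wt` created by the phase shift is cancelled by `δ (F / f²)'` together with
  -- the cross term of `φ² / wt`. Only the quadratic term `δ² (1 - (F / f²)²) / wt` is left, and `F
  -- 0 = F T = 0` removes the boundary terms.
  have key := J_ge (b := b) (α := α + δ) hT hw hg
    (φ := fun t => p t / f t + δ * (F t / f t ^ 2))
    (fun t ht => (hasDerivAt_ratio (hw' t ht) (hf' t ht) (h.hf t ht) (h.hp t ht)).add
      ((hd t ht).const_mul δ)) ?_ ?_ ?_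
  · rw [h.J_self hT hw, sub_neg_eq_add]
    have e : (∫ t in (0 : ℝ)..T, δ ^ 2 / wt σ t * (1 - (F t / f t ^ 2) ^ 2) * g t ^ 2) +
      (∫ t in (0 : ℝ)..T, wt σ t / (2 * b) * (f t ^ 2 - g t ^ 2) ^ 2) =
      (∫ t in (0 : ℝ)..T, (δ ^ 2 / wt σ t * (1 - (F t / f t ^ 2) ^ 2) * g t ^ 2 +
        (wt σ t / (2 * b) * g t ^ 4 - wt σ t / b * f t ^ 2 * g t ^ 2)))
      + ∫ t in (0 : ℝ)..T, wt σ t / (2 * b) * f t ^ 4 := by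
      have j1 : IntervalIntegrable (fun t => δ ^ 2 / wt σ t * (1 - (F t / f t ^ 2) ^ 2) * g t ^ 2)
          volume 0 T := intervalIntegrable_of_continuousOn_Icc hT.le
            (((continuousOn_const.div c1 hw').mul (continuousOn_const.sub (hq.pow 2))).mul
              (hgc.pow 2))
      have j2 : IntervalIntegrable
          (fun t => wt σ t / (2 * b) * g t ^ 4 - wt σ t / b * f t ^ 2 * g t ^ 2) volume 0 T :=
        intervalIntegrable_of_continuousOn_Icc hT.le
          (((c1.div_const _).mul (hgc.pow 4)).sub
            (((c1.div_const _).mul (hfc.pow 2)).mul (hgc.pow 2)))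
      have j3 : IntervalIntegrable (fun t => wt σ t / (2 * b) * f t ^ 4) volume 0 T :=
        intervalIntegrable_of_continuousOn_Icc hT.le ((c1.div_const _).mul (hfc.pow 4))
      rw [← intervalIntegral.integral_add j1 (h.integrable_defect hT hg),
        ← intervalIntegral.integral_add (j1.add j2) j3]
      apply intervalIntegral.integral_congr
      intro t _
      simp only
      ring
    rw [e]
    refine add_le_add_left (le_trans (le_of_eq ?_) key) _
    apply intervalIntegral.integral_congr
    intro t ht
    rw [uIcc_of_le hT.le] at ht
    have h1 := hw' t ht
    have e : mom σ (α + δ) t = mom σ α t + δ := by unfold mom; ring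
    simp only [e]
    generalize F t / f t ^ 2 = u
    generalize p t / f t = v
    field_simp
    ring
  · exact ((((c2.pow 2).div c1 hw').sub ((c1.div_const b).mul
      (continuousOn_const.sub (hfc.pow 2)))).sub ((hr.pow 2).div c1 hw')).add
      (continuousOn_const.mul (((continuousOn_const.mul c2).div c1 hw').sub
        (((continuousOn_const.mul hq).mul hr).div c1 hw')))
  · simp [hF0, h.p0]
  · simp [hFT, h.pT]

/-- The total current vanishes at an interior minimum point with respect to the phase. -/
theorem current_eq_zero (h : Sol b T σ α f p) (hb : 1 < b) (hT : 0 < T)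
    (hw : ∀ t ∈ Icc 0 T, 1 / 2 ≤ wt σ t ∧ wt σ t ≤ 2) {r : ℝ} (hr : 0 < r)
    (hmin : ∀ δ, |δ| < r → Emin b T σ α ≤ Emin b T σ (α + δ)) :
    ∫ t in (0 : ℝ)..T, 2 * mom σ α t / wt σ t * f t ^ 2 = 0 := by
  have hw0 : ∀ t ∈ Icc 0 T, 0 < wt σ t := fun t ht => by linarith [(hw t ht).1]
  have hf1 := h.h1on hT hw0
  set I := ∫ t in (0 : ℝ)..T, 2 * mom σ α t / wt σ t * f t ^ 2
  set K := ∫ t in (0 : ℝ)..T, f t ^ 2 / wt σ t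
  have hK : 0 ≤ K := intervalIntegral.integral_nonneg hT.le fun t ht => by
    have := (hw0 t ht).le
    positivity
  have key : ∀ δ, |δ| < r → 0 ≤ δ * I + δ ^ 2 * K := by
    intro δ hδ
    have h1 := hmin δ hδ
    rw [h.Emin_eq hb hT hw] at h1
    have h2 := h1.trans (Emin_le hb hT hw hf1)
    rw [J_add_phase hT hw0 hf1] at h2
    linarith
  by_contra hne
  have hI : 0 < |I| := abs_pos.2 hne
  -- Small enough that the quadratic term `s² K` is at most half of `s |I|`; a shift of sign
  -- opposite to `I` then lowers the energy.
  set s := min (r / 2) (|I| / (2 * (K + 1))) with hs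
  have hs0 : 0 < s := lt_min (by positivity) (by positivity)
  have hsr : s < r := (min_le_left _ _).trans_lt (by linarith)
  have hsK : s * K ≤ |I| / 2 := by
    have : s ≤ |I| / (2 * (K + 1)) := min_le_right _ _
    rw [le_div_iff₀ (by positivity)] at this
    nlinarith
  rcases abs_cases I with ⟨e, _⟩ | ⟨e, _⟩
  · have := key (-s) (by rwa [abs_neg, abs_of_pos hs0])
    rw [e] at hsK hI
    nlinarith
  · have := key s (by rwa [abs_of_pos hs0])
    rw [e] at hsK hI
    nlinarith

end Sol

end

end

/-! ### Smallness of the curvature relative to the length -/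

noncomputable section

/-- The smallness condition on the curvature parameter `σ = ε k`, relative to the length `T`. -/
def Small (m T σ : ℝ) : Prop := 1 ≤ T ∧ |σ| * (1 + T) ^ 6 ≤ m

namespace Small

variable {m T σ : ℝ}

theorem mono {m' : ℝ} (h : Small m T σ) (hm : m ≤ m') : Small m' T σ := ⟨h.1, h.2.trans hm⟩

theorem pos (h : Small m T σ) : 0 < T := by linarith [h.1]

theorem abs_mul_pow_le (h : Small m T σ) {j : ℕ} (hj : j ≤ 6) : |σ| * (1 + T) ^ j ≤ m :=
  (mul_le_mul_of_nonneg_left (pow_le_pow_right₀ (by linarith [h.1]) hj) (abs_nonneg _)).trans h.2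

theorem abs_mul_le (h : Small m T σ) {t : ℝ} (ht : t ∈ Icc 0 T) : |σ * t| ≤ m := by
  have := h.abs_mul_pow_le (j := 1) (by norm_num)
  rw [abs_mul, abs_of_nonneg ht.1]
  nlinarith [abs_nonneg σ, ht.2]

theorem abs_mul_sq_le (h : Small m T σ) {t : ℝ} (ht : t ∈ Icc 0 T) : |σ * t ^ 2| ≤ m := by
  have := h.abs_mul_pow_le (j := 2) (by norm_num)
  rw [abs_mul, abs_of_nonneg (sq_nonneg t)]
  have : t ^ 2 ≤ (1 + T) ^ 2 := pow_le_pow_left₀ ht.1 (by linarith [ht.2]) 2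
  nlinarith [abs_nonneg σ]

theorem wt_bounds (h : Small m T σ) {t : ℝ} (ht : t ∈ Icc 0 T) :
    1 - m ≤ wt σ t ∧ wt σ t ≤ 1 + m := by
  have := abs_le.1 (h.abs_mul_le ht)
  unfold wt
  constructor <;> linarith [this.1, this.2]

theorem mom_bounds (h : Small m T σ) (α : ℝ) {t : ℝ} (ht : t ∈ Icc 0 T) :
    t + α - m / 2 ≤ mom σ α t ∧ mom σ α t ≤ t + α + m / 2 := by
  have := abs_le.1 (h.abs_mul_sq_le ht)
  unfold mom
  constructor <;> linarith [this.1, this.2]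

theorem wt_half (h : Small (1 / 100) T σ) : ∀ t ∈ Icc 0 T, 1 / 2 ≤ wt σ t ∧ wt σ t ≤ 2 := by
  intro t ht
  have := h.wt_bounds ht
  constructor <;> linarith [this.1, this.2]

theorem wt_pos (h : Small (1 / 100) T σ) : ∀ t ∈ Icc 0 T, 0 < wt σ t := by
  intro t ht
  linarith [(h.wt_half t ht).1]

end Small

/-! ### Phases of nonnegative energy and existence of an optimal phase -/

section Phases

variable {b T σ α : ℝ}

/-- For such phases the potential alone dominates `wt / b`, so `φ = 0` suffices. -/
theorem J_nonneg_of_two_le (hb : 1 < b) (hs : Small (1 / 100) T σ) (hα : 2 ≤ α) {g : ℝ → ℝ}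
    (hg : H1on T g) : 0 ≤ J b T σ α g := by
  refine le_trans ?_ (J_ge hs.pos hs.wt_pos hg (φ := fun _ => 0) (φ' := fun _ => 0)
    (fun t _ => hasDerivAt_const t 0) continuousOn_const le_rfl le_rfl)
  apply intervalIntegral.integral_nonneg hs.pos.le
  intro t ht
  have h1 := hs.wt_bounds ht
  have h2 := (hs.mom_bounds α ht).1
  have h3 := hs.wt_pos t ht
  have h4 : wt σ t / b ≤ mom σ α t ^ 2 / wt σ t := by
    rw [div_le_div_iff₀ (by linarith) h3]
    have e1 : 3 ≤ mom σ α t ^ 2 := by nlinarith [ht.1]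
    have e2 : wt σ t * wt σ t ≤ 3 := by nlinarith [h1.2]
    nlinarith
  have h5 : 0 ≤ wt σ t / (2 * b) * g t ^ 4 := by positivity
  have h6 : 0 ≤ (mom σ α t ^ 2 / wt σ t - wt σ t / b - 0 - 0 ^ 2 / wt σ t) * g t ^ 2 :=
    mul_nonneg (by simp; linarith) (sq_nonneg _)
  linarith

/-- The well lies far from both end points, where the oscillator on the line has ground energy `1 >
1 / b`. The multiplier `-(mom / b) u²` is the logarithmic derivative of the Gaussian `exp (-mom² /
(2 b))`, cut off where `|mom| ≥ X` so that it vanishes at `0` and `T`. Near the centre `-φ'`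
compensates `wt / b`; the cutoff error is at most `7 mom² / X²` and is absorbed by `mom² (1 - 1 /
b²)`. -/
theorem J_nonneg_of_bulk (hb : 1 < b) (hs : Small (1 / 100) T σ) {X : ℝ} (hX : 2 ≤ X)
    (hXb : 7 ≤ X ^ 2 * (1 - 1 / b ^ 2)) (hT : 2 * X + 1 ≤ T) (hα : -T / 2 ≤ α) (hαX : α ≤ -X)
    {g : ℝ → ℝ} (hg : H1on T g) : 0 ≤ J b T σ α g := by
  set u : ℝ → ℝ := fun t => max 0 (1 - mom σ α t ^ 2 / X ^ 2) with hu
  have hu0 : ∀ t, X ^ 2 ≤ mom σ α t ^ 2 → u t = 0 := by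
    intro t ht
    refine max_eq_left ?_
    rw [sub_nonpos, le_div_iff₀ (by positivity)]
    linarith
  have hud : ∀ t, HasDerivAt (fun t => u t ^ 2)
      (2 * u t * (-(2 * mom σ α t * wt σ t / X ^ 2))) t := by
    intro t
    refine (hasDerivAt_max_zero_sq _).comp t ?_
    have := (((hasDerivAt_mom σ α t).pow 2).div_const (X ^ 2)).const_sub 1
    convert! this using 1
    simp
  have hd : ∀ t, HasDerivAt (fun t => -(mom σ α t / b) * u t ^ 2)
      (-(wt σ t / b) * u t ^ 2 + -(mom σ α t / b) *
        (2 * u t * (-(2 * mom σ α t * wt σ t / X ^ 2)))) t := fun t =>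
    ((hasDerivAt_mom σ α t).div_const b).neg.mul (hud t)
  have hc1 := continuous_wt σ
  have hc2 := continuous_mom σ α
  have huc : Continuous u := by fun_prop
  have h0m : (0 : ℝ) ∈ Icc 0 T := left_mem_Icc.2 hs.pos.le
  have hTm : T ∈ Icc 0 T := right_mem_Icc.2 hs.pos.le
  have hA0 : mom σ α 0 = α := by simp [mom]
  refine le_trans ?_ (J_ge hs.pos hs.wt_pos hg (fun t _ => hd t) (by fun_prop) ?_ ?_)
  · apply intervalIntegral.integral_nonneg hs.pos.le
    intro t ht
    have hw := hs.wt_pos t ht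
    have hw2 := hs.wt_bounds ht
    have h5 : 0 ≤ wt σ t / (2 * b) * g t ^ 4 := by positivity
    refine add_nonneg (mul_nonneg ?_ (sq_nonneg _)) h5
    have e : mom σ α t ^ 2 / wt σ t - wt σ t / b - (-(wt σ t / b) * u t ^ 2 + -(mom σ α t / b) *
        (2 * u t * (-(2 * mom σ α t * wt σ t / X ^ 2)))) -
        (-(mom σ α t / b) * u t ^ 2) ^ 2 / wt σ t
        = (mom σ α t ^ 2 - wt σ t ^ 2 / b * (1 - u t ^ 2 + 4 * (mom σ α t ^ 2 / X ^ 2) * u t)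
          - mom σ α t ^ 2 * (1 / b ^ 2) * u t ^ 4) / wt σ t := by
      field_simp
      ring
    rw [e]
    refine div_nonneg ?_ hw.le
    have hwb : wt σ t ^ 2 / b ≤ 1.1 := by
      rw [div_le_iff₀ (by linarith)]
      nlinarith [hw2.2]
    have hwb0 : 0 ≤ wt σ t ^ 2 / b := by positivity
    set y := mom σ α t ^ 2 / X ^ 2 with hy
    have hy0 : 0 ≤ y := by positivity
    have hyx : mom σ α t ^ 2 = X ^ 2 * y := by rw [hy]; field_simp
    rw [hyx]
    rcases le_total y 1 with h1 | h1
    · have hue : u t = 1 - y := max_eq_right (by linarith)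
      rw [hue]
      have e1 : 1 - (1 - y) ^ 2 + 4 * y * (1 - y) = 6 * y - 5 * y ^ 2 := by ring
      rw [e1]
      have e2 : wt σ t ^ 2 / b * (6 * y - 5 * y ^ 2) ≤ 7 * y := by
        nlinarith [mul_le_mul_of_nonneg_right hwb hy0, mul_nonneg hwb0 (sq_nonneg y)]
      have e3 : (1 - y) ^ 4 ≤ 1 := pow_le_one₀ (by linarith) (by linarith)
      have e4 : X ^ 2 * y * (1 / b ^ 2) * (1 - y) ^ 4 ≤ X ^ 2 * y * (1 / b ^ 2) :=
        mul_le_of_le_one_right (by positivity) e3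
      nlinarith
    · have hue : u t = 0 := max_eq_left (by linarith)
      rw [hue]
      nlinarith
  · simp only [hA0]
    rw [hu0 0 (by rw [hA0]; nlinarith)]
    simp
  · rw [hu0 T]
    · simp
    · have := (hs.mom_bounds α hTm).1
      have : X ≤ mom σ α T := by linarith
      exact pow_le_pow_left₀ (by linarith) this 2

theorem Emin_nonpos (hb : 1 < b) (hs : Small (1 / 100) T σ) : Emin b T σ α ≤ 0 := by
  have := Emin_le (α := α) hb hs.pos hs.wt_half (H1on_zero hs.pos)
  rwa [J_zero] at this

/-- Functions of nonpositive energy are bounded in `L²`. -/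
theorem integral_sq_le_of_J_nonpos (hb : 1 < b) (hs : Small (1 / 100) T σ) {g : ℝ → ℝ}
    (hg : H1on T g) (hJ : J b T σ α g ≤ 0) : ∫ t in (0 : ℝ)..T, g t ^ 2 ≤ 8 * T := by
  have hgc := hg.continuousOn hs.pos.le
  have h1 : ∫ t in (0 : ℝ)..T, (1 / (2 * b) * (g t ^ 2 - 8)) ≤ J b T σ α g := by
    apply intervalIntegral.integral_mono_on hs.pos.le _ (J_integrable b σ α hs.pos.le hs.wt_pos hg)
    · intro t ht
      have hw := hs.wt_half t ht
      have e1 : 0 ≤ mom σ α t ^ 2 / wt σ t ^ 2 * g t ^ 2 := by positivity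
      have e2 : wt σ t * (deriv g t ^ 2 + mom σ α t ^ 2 / wt σ t ^ 2 * g t ^ 2
          - 1 / (2 * b) * (2 * g t ^ 2 - g t ^ 4)) =
        wt σ t * (deriv g t ^ 2 + mom σ α t ^ 2 / wt σ t ^ 2 * g t ^ 2)
          + 1 / (2 * b) * (wt σ t * (g t ^ 4 - 2 * g t ^ 2)) := by ring
      rw [e2]
      have e3 : 0 ≤ wt σ t * (deriv g t ^ 2 + mom σ α t ^ 2 / wt σ t ^ 2 * g t ^ 2) :=
        mul_nonneg (by linarith [hw.1]) (by positivity)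
      have e4 : g t ^ 2 - 8 ≤ wt σ t * (g t ^ 4 - 2 * g t ^ 2) := by
        have : 2 * g t ^ 2 - 4 ≤ g t ^ 4 - 2 * g t ^ 2 := by nlinarith [sq_nonneg (g t ^ 2 - 2)]
        nlinarith [mul_le_mul_of_nonneg_left this (by linarith [hw.1] : 0 ≤ wt σ t), sq_nonneg (g t)]
      have : 0 ≤ 1 / (2 * b) := by positivity
      nlinarith [mul_le_mul_of_nonneg_left e4 this]
    · exact intervalIntegrable_of_continuousOn_Icc hs.pos.le
        (continuousOn_const.mul ((hgc.pow 2).sub continuousOn_const))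
  have i1 : IntervalIntegrable (fun t => g t ^ 2) volume 0 T :=
    intervalIntegrable_of_continuousOn_Icc hs.pos.le (hgc.pow 2)
  rw [intervalIntegral.integral_const_mul, intervalIntegral.integral_sub i1 (by simp)] at h1
  simp only [intervalIntegral.integral_const, sub_zero, smul_eq_mul] at h1
  have h2 : 0 < 1 / (2 * b) := by positivity
  by_contra! h3
  nlinarith [mul_pos h2 (by linarith : 0 < (∫ t in (0 : ℝ)..T, g t ^ 2) - T * 8)]

/-- Trial functions of nonpositive energy have `∫ g² ≤ 8 T`, which bounds the effect of a phase
shift; for the others it is enough that `Emin ≤ 0`. -/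
theorem Emin_le_add (hb : 1 < b) (hs : Small (1 / 100) T σ) {R α' : ℝ} (hα : |α| ≤ R)
    (hα' : |α'| ≤ R) :
    Emin b T σ α' ≤ Emin b T σ α + 32 * T * (T + 2 * R + 1) * |α' - α| := by
  have hR : 0 ≤ R := (abs_nonneg _).trans hα
  have hT := hs.pos
  rw [← sub_le_iff_le_add]
  apply le_Emin hs.pos
  intro g hg
  rw [sub_le_iff_le_add]
  rcases le_total (J b T σ α g) 0 with h | h
  · have h1 := integral_sq_le_of_J_nonpos hb hs hg h
    set δ := α' - α with hδ
    have hδR : |δ| ≤ 2 * R := (abs_sub _ _).trans (by linarith)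
    have e : α' = α + δ := by rw [hδ]; ring
    rw [e]
    refine (Emin_le hb hT hs.wt_half hg).trans ?_
    rw [J_add_phase hT hs.wt_pos hg]
    have hgc := hg.continuousOn hs.pos.le
    have c1 := (continuous_wt σ).continuousOn (s := Icc 0 T)
    have c2 := (continuous_mom σ α).continuousOn (s := Icc 0 T)
    have hw' : ∀ t ∈ Icc 0 T, wt σ t ≠ 0 := fun t ht => (hs.wt_pos t ht).ne'
    have i1 : IntervalIntegrable (fun t => 2 * mom σ α t / wt σ t * g t ^ 2) volume 0 T :=
      intervalIntegrable_of_continuousOn_Icc hT.le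
        (((continuousOn_const.mul c2).div c1 hw').mul (hgc.pow 2))
    have i2 : IntervalIntegrable (fun t => g t ^ 2 / wt σ t) volume 0 T :=
      intervalIntegrable_of_continuousOn_Icc hT.le ((hgc.pow 2).div c1 hw')
    have i3 : IntervalIntegrable (fun t => g t ^ 2) volume 0 T :=
      intervalIntegrable_of_continuousOn_Icc hT.le (hgc.pow 2)
    have hI : δ * (∫ t in (0 : ℝ)..T, 2 * mom σ α t / wt σ t * g t ^ 2)
        + δ ^ 2 * (∫ t in (0 : ℝ)..T, g t ^ 2 / wt σ t) ≤
        4 * |δ| * (T + 2 * R + 1) * ∫ t in (0 : ℝ)..T, g t ^ 2 := by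
      rw [← intervalIntegral.integral_const_mul, ← intervalIntegral.integral_const_mul,
        ← intervalIntegral.integral_const_mul, ← intervalIntegral.integral_add
          (i1.const_mul δ) (i2.const_mul _)]
      apply intervalIntegral.integral_mono_on hT.le ((i1.const_mul δ).add (i2.const_mul _))
        (i3.const_mul _)
      intro t ht
      have hw := hs.wt_half t ht
      have hm := hs.mom_bounds α ht
      have hα2 := abs_le.1 hα
      have hA : |mom σ α t| ≤ T + R + 1 := abs_le.2
        ⟨by linarith [hm.1, ht.1, hα2.1, ht.2], by linarith [hm.2, ht.2, hα2.2]⟩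
      have e1 : δ * (2 * mom σ α t / wt σ t * g t ^ 2) + δ ^ 2 * (g t ^ 2 / wt σ t)
        = (2 * δ * mom σ α t + δ ^ 2) / wt σ t * g t ^ 2 := by ring
      rw [e1]
      refine mul_le_mul_of_nonneg_right ?_ (sq_nonneg _)
      rw [div_le_iff₀ (by linarith [hw.1])]
      have e2 : δ * mom σ α t ≤ |δ| * (T + R + 1) :=
        (le_abs_self _).trans (by rw [abs_mul]; exact mul_le_mul_of_nonneg_left hA (abs_nonneg _))
      have e3 : δ ^ 2 ≤ |δ| * (2 * R) := by
        rw [← sq_abs]; nlinarith [abs_nonneg δ]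
      have e4 : 0 ≤ |δ| * (T + 2 * R + 1) := mul_nonneg (abs_nonneg _) (by linarith)
      nlinarith [hw.1, abs_nonneg δ]
    have : 4 * |δ| * (T + 2 * R + 1) * (∫ t in (0 : ℝ)..T, g t ^ 2) ≤
        4 * |δ| * (T + 2 * R + 1) * (8 * T) := mul_le_mul_of_nonneg_left h1
          (mul_nonneg (by positivity) (by linarith))
    linarith
  · have h1 := Emin_nonpos (α := α') hb hs
    have : 0 ≤ 32 * T * (T + 2 * R + 1) * |α' - α| :=
      mul_nonneg (mul_nonneg (by linarith) (by linarith)) (abs_nonneg _)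
    linarith

/-- The optimal energy. -/
def Est (b T σ : ℝ) : ℝ := sInf (Emin b T σ '' Ici (-T / 2))

theorem EStar_eq_Est (b c₀ ε k : ℝ) : EStar b c₀ ε k = Est b (tEps c₀ ε) (ε * k) := by
  unfold EStar Est phases
  congr 1
  ext x
  simp only [mem_image, E1D_eq_Emin]

theorem bddBelow_Emin (hb : 1 < b) (hs : Small (1 / 100) T σ) (S : Set ℝ) :
    BddBelow (Emin b T σ '' S) :=
  ⟨-T, by
    rintro _ ⟨α, _, rfl⟩
    exact le_Emin hs.pos fun g hg => J_lower_bound hb hs.pos hs.wt_half hg⟩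

theorem Est_le (hb : 1 < b) (hs : Small (1 / 100) T σ) (hα : -T / 2 ≤ α) :
    Est b T σ ≤ Emin b T σ α := csInf_le (bddBelow_Emin hb hs _) ⟨α, hα, rfl⟩

/-- On `[-T / 2, 2]` the minimal energy is continuous, and beyond `2` it is nonnegative, hence no
smaller than at any other phase. -/
theorem exists_optimal_phase (hb : 1 < b) (hs : Small (1 / 100) T σ) :
    ∃ α, -T / 2 ≤ α ∧ Emin b T σ α = Est b T σ := by
  have hT := hs.pos
  have hcont : ContinuousOn (Emin b T σ) (Icc (-T / 2) 2) := by
    set R := T + 2 with hR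
    have hC : 0 ≤ 32 * T * (T + 2 * R + 1) := by positivity
    refine LipschitzOnWith.continuousOn (K := Real.toNNReal (32 * T * (T + 2 * R + 1)))
      (LipschitzOnWith.of_dist_le_mul fun x hx y hy => ?_)
    rw [Real.coe_toNNReal _ hC, Real.dist_eq, Real.dist_eq]
    have hxR : |x| ≤ R := abs_le.2 ⟨by linarith [hx.1], by linarith [hx.2]⟩
    have hyR : |y| ≤ R := abs_le.2 ⟨by linarith [hy.1], by linarith [hy.2]⟩
    have h1 := Emin_le_add hb hs hxR hyR
    have h2 := Emin_le_add hb hs hyR hxR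
    rw [abs_sub_comm y x] at h1
    rw [abs_le]
    constructor <;> linarith
  obtain ⟨α, hα, hmin⟩ := isCompact_Icc.exists_isMinOn
    (⟨0, by constructor <;> linarith⟩ : (Icc (-T / 2) 2).Nonempty) hcont
  refine ⟨α, hα.1, le_antisymm ?_ (Est_le hb hs hα.1)⟩
  refine le_csInf ⟨_, _, hα.1, rfl⟩ ?_
  rintro _ ⟨β, hβ, rfl⟩
  rcases le_total β 2 with h | h
  · exact hmin ⟨hβ, h⟩
  · exact (Emin_nonpos hb hs).trans (le_Emin hT fun g hg => J_nonneg_of_two_le hb hs h hg)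

/-- Phases of negative energy are confined to a bounded interval. -/
theorem phase_bounds (hb : 1 < b) (hs : Small (1 / 100) T σ) {X : ℝ} (hX : 2 ≤ X)
    (hXb : 7 ≤ X ^ 2 * (1 - 1 / b ^ 2)) (hT : 2 * X + 1 ≤ T) (hα : -T / 2 ≤ α)
    (hE : Emin b T σ α < 0) : -X < α ∧ α < 2 := by
  constructor
  · by_contra! h
    exact absurd (le_Emin hs.pos fun g hg => J_nonneg_of_bulk hb hs hX hXb hT hα h hg) (by linarith)
  · by_contra! h
    exact absurd (le_Emin hs.pos fun g hg => J_nonneg_of_two_le hb hs h hg) (by linarith)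

theorem exists_sol_of_Emin_neg (hb : 1 < b) (hs : Small (1 / 100) T σ)
    (hE : Emin b T σ α < 0) : ∃ f p, Sol b T σ α f p := by
  by_contra hne
  refine absurd (le_Emin hs.pos (x := 0) fun g hg => ?_) (by linarith)
  by_contra! hJ
  exact hne (exists_sol hb hs.pos hs.wt_half hg hJ)

end Phases

end

/-! ### Bounds on solutions by Wronskian comparison -/

noncomputable section

theorem antitoneOn_of_hasDerivAt_nonpos {a c : ℝ} {q q' : ℝ → ℝ}
    (hq : ∀ t ∈ Icc a c, HasDerivAt q (q' t) t) (h : ∀ t ∈ Icc a c, q' t ≤ 0) :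
    AntitoneOn q (Icc a c) := by
  apply antitoneOn_of_deriv_nonpos (convex_Icc _ _)
  · exact fun t ht => (hq t ht).continuousAt.continuousWithinAt
  · intro t ht
    rw [interior_Icc] at ht
    exact (hq t (Ioo_subset_Icc_self ht)).differentiableAt.differentiableWithinAt
  · intro t ht
    rw [interior_Icc] at ht
    rw [(hq t (Ioo_subset_Icc_self ht)).deriv]
    exact h t (Ioo_subset_Icc_self ht)

theorem monotoneOn_of_hasDerivAt_nonneg {a c : ℝ} {q q' : ℝ → ℝ}
    (hq : ∀ t ∈ Icc a c, HasDerivAt q (q' t) t) (h : ∀ t ∈ Icc a c, 0 ≤ q' t) :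
    MonotoneOn q (Icc a c) := by
  have := antitoneOn_of_hasDerivAt_nonpos (q := fun t => -q t) (fun t ht => (hq t ht).neg)
    (fun t ht => neg_nonpos.2 (h t ht))
  intro x hx y hy hxy
  have := this hx hy hxy
  simp only at this
  linarith

theorem integral_exp_neg_le_one {T : ℝ} : ∫ t in (0 : ℝ)..T, Real.exp (-t) ≤ 1 := by
  have : ∫ t in (0 : ℝ)..T, Real.exp (-t) = 1 - Real.exp (-T) := by
    rw [intervalIntegral.integral_comp_neg (fun x => Real.exp x), integral_exp]
    simp
  rw [this]
  linarith [Real.exp_pos (-T)]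

/-- The linear potential in the Euler-Lagrange equation. -/
def pot (b σ α y t : ℝ) : ℝ := mom σ α t ^ 2 / wt σ t - wt σ t / b * (1 - y ^ 2)

namespace Sol

variable {b T σ α : ℝ} {f p : ℝ → ℝ}

/-- The Wronskian of a solution with a comparison function. -/
theorem hasDerivAt_wronskian (h : Sol b T σ α f p) (hw : ∀ t ∈ Icc 0 T, wt σ t ≠ 0)
    {ψ ψ₁ : ℝ → ℝ} {ψ₂ t : ℝ} (ht : t ∈ Icc 0 T) (h1 : HasDerivAt ψ (ψ₁ t) t)
    (h2 : HasDerivAt ψ₁ ψ₂ t) :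
    HasDerivAt (fun t => p t * ψ t - f t * (wt σ t * ψ₁ t))
      (f t * (pot b σ α (f t) t * ψ t + σ * ψ₁ t - wt σ t * ψ₂)) t := by
  convert! ((h.hp t ht).mul h1).sub ((h.hf t ht).mul ((hasDerivAt_wt σ t).mul h2)) using 1
  have := hw t ht
  unfold pot
  simp only [Pi.mul_apply]
  field_simp
  ring

end Sol

section

variable {b T σ α X : ℝ} {f p : ℝ → ℝ}

/-- The smallness threshold for the curvature parameter. -/
def mX (X : ℝ) : ℝ := 1 / (100 * (X + 6) ^ 2)

theorem mX_pos (hX : 2 ≤ X) : 0 < mX X := by unfold mX; positivity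

theorem mX_le (hX : 2 ≤ X) : mX X ≤ 1 / 100 := by
  unfold mX
  apply one_div_le_one_div_of_le (by norm_num)
  nlinarith

/-- Beyond `X + 4` lies the forbidden region, where solutions decay exponentially. -/
theorem pot_ge_two (hb : 1 < b) (hs : Small (1 / 100) T σ) (hα : -X ≤ α) {t : ℝ}
    (ht : t ∈ Icc 0 T) (htX : X + 4 ≤ t) (y : ℝ) : 2 ≤ pot b σ α y t := by
  have h1 := hs.wt_bounds ht
  have h2 := hs.wt_pos t ht
  have h3 := (hs.mom_bounds α ht).1
  unfold pot
  have e1 : 14 ≤ mom σ α t ^ 2 / wt σ t := by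
    rw [le_div_iff₀ h2]; nlinarith
  have e2 : wt σ t / b * (1 - y ^ 2) ≤ 2 := by
    have : wt σ t / b ≤ 2 := by rw [div_le_iff₀ (by linarith)]; nlinarith
    have : 0 ≤ wt σ t / b := by positivity
    nlinarith [mul_nonneg this (sq_nonneg y)]
  linarith

namespace Sol

/-- The comparison function `cosh (T - t)` also satisfies the Neumann condition at `T`, and the
potential is at least `2`. The Wronskian is therefore nondecreasing and vanishes at `T`, so it is
nonpositive to the left of `T`. -/
theorem antitoneOn_div_cosh (h : Sol b T σ α f p) (hb : 1 < b) (hs : Small (1 / 100) T σ)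
    (hα : -X ≤ α) (hX : 2 ≤ X) :
    AntitoneOn (fun t => f t / Real.cosh (T - t)) (Icc (X + 4) T) ∧
      ∀ t ∈ Icc (X + 4) T, p t ≤ 0 := by
  rcases lt_or_ge T (X + 4) with hlt | hXT
  · rw [Icc_eq_empty (by linarith)]
    exact ⟨fun x hx => absurd hx (notMem_empty x), by simp⟩
  have hsub : ∀ t ∈ Icc (X + 4) T, t ∈ Icc 0 T := fun t ht => ⟨by linarith [ht.1], ht.2⟩
  have hw' : ∀ t ∈ Icc 0 T, wt σ t ≠ 0 := fun t ht => (hs.wt_pos t ht).ne'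
  have hσ : |σ| ≤ 1 / 100 := by
    have := hs.abs_mul_pow_le (j := 0) (by norm_num)
    simpa using this
  have d0 : ∀ t : ℝ, HasDerivAt (fun t => Real.cosh (T - t)) (-Real.sinh (T - t)) t := by
    intro t
    have := (Real.hasDerivAt_cosh (T - t)).comp t ((hasDerivAt_id t).const_sub T)
    convert! this using 1
    ring
  have d1 : ∀ t : ℝ, HasDerivAt (fun t => -Real.sinh (T - t)) (Real.cosh (T - t)) t := by
    intro t
    have := ((Real.hasDerivAt_sinh (T - t)).comp t ((hasDerivAt_id t).const_sub T)).neg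
    convert! this using 1
    ring
  have hsc : ∀ t ∈ Icc (X + 4) T, 0 ≤ Real.sinh (T - t) ∧
      Real.sinh (T - t) ≤ Real.cosh (T - t) := fun t ht =>
    ⟨Real.sinh_nonneg_iff.2 (by linarith [ht.2]), (Real.sinh_lt_cosh _).le⟩
  have hq : ∀ t ∈ Icc (X + 4) T,
      p t * Real.cosh (T - t) - f t * (wt σ t * -Real.sinh (T - t)) ≤ 0 := by
    have hmono := monotoneOn_of_hasDerivAt_nonneg (a := X + 4) (c := T)
      (fun t ht => h.hasDerivAt_wronskian hw' (hsub t ht) (d0 t) (d1 t)) ?_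
    · intro t ht
      have := hmono ht (right_mem_Icc.2 hXT) ht.2
      simpa [h.pT] using this
    · intro t ht
      have h1 := pot_ge_two hb hs hα (hsub t ht) ht.1 (f t)
      have h2 := hs.wt_bounds (hsub t ht)
      obtain ⟨h3, h4⟩ := hsc t ht
      have h5 := Real.cosh_pos (T - t)
      refine mul_nonneg (h.pos t (hsub t ht)).le ?_
      have h6 := abs_le.1 hσ
      have h7 : σ * Real.sinh (T - t) ≤ 1 / 100 * Real.cosh (T - t) := by nlinarith
      nlinarith
  constructor
  · refine antitoneOn_of_hasDerivAt_nonpos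
      (fun t ht => (h.hf t (hsub t ht)).div (d0 t) (Real.cosh_pos _).ne') fun t ht => ?_
    have h1 := hq t ht
    have h2 := hs.wt_pos t (hsub t ht)
    have e : p t / wt σ t * Real.cosh (T - t) - f t * -Real.sinh (T - t) =
        (p t * Real.cosh (T - t) - f t * (wt σ t * -Real.sinh (T - t))) / wt σ t := by
      field_simp
    rw [e]
    exact div_nonpos_of_nonpos_of_nonneg (div_nonpos_of_nonpos_of_nonneg h1 h2.le) (sq_nonneg _)
  · intro t ht
    have h1 := hq t ht
    obtain ⟨h3, h4⟩ := hsc t ht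
    have h5 := Real.cosh_pos (T - t)
    have h2 := hs.wt_pos t (hsub t ht)
    have h6 : 0 ≤ f t * (wt σ t * Real.sinh (T - t)) :=
      mul_nonneg (h.pos t (hsub t ht)).le (mul_nonneg h2.le h3)
    by_contra! h7
    have := mul_pos h7 h5
    linarith

theorem le_cosh (h : Sol b T σ α f p) (hb : 1 < b) (hs : Small (1 / 100) T σ)
    (hα : -X ≤ α) (hX : 2 ≤ X) {s t : ℝ} (hs1 : X + 4 ≤ s) (hst : s ≤ t) (htT : t ≤ T) :
    f t * Real.cosh (T - s) ≤ f s * Real.cosh (T - t) := by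
  have := (h.antitoneOn_div_cosh hb hs hα hX).1 ⟨hs1, hst.trans htT⟩ ⟨hs1.trans hst, htT⟩ hst
  simp only at this
  rwa [div_le_div_iff₀ (Real.cosh_pos _) (Real.cosh_pos _)] at this

/-- This is monotonicity of the quotient by `cosh (T - t)`; the factor `2` comes from `exp x / 2 ≤
cosh x ≤ exp x` for `x ≥ 0`. -/
theorem decay (h : Sol b T σ α f p) (hb : 1 < b) (hs : Small (1 / 100) T σ)
    (hα : -X ≤ α) (hX : 2 ≤ X) {s t : ℝ} (hs1 : X + 4 ≤ s) (hst : s ≤ t) (htT : t ≤ T) :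
    f t ≤ f s ∧ f t ≤ 2 * Real.exp (s - t) * f s := by
  have h1 := h.le_cosh hb hs hα hX hs1 hst htT
  have hfs := h.pos s ⟨by linarith, by linarith⟩
  have hft := h.pos t ⟨by linarith, by linarith⟩
  have h2 : Real.cosh (T - t) ≤ Real.cosh (T - s) := by
    rw [Real.cosh_le_cosh, abs_of_nonneg (by linarith), abs_of_nonneg (by linarith)]
    linarith
  have h3 := Real.cosh_pos (T - s)
  constructor
  · by_contra! h4
    nlinarith [Real.cosh_pos (T - t)]
  · have h4 : Real.cosh (T - t) ≤ Real.exp (T - t) := by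
      rw [Real.cosh_eq]
      have : Real.exp (-(T - t)) ≤ Real.exp (T - t) := Real.exp_le_exp.2 (by linarith)
      linarith
    have h5 : Real.exp (T - s) ≤ 2 * Real.cosh (T - s) := by
      rw [Real.cosh_eq]
      linarith [Real.exp_pos (-(T - s))]
    have h6 : Real.exp (T - t) = Real.exp (s - t) * Real.exp (T - s) := by
      rw [← Real.exp_add]; ring_nf
    have h7 : f t * Real.cosh (T - s) ≤ (2 * Real.exp (s - t) * f s) * Real.cosh (T - s) := by
      calc f t * Real.cosh (T - s) ≤ f s * Real.exp (T - t) :=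
            h1.trans (mul_le_mul_of_nonneg_left h4 hfs.le)
        _ = f s * Real.exp (s - t) * Real.exp (T - s) := by rw [h6]; ring
        _ ≤ f s * Real.exp (s - t) * (2 * Real.cosh (T - s)) :=
            mul_le_mul_of_nonneg_left h5 (by positivity)
        _ = _ := by ring
    exact le_of_mul_le_mul_right h7 h3

theorem le_exp_neg (h : Sol b T σ α f p) (hb : 1 < b) (hs : Small (1 / 100) T σ)
    (hα : -X ≤ α) (hX : 2 ≤ X) {t : ℝ} (ht : t ∈ Icc 0 T) :
    f t ≤ 2 * Real.exp (X + 4 - t) := by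
  rcases le_total (X + 4) t with h1 | h1
  · have h2 := (h.decay hb hs hα hX le_rfl h1 ht.2).2
    have h3 := h.le_one (X + 4) ⟨by linarith, h1.trans ht.2⟩
    have := Real.exp_pos (X + 4 - t)
    nlinarith
  · have h3 := h.le_one t ht
    have : 1 ≤ Real.exp (X + 4 - t) := Real.one_le_exp (by linarith)
    linarith

/-- Upper bound on the logarithmic derivative. -/
theorem p_le (h : Sol b T σ α f p) (hb : 1 < b) (hs : Small (1 / 100) T σ)
    (hα : -X ≤ α) (hα2 : α ≤ 2) (hX : 2 ≤ X) {L : ℝ} (hL : 0 ≤ L) {t : ℝ}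
    (ht : t ∈ Icc 0 T) (htL : t ≤ L) : p t ≤ 2 * (L + X + 3) * (wt σ t * f t) := by
  -- On `[0, L]` the potential is at most `2 (L + X + 3)² = Λ² / 2`, so `exp (Λ x)` grows faster
  -- than the equation allows, even after the `σ` terms.
  set Λ := 2 * (L + X + 3) with hΛ
  have hσ : |σ| ≤ 1 / 100 := by
    have := hs.abs_mul_pow_le (j := 0) (by norm_num)
    simpa using this
  have hw' : ∀ t ∈ Icc 0 T, wt σ t ≠ 0 := fun t ht => (hs.wt_pos t ht).ne'
  have hsub : ∀ x ∈ Icc 0 t, x ∈ Icc 0 T := fun x hx => ⟨hx.1, hx.2.trans ht.2⟩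
  have d0 : ∀ x : ℝ, HasDerivAt (fun x => Real.exp (Λ * x)) (Λ * Real.exp (Λ * x)) x := by
    intro x
    have := ((hasDerivAt_id x).const_mul Λ).exp
    convert! this using 1
    simp; ring
  have hanti := antitoneOn_of_hasDerivAt_nonpos (a := 0) (c := t)
    (fun x hx => h.hasDerivAt_wronskian hw' (hsub x hx) (d0 x) ((d0 x).const_mul Λ)) ?_
  · have := hanti (left_mem_Icc.2 ht.1) (right_mem_Icc.2 ht.1) ht.1
    simp only [h.p0, zero_mul, zero_sub] at this
    have h0 : 0 ≤ f 0 * (wt σ 0 * (Λ * Real.exp (Λ * 0))) := by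
      have := (h.pos 0 ⟨le_rfl, hs.pos.le⟩).le
      have := (hs.wt_pos 0 ⟨le_rfl, hs.pos.le⟩).le
      positivity
    have h1 : (p t - Λ * (wt σ t * f t)) * Real.exp (Λ * t) ≤ 0 := by nlinarith
    have := Real.exp_pos (Λ * t)
    by_contra! h2
    have := mul_pos (sub_pos.2 h2) this
    linarith
  · intro x hx
    have h1 := hs.wt_bounds (hsub x hx)
    have h2 := hs.wt_pos x (hsub x hx)
    have h3 := hs.mom_bounds α (hsub x hx)
    refine mul_nonpos_of_nonneg_of_nonpos (h.pos x (hsub x hx)).le ?_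
    have hpot : pot b σ α (f x) x ≤ 2 * (L + X + 3) ^ 2 := by
      unfold pot
      have e1 : mom σ α x ^ 2 / wt σ x ≤ 2 * (L + X + 3) ^ 2 := by
        rw [div_le_iff₀ h2]
        have : mom σ α x ^ 2 ≤ (L + X + 3) ^ 2 :=
          sq_le_sq' (by linarith [h3.1, hx.1]) (by linarith [h3.2, hx.2])
        nlinarith
      have e2 : 0 ≤ wt σ x / b * (1 - f x ^ 2) := by
        have := h.le_one x (hsub x hx)
        have := h.pos x (hsub x hx)
        exact mul_nonneg (by positivity) (by nlinarith)
      linarith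
    have h5 := Real.exp_pos (Λ * x)
    have e : pot b σ α (f x) x * Real.exp (Λ * x) + σ * (Λ * Real.exp (Λ * x)) -
        wt σ x * (Λ * (Λ * Real.exp (Λ * x)))
        = (pot b σ α (f x) x + σ * Λ - wt σ x * Λ ^ 2) * Real.exp (Λ * x) := by ring
    rw [e]
    refine mul_nonpos_of_nonpos_of_nonneg ?_ h5.le
    have h6 := abs_le.1 hσ
    have h7 : 1 ≤ Λ := by linarith
    have h8 : 2 * (L + X + 3) ^ 2 = Λ ^ 2 / 2 := by rw [hΛ]; ring
    nlinarith [sq_nonneg Λ]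

/-- Lower bound on the logarithmic derivative. -/
theorem le_p (h : Sol b T σ α f p) (hb : 1 < b) (hX : 2 ≤ X) (hs : Small (mX X) T σ)
    (hα : -X ≤ α) (hα2 : α ≤ 2) {t : ℝ} (ht : t ∈ Icc 0 T) :
    -((t + (X + 4)) * (wt σ t * f t)) ≤ p t := by
  -- The Gaussian `exp (-(x + a)² / 2)` corresponds to the potential `(x + a)² - 1`. As `|mom| ≤ x +
  -- a - 3`, this exceeds `mom² / wt` with room for the curvature errors, which `mX` keeps below `1
  -- / 100`. The Wronskian is nonnegative at `T` and nonincreasing, so the bound propagates down to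
  -- `t`.
  set a := X + 4 with ha
  have hs' := hs.mono (mX_le hX)
  have hw' : ∀ t ∈ Icc 0 T, wt σ t ≠ 0 := fun t ht => (hs'.wt_pos t ht).ne'
  have hsub : ∀ x ∈ Icc t T, x ∈ Icc 0 T := fun x hx => ⟨ht.1.trans hx.1, hx.2⟩
  have d0 : ∀ x : ℝ, HasDerivAt (fun x => Real.exp (-(x + a) ^ 2 / 2))
      (-(x + a) * Real.exp (-(x + a) ^ 2 / 2)) x := by
    intro x
    have := ((((hasDerivAt_id x).add_const a).pow 2).neg.div_const 2).exp
    convert! this using 1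
    simp; ring
  have d1 : ∀ x : ℝ, HasDerivAt (fun x => -(x + a) * Real.exp (-(x + a) ^ 2 / 2))
      (((x + a) ^ 2 - 1) * Real.exp (-(x + a) ^ 2 / 2)) x := by
    intro x
    have := (((hasDerivAt_id x).add_const a).neg).mul (d0 x)
    convert! this using 1
    simp; ring
  have hanti := antitoneOn_of_hasDerivAt_nonpos (a := t) (c := T)
    (fun x hx => h.hasDerivAt_wronskian hw' (hsub x hx) (d0 x) (d1 x)) ?_
  · have := hanti (left_mem_Icc.2 ht.2) (right_mem_Icc.2 ht.2) ht.2
    simp only [h.pT, zero_mul, zero_sub] at this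
    have hT : T ∈ Icc 0 T := ⟨hs.pos.le, le_rfl⟩
    have h0 : 0 ≤ -(f T * (wt σ T * (-(T + a) * Real.exp (-(T + a) ^ 2 / 2)))) := by
      have h1 := (h.pos T hT).le
      have h2 := (hs'.wt_pos T hT).le
      have h3 : 0 ≤ T + a := by linarith [hT.1]
      have : 0 ≤ f T * (wt σ T * ((T + a) * Real.exp (-(T + a) ^ 2 / 2))) := by positivity
      linarith
    have h1 : 0 ≤ (p t + (t + a) * (wt σ t * f t)) * Real.exp (-(t + a) ^ 2 / 2) := by nlinarith
    have := Real.exp_pos (-(t + a) ^ 2 / 2)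
    by_contra! h2
    have := mul_pos (by linarith : 0 < -(p t + (t + a) * (wt σ t * f t))) this
    linarith
  · intro x hx
    have h1 := hs'.wt_bounds (hsub x hx)
    have h2 := hs'.wt_pos x (hsub x hx)
    have h3 := hs'.mom_bounds α (hsub x hx)
    have hx0 := (hsub x hx).1
    refine mul_nonpos_of_nonneg_of_nonpos (h.pos x (hsub x hx)).le ?_
    have h5 := Real.exp_pos (-(x + a) ^ 2 / 2)
    have e : pot b σ α (f x) x * Real.exp (-(x + a) ^ 2 / 2) +
        σ * (-(x + a) * Real.exp (-(x + a) ^ 2 / 2)) -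
        wt σ x * (((x + a) ^ 2 - 1) * Real.exp (-(x + a) ^ 2 / 2))
        = (pot b σ α (f x) x - σ * (x + a) - wt σ x * ((x + a) ^ 2 - 1)) *
          Real.exp (-(x + a) ^ 2 / 2) := by ring
    rw [e]
    refine mul_nonpos_of_nonpos_of_nonneg ?_ h5.le
    have e1 : pot b σ α (f x) x ≤ mom σ α x ^ 2 / wt σ x := by
      unfold pot
      have e2 : 0 ≤ wt σ x / b * (1 - f x ^ 2) := by
        have := h.le_one x (hsub x hx)
        have := h.pos x (hsub x hx)
        exact mul_nonneg (by positivity) (by nlinarith)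
      linarith
    have e2 : mom σ α x ^ 2 ≤ (x + a - 3) ^ 2 :=
      sq_le_sq' (by linarith [h3.1]) (by linarith [h3.2])
    -- curvature errors
    have hσ3 : |σ| * ((1 + x) * (x + a) ^ 2) ≤ 1 / 100 := by
      have h6 := hs.abs_mul_pow_le (j := 3) (by norm_num)
      have h7 : (1 + x) * (x + a) ^ 2 ≤ (X + 6) ^ 2 * (1 + T) ^ 3 := by
        have i1 : x + a ≤ (X + 6) * (1 + T) := by
          have := (hsub x hx).2
          nlinarith
        have i2 : (x + a) ^ 2 ≤ ((X + 6) * (1 + T)) ^ 2 :=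
          pow_le_pow_left₀ (by linarith) i1 2
        have i3 : 1 + x ≤ 1 + T := by linarith [(hsub x hx).2]
        calc (1 + x) * (x + a) ^ 2 ≤ (1 + T) * ((X + 6) * (1 + T)) ^ 2 :=
              mul_le_mul i3 i2 (sq_nonneg _) (by linarith)
          _ = _ := by ring
      have h8 : (X + 6) ^ 2 * mX X = 1 / 100 := by unfold mX; field_simp
      calc |σ| * ((1 + x) * (x + a) ^ 2) ≤ |σ| * ((X + 6) ^ 2 * (1 + T) ^ 3) :=
            mul_le_mul_of_nonneg_left h7 (abs_nonneg _)
        _ = (X + 6) ^ 2 * (|σ| * (1 + T) ^ 3) := by ring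
        _ ≤ (X + 6) ^ 2 * mX X := mul_le_mul_of_nonneg_left h6 (by positivity)
        _ = _ := h8
    have hxa : 1 ≤ x + a := by linarith
    have e3 : |σ * (x + a)| ≤ 1 / 100 := by
      rw [abs_mul, abs_of_nonneg (by linarith : 0 ≤ x + a)]
      have : x + a ≤ (1 + x) * (x + a) ^ 2 := by nlinarith [mul_nonneg hx0 (sq_nonneg (x + a))]
      nlinarith [abs_nonneg σ]
    have e4 : |σ * x * (x + a) ^ 2| ≤ 1 / 100 := by
      rw [abs_mul, abs_mul, abs_of_nonneg hx0, abs_of_nonneg (sq_nonneg (x + a)), mul_assoc]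
      refine le_trans (mul_le_mul_of_nonneg_left ?_ (abs_nonneg σ)) hσ3
      nlinarith [sq_nonneg (x + a)]
    have e5 := abs_le.1 e3
    have e6 := abs_le.1 e4
    have e7 : (x + a) ^ 2 - 1 - 2 / 100 ≤ wt σ x * ((x + a) ^ 2 - 1) := by
      have : wt σ x * ((x + a) ^ 2 - 1) = (x + a) ^ 2 - 1 - σ * x * (x + a) ^ 2 + σ * x := by
        unfold wt; ring
      have h9 := abs_le.1 (hs'.abs_mul_le (hsub x hx))
      rw [this]; linarith [h9.1, e6.2]
    have e8 : mom σ α x ^ 2 / wt σ x ≤ (x + a - 3) ^ 2 + 2 / 100 := by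
      rw [div_le_iff₀ h2]
      have : (x + a - 3) ^ 2 * (σ * x) ≤ 1 / 100 := by
        have i1 : (x + a - 3) ^ 2 ≤ (x + a) ^ 2 := by nlinarith
        have i2 : |σ * x| * (x + a - 3) ^ 2 ≤ |σ * x * (x + a) ^ 2| := by
          rw [abs_mul (σ * x), abs_of_nonneg (sq_nonneg (x + a))]
          exact mul_le_mul_of_nonneg_left i1 (abs_nonneg _)
        nlinarith [le_abs_self (σ * x), sq_nonneg (x + a - 3)]
      have i4 : ((x + a - 3) ^ 2 + 2 / 100) * wt σ x
          = (x + a - 3) ^ 2 - (x + a - 3) ^ 2 * (σ * x) + 2 / 100 * wt σ x := by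
        unfold wt; ring
      rw [i4]
      linarith [h1.1]
    nlinarith [e5.1, e5.2]

theorem monotoneOn_mul_exp (h : Sol b T σ α f p) (hw : ∀ t ∈ Icc 0 T, 0 < wt σ t) {a c l : ℝ}
    (hac : Icc a c ⊆ Icc 0 T) (hp : ∀ t ∈ Icc a c, -(l * (wt σ t * f t)) ≤ p t) {s t : ℝ}
    (hs : a ≤ s) (hst : s ≤ t) (ht : t ≤ c) : f s * Real.exp (-(l * (t - s))) ≤ f t := by
  have d0 : ∀ x : ℝ, HasDerivAt (fun x => Real.exp (l * x)) (l * Real.exp (l * x)) x := by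
    intro x
    have := ((hasDerivAt_id x).const_mul l).exp
    convert! this using 1
    simp; ring
  have hm := monotoneOn_of_hasDerivAt_nonneg (a := a) (c := c)
    (fun x hx => (h.hf x (hac hx)).mul (d0 x)) fun x hx => by
      have h1 := hw x (hac hx)
      have h2 := hp x hx
      have e : p x / wt σ x * Real.exp (l * x) + f x * (l * Real.exp (l * x)) =
          (p x + l * (wt σ x * f x)) / wt σ x * Real.exp (l * x) := by field_simp
      rw [e]
      exact mul_nonneg (div_nonneg (by linarith) h1.le) (Real.exp_pos _).le
  have h1 := hm ⟨hs, hst.trans ht⟩ ⟨hs.trans hst, ht⟩ hst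
  simp only [Pi.mul_apply] at h1
  have e : Real.exp (-(l * (t - s))) = Real.exp (l * s) * Real.exp (-(l * t)) := by
    rw [← Real.exp_add]; ring_nf
  have e2 : Real.exp (l * t) * Real.exp (-(l * t)) = 1 := by
    rw [← Real.exp_add]; simp
  calc f s * Real.exp (-(l * (t - s))) = f s * Real.exp (l * s) * Real.exp (-(l * t)) := by
        rw [e]; ring
    _ ≤ f t * Real.exp (l * t) * Real.exp (-(l * t)) :=
        mul_le_mul_of_nonneg_right h1 (Real.exp_pos _).le
    _ = f t := by rw [mul_assoc, e2, mul_one]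

theorem antitoneOn_mul_exp (h : Sol b T σ α f p) (hw : ∀ t ∈ Icc 0 T, 0 < wt σ t) {a c l : ℝ}
    (hac : Icc a c ⊆ Icc 0 T) (hp : ∀ t ∈ Icc a c, p t ≤ l * (wt σ t * f t)) {s t : ℝ}
    (hs : a ≤ s) (hst : s ≤ t) (ht : t ≤ c) : f t * Real.exp (-(l * (t - s))) ≤ f s := by
  have d0 : ∀ x : ℝ, HasDerivAt (fun x => Real.exp (-l * x)) (-l * Real.exp (-l * x)) x := by
    intro x
    have := ((hasDerivAt_id x).const_mul (-l)).exp
    convert! this using 1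
    simp; ring
  have hm := antitoneOn_of_hasDerivAt_nonpos (a := a) (c := c)
    (fun x hx => (h.hf x (hac hx)).mul (d0 x)) fun x hx => by
      have h1 := hw x (hac hx)
      have h2 := hp x hx
      have e : p x / wt σ x * Real.exp (-l * x) + f x * (-l * Real.exp (-l * x)) =
          (p x - l * (wt σ x * f x)) / wt σ x * Real.exp (-l * x) := by field_simp; ring
      rw [e]
      exact mul_nonpos_of_nonpos_of_nonneg
        (div_nonpos_of_nonpos_of_nonneg (by linarith) h1.le) (Real.exp_pos _).le
  have h1 := hm ⟨hs, hst.trans ht⟩ ⟨hs.trans hst, ht⟩ hst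
  simp only [Pi.mul_apply] at h1
  have e : Real.exp (-(l * (t - s))) = Real.exp (-l * t) * Real.exp (l * s) := by
    rw [← Real.exp_add]; ring_nf
  have e2 : Real.exp (-l * s) * Real.exp (l * s) = 1 := by
    rw [← Real.exp_add]; simp
  calc f t * Real.exp (-(l * (t - s))) = f t * Real.exp (-l * t) * Real.exp (l * s) := by
        rw [e]; ring
    _ ≤ f s * Real.exp (-l * s) * Real.exp (l * s) :=
        mul_le_mul_of_nonneg_right h1 (Real.exp_pos _).le
    _ = f s := by rw [mul_assoc, e2, mul_one]

end Sol

end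

end

/-! ### Uniform control of solutions of negative energy -/

noncomputable section

/-- A solution with the uniform bounds that hold at the optimal phase; `X` bounds the phase,
`τ` is the length of the boundary layer and `C` is a constant. -/
structure Ctrl (b X τ C T σ α : ℝ) (f p : ℝ → ℝ) : Prop where
  sol : Sol b T σ α f p
  small : Small (mX X) T σ
  hX : 2 ≤ X
  hτ : X + 4 ≤ τ
  hτT : 2 * τ ≤ T
  hC : 1 ≤ C
  lower_phase : -X < α
  phase_lt : α < 2
  le_exp : ∀ t ∈ Icc 0 T, f t ≤ C * Real.exp (-t)
  abs_p_le : ∀ t ∈ Icc 0 T, |p t| ≤ C * (1 + t) * f t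
  harnack : ∀ s ∈ Icc 0 T, ∀ t ∈ Icc 0 T, s ≤ t → f t ≤ C * f s
  one_le : ∀ t ∈ Icc 0 τ, 1 ≤ C * f t

/-- Since `J f = -∫ wt / (2 b) f⁴ ≤ -c` while `f` is exponentially small past `τ`, the solution
cannot be small on all of `[0, τ]`. The two bounds on the logarithmic derivative spread the lower
bound from one point to the whole layer. The constants `τ` and `C` depend only on `X` and `c`, not
on `T`, `σ`, `α`. -/
theorem exists_ctrl {b X c : ℝ} (hb : 1 < b) (hX : 2 ≤ X) (hc : 0 < c) :
    ∃ τ C, X + 4 ≤ τ ∧ 1 ≤ C ∧ ∀ T σ α f p, 2 * τ ≤ T → Small (mX X) T σ → -X < α → α < 2 →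
      Sol b T σ α f p → J b T σ α f ≤ -c → Ctrl b X τ C T σ α f p := by
  set a := X + 4 with ha
  -- the length of the boundary layer
  obtain ⟨τ, hτa, hτ⟩ : ∃ τ, a ≤ τ ∧ 4 * Real.exp (2 * a) * Real.exp (-τ) ≤ c / 4 := by
    have h := (Real.tendsto_exp_neg_atTop_nhds_zero.const_mul (4 * Real.exp (2 * a)))
    rw [mul_zero] at h
    obtain ⟨τ, h1, h2⟩ := ((h.eventually_le_const (by positivity : 0 < c / 4)).and
      (Filter.eventually_ge_atTop a)).exists
    exact ⟨τ, h2, h1⟩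
  have hτ0 : 0 < τ := by linarith
  -- If `f² ≤ κ` on `[0, τ]`, then `wt / (2 b) f⁴ ≤ (c / 4) exp (-t)` both in the layer and beyond
  -- it, too little to reach energy `-c`.
  set κ := c / 4 * Real.exp (-τ) with hκ
  have hκ0 : 0 < κ := by positivity
  set l := 2 * (τ + X + 4) with hl
  set e0 := Real.exp (-(l * τ)) with he0
  have he0p : 0 < e0 := Real.exp_pos _
  set C := max (max (2 * Real.exp a) (4 * l)) (1 / (Real.sqrt κ * e0)) with hC
  have hC1 : 2 * Real.exp a ≤ C := (le_max_left _ _).trans (le_max_left _ _)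
  have hC2 : 4 * l ≤ C := (le_max_right _ _).trans (le_max_left _ _)
  have hC3 : 1 / (Real.sqrt κ * e0) ≤ C := le_max_right _ _
  have hC4 : 1 ≤ C := by linarith
  refine ⟨τ, C, hτa, hC4, fun T σ α f p hτT hs hα hα2 h hJ => ?_⟩
  have hs' := hs.mono (mX_le hX)
  have hexp : ∀ t ∈ Icc 0 T, f t ≤ 2 * Real.exp a * Real.exp (-t) := by
    intro t ht
    have := h.le_exp_neg hb hs' hα.le hX ht
    rw [sub_eq_add_neg, Real.exp_add] at this
    linarith
  have hsub : Icc 0 τ ⊆ Icc 0 T := Icc_subset_Icc_right (by linarith)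
  -- a point where the solution is not small
  obtain ⟨s, hsτ, hsf⟩ : ∃ s ∈ Icc 0 τ, κ < f s ^ 2 := by
    by_contra! hcon
    have h1 : ∫ t in (0 : ℝ)..T, wt σ t / (2 * b) * f t ^ 4 ≤
        ∫ t in (0 : ℝ)..T, c / 2 * Real.exp (-t) := by
      apply intervalIntegral.integral_mono_on hs.pos.le
      · exact intervalIntegrable_of_continuousOn_Icc hs.pos.le
          (((continuous_wt σ).continuousOn.div_const _).mul (h.continuousOn_f.pow 4))
      · exact (by fun_prop : Continuous fun t => c / 2 * Real.exp (-t)).intervalIntegrable _ _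
      intro t ht
      have hw := hs'.wt_bounds ht
      have hf0 := h.pos t ht
      have hf1 := h.le_one t ht
      have e1 : wt σ t / (2 * b) * f t ^ 4 ≤ f t ^ 2 := by
        have : wt σ t / (2 * b) ≤ 1 := by rw [div_le_one (by linarith)]; linarith [hw.2]
        have : f t ^ 4 ≤ f t ^ 2 := pow_le_pow_of_le_one hf0.le hf1 (by norm_num)
        have : 0 ≤ f t ^ 4 := by positivity
        nlinarith
      refine e1.trans ?_
      rcases le_total t τ with htτ | htτ
      · refine (hcon t ⟨ht.1, htτ⟩).trans ?_
        have : Real.exp (-τ) ≤ Real.exp (-t) := Real.exp_le_exp.2 (by linarith)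
        rw [hκ]
        nlinarith [Real.exp_pos (-t)]
      · have h2 := pow_le_pow_left₀ hf0.le (hexp t ht) 2
        have e2 : (2 * Real.exp a * Real.exp (-t)) ^ 2 =
            4 * Real.exp (2 * a) * Real.exp (-t) * Real.exp (-t) := by
          rw [show Real.exp (2 * a) = Real.exp a * Real.exp a by rw [← Real.exp_add, two_mul]]
          ring
        rw [e2] at h2
        have : Real.exp (-t) ≤ Real.exp (-τ) := Real.exp_le_exp.2 (by linarith)
        have h3 : 4 * Real.exp (2 * a) * Real.exp (-t) ≤ c / 4 :=
          (mul_le_mul_of_nonneg_left this (by positivity)).trans hτ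
        nlinarith [Real.exp_pos (-t)]
    rw [intervalIntegral.integral_const_mul] at h1
    have h2 := integral_exp_neg_le_one (T := T)
    rw [h.J_self hs.pos hs'.wt_pos] at hJ
    nlinarith
  have hsf' : Real.sqrt κ ≤ f s := by
    rw [Real.sqrt_le_left (h.pos s (hsub hsτ)).le]
    exact hsf.le
  have hpu : ∀ t ∈ Icc 0 τ, p t ≤ l * (wt σ t * f t) := by
    intro t ht
    have := h.p_le hb hs' hα.le hα2.le hX hτ0.le (hsub ht) ht.2
    have h1 := (hs'.wt_pos t (hsub ht)).le
    have h2 := (h.pos t (hsub ht)).le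
    refine this.trans (mul_le_mul_of_nonneg_right (by linarith) (by positivity))
  have hpl : ∀ t ∈ Icc 0 τ, -(l * (wt σ t * f t)) ≤ p t := by
    intro t ht
    have := h.le_p hb hX hs hα.le hα2.le (hsub ht)
    have h1 := (hs'.wt_pos t (hsub ht)).le
    have h2 := (h.pos t (hsub ht)).le
    have h3 : (t + (X + 4)) * (wt σ t * f t) ≤ l * (wt σ t * f t) :=
      mul_le_mul_of_nonneg_right (by linarith [ht.2]) (by positivity)
    linarith
  have hlow : ∀ t ∈ Icc 0 τ, Real.sqrt κ * e0 ≤ f t := by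
    intro t ht
    have hl0 : 0 ≤ l := by linarith
    rcases le_total s t with hst | hst
    · have h1 := h.monotoneOn_mul_exp hs'.wt_pos hsub hpl hsτ.1 hst ht.2
      refine le_trans ?_ h1
      refine mul_le_mul hsf' (Real.exp_le_exp.2 ?_) he0p.le (h.pos s (hsub hsτ)).le
      have : l * (t - s) ≤ l * τ := mul_le_mul_of_nonneg_left (by linarith [ht.2, hsτ.1]) hl0
      linarith
    · have h1 := h.antitoneOn_mul_exp hs'.wt_pos hsub hpu ht.1 hst hsτ.2
      refine le_trans ?_ h1
      refine mul_le_mul hsf' (Real.exp_le_exp.2 ?_) he0p.le (h.pos s (hsub hsτ)).le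
      have : l * (s - t) ≤ l * τ := mul_le_mul_of_nonneg_left (by linarith [ht.1, hsτ.2]) hl0
      linarith
  have hone : ∀ t ∈ Icc 0 τ, 1 ≤ C * f t := by
    intro t ht
    have h1 := hlow t ht
    have h2 : 0 < Real.sqrt κ * e0 := mul_pos (Real.sqrt_pos.2 hκ0) he0p
    have h3 : 1 = 1 / (Real.sqrt κ * e0) * (Real.sqrt κ * e0) := by field_simp
    calc (1 : ℝ) = 1 / (Real.sqrt κ * e0) * (Real.sqrt κ * e0) := h3
      _ ≤ C * f t := mul_le_mul hC3 h1 h2.le (by linarith)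
  refine ⟨h, hs, hX, hτa, hτT, hC4, hα, hα2, ?_, ?_, ?_, hone⟩
  · intro t ht
    exact (hexp t ht).trans (mul_le_mul_of_nonneg_right hC1 (Real.exp_pos _).le)
  · intro t ht
    have h1 := hs'.wt_half t ht
    have h2 := (h.pos t ht).le
    have hlow := h.le_p hb hX hs hα.le hα2.le ht
    have hl1 : 2 * l * (1 + t) ≤ C * (1 + t) :=
      mul_le_mul_of_nonneg_right (by linarith) (by linarith [ht.1])
    have hwf : wt σ t * f t ≤ 2 * f t := mul_le_mul_of_nonneg_right h1.2 h2
    have hwf0 : 0 ≤ wt σ t * f t := mul_nonneg (by linarith [h1.1]) h2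
    have hCf : 2 * l * (1 + t) * f t ≤ C * (1 + t) * f t := mul_le_mul_of_nonneg_right hl1 h2
    rw [abs_le]
    constructor
    · have h3 : (t + (X + 4)) * (wt σ t * f t) ≤ (l * (1 + t)) * (wt σ t * f t) := by
        refine mul_le_mul_of_nonneg_right ?_ hwf0
        nlinarith [ht.1]
      have h4 : (l * (1 + t)) * (wt σ t * f t) ≤ (l * (1 + t)) * (2 * f t) :=
        mul_le_mul_of_nonneg_left hwf (mul_nonneg (by linarith) (by linarith [ht.1]))
      have h5 : (l * (1 + t)) * (2 * f t) = 2 * l * (1 + t) * f t := by ring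
      linarith
    · rcases le_total t τ with htτ | htτ
      · have h3 := hpu t ⟨ht.1, htτ⟩
        have h4 : l * (wt σ t * f t) ≤ l * (2 * f t) :=
          mul_le_mul_of_nonneg_left hwf (by linarith)
        have h5 : 2 * l * f t ≤ 2 * l * (1 + t) * f t :=
          mul_le_mul_of_nonneg_right (by nlinarith [ht.1]) h2
        linarith
      · have h3 := (h.antitoneOn_div_cosh hb hs' hα.le hX).2 t ⟨by linarith, ht.2⟩
        have : 0 ≤ C * (1 + t) * f t :=
          mul_nonneg (mul_nonneg (by linarith) (by linarith [ht.1])) h2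
        linarith
  -- For `s` in the layer the bound is `f t ≤ 1 ≤ C f s`; past the layer `f` is nonincreasing.
  · intro s hs1 t ht hst
    rcases le_total s τ with h1 | h1
    · exact (h.le_one t ht).trans (hone s ⟨hs1.1, h1⟩)
    · have h2 := (h.decay hb hs' hα.le hX (by linarith) hst ht.2).1
      have h3 := (h.pos s hs1).le
      nlinarith

end

/-! ### Positivity of the cost function through a Bernoulli-type quantity -/

noncomputable section

/-- The length of the interval is large compared with the constant `C` and `(1 - 1 / b)⁻¹`. -/
structure Large (b C T : ℝ) : Prop where
  lin : 80 * C ^ 2 ≤ (1 - 1 / b) * T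
  exp : 103200 * C ^ 8 * T ^ 6 * Real.exp (-(T / 2)) ≤ 1 - 1 / b

theorem one_add_pow_four_le {x : ℝ} (h0 : 0 ≤ x) (h1 : x ≤ 1 / 100) :
    (1 + x) ^ 4 ≤ 1 + 5 * x := by
  have h2 : x ^ 2 ≤ x / 100 := by nlinarith
  have h3 : x ^ 3 ≤ x / 100 := by nlinarith [sq_nonneg x]
  have h4 : x ^ 4 ≤ x / 100 := by nlinarith [sq_nonneg x, sq_nonneg (x ^ 2)]
  nlinarith

/-- The arithmetic of `neg_bern_le`, with `W = wt⁴`, `B = (mom + e)²`, `a = mom` and `s = |σ| T`: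
curvature and the gap `d` cost less than `κ / 2`. -/
theorem weighted_sq_le {κ d T a s W B : ℝ} (hκ0 : 0 < κ) (hκ1 : κ ≤ 1) (hd0 : 0 < d)
    (hd1 : d ≤ κ / 100) (hdT : d * T ^ 2 = κ / 100) (ha : a ^ 2 ≤ 4 * T ^ 2) (hs0 : 0 ≤ s)
    (hs1 : s ≤ 1 / 100) (hs3 : s * T ^ 2 ≤ κ / 100) (hW : W ≤ 1 + 5 * s)
    (hB : B ≤ a ^ 2 + κ / 10) (hB0 : 0 ≤ B) : W * B ≤ (1 - d) ^ 2 * (a ^ 2 + κ / 2) := by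
  have i1 : W * B ≤ (1 + 5 * s) * (a ^ 2 + κ / 10) := mul_le_mul hW hB hB0 (by positivity)
  have i2 : s * a ^ 2 ≤ κ / 25 := by
    have : s * a ^ 2 ≤ s * (4 * T ^ 2) := mul_le_mul_of_nonneg_left ha hs0
    linarith
  have i3 : d * a ^ 2 ≤ κ / 25 := by
    have : d * a ^ 2 ≤ d * (4 * T ^ 2) := mul_le_mul_of_nonneg_left ha hd0.le
    linarith
  have i4 : s * κ ≤ κ / 100 := by
    have := mul_le_mul_of_nonneg_right hs1 hκ0.le
    linarith
  have i5 : (1 + 5 * s) * (a ^ 2 + κ / 10) = a ^ 2 + 5 * (s * a ^ 2) + κ / 10 + s * κ / 2 := by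
    ring
  have i6 : (1 - d) ^ 2 * (a ^ 2 + κ / 2) =
      a ^ 2 + κ / 2 - 2 * (d * a ^ 2) - d * κ + d ^ 2 * (a ^ 2 + κ / 2) := by ring
  have i7 : d * κ ≤ κ / 100 := by
    have := mul_le_mul_of_nonneg_right hd1 hκ0.le
    have := mul_le_mul_of_nonneg_left hκ1 hκ0.le
    linarith
  have i8 : 0 ≤ d ^ 2 * (a ^ 2 + κ / 2) := by positivity
  linarith

namespace Ctrl

variable {b X τ C T σ α : ℝ} {f p : ℝ → ℝ}

theorem small' (h : Ctrl b X τ C T σ α f p) : Small (1 / 100) T σ := h.small.mono (mX_le h.hX)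

theorem T_ge (h : Ctrl b X τ C T σ α f p) : 2 * X + 8 ≤ T := by linarith [h.hτ, h.hτT]

theorem abs_mom_le (h : Ctrl b X τ C T σ α f p) {t : ℝ} (ht : t ∈ Icc 0 T) :
    |mom σ α t| ≤ 2 * T := by
  have h1 := h.small'.mom_bounds α ht
  rw [abs_le]
  constructor <;> linarith [h1.1, h1.2, h.T_ge, h.hX, h.lower_phase, h.phase_lt, ht.1, ht.2]

theorem sq_harnack (h : Ctrl b X τ C T σ α f p) {s t : ℝ} (hs : s ∈ Icc 0 T) (ht : t ∈ Icc 0 T)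
    (hst : s ≤ t) : f t ^ 2 ≤ C ^ 2 * f s ^ 2 := by
  rw [← mul_pow]
  exact pow_le_pow_left₀ (h.sol.pos t ht).le (h.harnack s hs t ht hst) 2

/-- The pointwise conserved quantity of the problem without curvature. -/
def bern (b σ α : ℝ) (f p : ℝ → ℝ) (t : ℝ) : ℝ :=
  -p t ^ 2 + mom σ α t ^ 2 * f t ^ 2 - wt σ t ^ 2 / (2 * b) * (2 * f t ^ 2 - f t ^ 4)

/-- By the Euler-Lagrange equation all terms containing `p` cancel. At `σ = 0` what remains is the
derivative `2 mom f²` of the current function `F`, so it is `F - bern` that is conserved. -/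
theorem hasDerivAt_bern (h : Ctrl b X τ C T σ α f p) {t : ℝ} (ht : t ∈ Icc 0 T) :
    HasDerivAt (bern b σ α f p) (2 * mom σ α t * wt σ t * f t ^ 2 +
      σ * wt σ t / b * (2 * f t ^ 2 - f t ^ 4)) t := by
  have hw := (h.small'.wt_pos t ht).ne'
  have hf := h.sol.hf t ht
  have hp := h.sol.hp t ht
  have := (((hp.pow 2).neg).add (((hasDerivAt_mom σ α t).pow 2).mul (hf.pow 2))).sub
    ((((hasDerivAt_wt σ t).pow 2).div_const (2 * b)).mul
      (((hf.pow 2).const_mul 2).sub (hf.pow 4)))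
  unfold bern
  convert! this using 1
  simp only [Pi.pow_apply, Pi.sub_apply, Nat.cast_ofNat, Nat.add_one_sub_one, pow_one]
  field_simp
  ring

theorem omega_pos (hb : 1 < b) : 0 < 1 - 1 / b := by
  rw [sub_pos, div_lt_one (by linarith)]; exact hb

theorem curvature_small (h : Ctrl b X τ C T σ α f p) (hb : 1 < b) (hL : Large b C T) :
    |σ| * (1 + T) ^ 3 * T ≤ 1 / 100 ∧ |σ| * (1 + T) ^ 3 * T ^ 3 ≤ 1 / 100 ∧
      |σ| * (1 + T) ^ 3 ≤ (1 - 1 / b) / 100 := by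
  have hT := h.small.1
  have h1 := h.small'.2
  -- Three powers of `1 + T` stay with `σ` and the other three dominate `T³`; this is what the
  -- exponent `6` of `Small` is for.
  have e : |σ| * (1 + T) ^ 6 = |σ| * (1 + T) ^ 3 * (1 + T) ^ 3 := by ring
  rw [e] at h1
  have h0 : 0 ≤ |σ| * (1 + T) ^ 3 := by positivity
  have h2 : T ^ 3 ≤ (1 + T) ^ 3 := pow_le_pow_left₀ (by linarith) (by linarith) 3
  have h3 : T ≤ T ^ 3 := by nlinarith [sq_nonneg T, mul_self_le_mul_self zero_le_one hT]
  have h4 : |σ| * (1 + T) ^ 3 * T ^ 3 ≤ 1 / 100 :=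
    (mul_le_mul_of_nonneg_left h2 h0).trans h1
  have h5 : |σ| * (1 + T) ^ 3 * T ≤ 1 / 100 := (mul_le_mul_of_nonneg_left h3 h0).trans h4
  refine ⟨h5, h4, ?_⟩
  have h6 : 1 ≤ (1 - 1 / b) * T := by nlinarith [hL.lin, h.hC]
  have h7 := omega_pos hb
  by_contra! h8
  have h9 : (1 - 1 / b) / 100 * T < |σ| * (1 + T) ^ 3 * T :=
    mul_lt_mul_of_pos_right h8 (by linarith)
  linarith

/-- The relative gap in the positivity of the cost function. -/
def gap (b T : ℝ) : ℝ := (1 - 1 / b) / (100 * T ^ 2)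

theorem gap_pos (hb : 1 < b) (hT : 1 ≤ T) : 0 < gap b T := by
  have := omega_pos hb
  unfold gap
  positivity

theorem gap_mul (hT : 1 ≤ T) : gap b T * T ^ 2 = (1 - 1 / b) / 100 := by
  unfold gap
  field_simp

theorem gap_le (hb : 1 < b) (hT : 1 ≤ T) : gap b T ≤ (1 - 1 / b) / 100 := by
  have := gap_mul (b := b) hT
  have := gap_pos hb hT
  nlinarith [mul_self_le_mul_self zero_le_one hT]

/-- Look at a minimum point of `(1 - d) f² + bern`. At an end point `p = 0`; in the interior the
critical equation determines `p` as `-mom f` up to curvature and `d`. In both cases `p² ≤ f² (mom² +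
κ / 2)`, and then `κ = 1 - 1 / b > 0` makes the minimum nonnegative. -/
theorem neg_bern_le (h : Ctrl b X τ C T σ α f p) (hb : 1 < b) (hL : Large b C T) {t : ℝ}
    (ht : t ∈ Icc 0 T) : -bern b σ α f p t ≤ (1 - gap b T) * f t ^ 2 := by
  have hT := h.small.1
  set d := gap b T with hd
  set κ := 1 - 1 / b with hκ
  have hκ0 : 0 < κ := omega_pos hb
  have hκ1 : κ ≤ 1 := by
    rw [hκ]
    have : 0 < 1 / b := by positivity
    linarith
  have hd0 : 0 < d := gap_pos hb hT
  have hdT : d * T ^ 2 = κ / 100 := gap_mul hT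
  have hd1 : d ≤ κ / 100 := gap_le hb hT
  obtain ⟨-, -, hσ⟩ := h.curvature_small hb hL
  have hb0 : 0 < b := by linarith
  -- elementary consequences of smallness
  have hσ1 : |σ| * (1 + T) ≤ κ / 100 := by
    refine le_trans (mul_le_mul_of_nonneg_left ?_ (abs_nonneg _)) hσ
    exact le_self_pow₀ (by linarith) (by norm_num)
  have hσp : 0 ≤ |σ| * T := by positivity
  have hσe : |σ| * (1 + T) = |σ| + |σ| * T := by ring
  have hσ0 : |σ| ≤ κ / 100 := by linarith
  have hσT : |σ| * T ≤ κ / 100 := by linarith [abs_nonneg σ]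
  have hσT1 : |σ| * T ≤ 1 / 100 := by linarith
  have hσt : ∀ s ∈ Icc 0 T, |σ * s| ≤ κ / 100 := by
    intro s hs
    rw [abs_mul, abs_of_nonneg hs.1]
    refine le_trans (mul_le_mul_of_nonneg_left ?_ (abs_nonneg _)) hσ1
    linarith [hs.2]
  have hw2 : ∀ s ∈ Icc 0 T, wt σ s ^ 2 / b ≤ 1 - κ + κ / 10 := by
    intro s hs
    have h1 := abs_le.1 (hσt s hs)
    have h2 : wt σ s ^ 2 ≤ 1 + κ / 10 := by
      unfold wt
      nlinarith [h1.1, h1.2]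
    have h3 : 1 - κ = 1 / b := by rw [hκ]; ring
    rw [h3, div_le_iff₀ hb0]
    have : (1 / b + κ / 10) * b = 1 + κ / 10 * b := by field_simp
    rw [this]
    nlinarith
  -- it is enough to bound `p`
  have suff : ∀ s ∈ Icc 0 T, p s ^ 2 ≤ f s ^ 2 * (mom σ α s ^ 2 + κ / 2) →
      0 ≤ (1 - d) * f s ^ 2 + bern b σ α f p s := by
    intro s hs hp
    have h1 := hw2 s hs
    have h0 : 0 ≤ wt σ s ^ 2 / b := by positivity
    unfold bern
    have e : wt σ s ^ 2 / (2 * b) * (2 * f s ^ 2 - f s ^ 4) =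
        wt σ s ^ 2 / b * f s ^ 2 - wt σ s ^ 2 / b * f s ^ 4 / 2 := by field_simp
    rw [e]
    have h2 : 0 ≤ wt σ s ^ 2 / b * f s ^ 4 / 2 := by positivity
    have h3 : wt σ s ^ 2 / b * f s ^ 2 ≤ (1 - κ + κ / 10) * f s ^ 2 :=
      mul_le_mul_of_nonneg_right h1 (sq_nonneg _)
    nlinarith [sq_nonneg (f s), mul_nonneg hκ0.le (sq_nonneg (f s)),
      mul_le_mul_of_nonneg_right hd1 (sq_nonneg (f s))]
  have hcont : ContinuousOn (fun s => (1 - d) * f s ^ 2 + bern b σ α f p s) (Icc 0 T) :=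
    (continuousOn_const.mul (h.sol.continuousOn_f.pow 2)).add
      fun s hs => (h.hasDerivAt_bern hs).continuousAt.continuousWithinAt
  obtain ⟨s, hs, hmin⟩ := isCompact_Icc.exists_isMinOn
    (⟨0, left_mem_Icc.2 h.small.pos.le⟩ : (Icc 0 T).Nonempty) hcont
  have key : 0 ≤ (1 - d) * f s ^ 2 + bern b σ α f p s := by
    apply suff s hs
    rcases eq_or_ne s 0 with rfl | hs0
    · rw [h.sol.p0, zero_pow two_ne_zero]; positivity
    rcases eq_or_ne s T with rfl | hsT
    · rw [h.sol.pT, zero_pow two_ne_zero]; positivity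
    have hsI : s ∈ Ioo 0 T := ⟨lt_of_le_of_ne hs.1 hs0.symm, lt_of_le_of_ne hs.2 hsT⟩
    have hder := (((h.sol.hf s hs).pow 2).const_mul (1 - d)).add (h.hasDerivAt_bern hs)
    have hz := (hmin.isLocalMin (Icc_mem_nhds hsI.1 hsI.2)).hasDerivAt_eq_zero hder
    simp only [Nat.cast_ofNat, Nat.add_one_sub_one, pow_one] at hz
    have hw := h.small'.wt_pos s hs
    have hf := h.sol.pos s hs
    have hf1 := h.sol.le_one s hs
    set A := mom σ α s with hA
    set w := wt σ s with hwdef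
    set e := σ / (2 * b) * (2 - f s ^ 2) with he
    have hp : (1 - d) * p s = -(w ^ 2 * f s * (A + e)) := by
      have hz' : 2 * f s / w * ((1 - d) * p s + w ^ 2 * f s * (A + e)) = 0 := by
        rw [← hz, he]
        field_simp
      have h1 : 2 * f s / w ≠ 0 := by positivity
      linarith [(mul_eq_zero.1 hz').resolve_left h1]
    have hee : |e| ≤ |σ| := by
      rw [he, abs_mul, abs_div, abs_of_pos (by linarith : 0 < 2 * b)]
      have h2 : |2 - f s ^ 2| ≤ 2 := abs_le.2 ⟨by nlinarith, by nlinarith⟩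
      calc |σ| / (2 * b) * |2 - f s ^ 2| ≤ |σ| / (2 * b) * 2 :=
            mul_le_mul_of_nonneg_left h2 (by positivity)
        _ = |σ| / b := by field_simp
        _ ≤ |σ| := div_le_self (abs_nonneg _) hb.le
    have hAT : |A| ≤ 2 * T := h.abs_mom_le hs
    have hAe : (A + e) ^ 2 ≤ A ^ 2 + κ / 10 := by
      have h1 : |A * e| ≤ 2 * T * |σ| := by
        rw [abs_mul]; exact mul_le_mul hAT hee (abs_nonneg _) (by linarith)
      have h2 : |e| ^ 2 ≤ |σ| ^ 2 := pow_le_pow_left₀ (abs_nonneg _) hee 2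
      rw [sq_abs] at h2
      have h3 := le_abs_self (A * e)
      have h4 : |σ| ^ 2 ≤ |σ| := by
        rw [sq]; exact mul_le_of_le_one_left (abs_nonneg _) (by linarith)
      have h5 : (A + e) ^ 2 = A ^ 2 + 2 * (A * e) + e ^ 2 := by ring
      rw [h5]
      linarith
    have hw4 : w ^ 4 ≤ 1 + 5 * (|σ| * T) := by
      have h1 : |σ * s| ≤ |σ| * T := by
        rw [abs_mul, abs_of_nonneg hs.1]
        exact mul_le_mul_of_nonneg_left hs.2 (abs_nonneg _)
      have h2 : w ≤ 1 + |σ| * T := by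
        rw [hwdef]; unfold wt; linarith [(abs_le.1 h1).1]
      exact (pow_le_pow_left₀ hw.le h2 4).trans (one_add_pow_four_le hσp hσT1)
    have hA2 : A ^ 2 ≤ 4 * T ^ 2 := by
      have := pow_le_pow_left₀ (abs_nonneg _) hAT 2
      rw [sq_abs] at this
      linarith
    have hσ3 : |σ| * T * T ^ 2 ≤ κ / 100 := by
      refine le_trans (le_of_eq (by ring)) (le_trans (mul_le_mul_of_nonneg_left
        (pow_le_pow_left₀ (by linarith) (by linarith : T ≤ 1 + T) 3) (abs_nonneg σ)) hσ)
    have hmain : w ^ 4 * (A + e) ^ 2 ≤ (1 - d) ^ 2 * (A ^ 2 + κ / 2) :=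
      weighted_sq_le hκ0 hκ1 hd0 hd1 hdT hA2 (by positivity) hσT1 hσ3
        hw4 hAe (sq_nonneg _)
    have h1d : 0 < 1 - d := by linarith
    have hsq : (1 - d) ^ 2 * p s ^ 2 = f s ^ 2 * (w ^ 4 * (A + e) ^ 2) := by
      rw [← mul_pow, hp]; ring
    have h2 : (1 - d) ^ 2 * p s ^ 2 ≤ (1 - d) ^ 2 * (f s ^ 2 * (A ^ 2 + κ / 2)) := by
      rw [hsq]
      refine (mul_le_mul_of_nonneg_left hmain (sq_nonneg (f s))).trans (le_of_eq ?_)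
      ring
    exact le_of_mul_le_mul_left h2 (by positivity)
  have := hmin ht
  simp only [mem_ofPred_eq] at this
  linarith

end Ctrl

end

/-! ### The current function and coercivity in phase and density -/

noncomputable section

namespace Ctrl

variable {b X τ C T σ α : ℝ} {f p : ℝ → ℝ}

theorem two_sub_bounds (h : Ctrl b X τ C T σ α f p) {t : ℝ} (ht : t ∈ Icc 0 T) :
    0 ≤ 2 * f t ^ 2 - f t ^ 4 ∧ 2 * f t ^ 2 - f t ^ 4 ≤ 2 * f t ^ 2 := by
  have h0 := h.sol.pos t ht
  have h1 := h.sol.le_one t ht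
  have : f t ^ 4 ≤ f t ^ 2 := pow_le_pow_of_le_one h0.le h1 (by norm_num)
  have : 0 ≤ f t ^ 4 := by positivity
  constructor <;> nlinarith [sq_nonneg (f t)]

section Current

variable {F : ℝ → ℝ}

/-- As `mom` is increasing, `F` first decreases and then increases, and it vanishes at both ends. -/
theorem current_nonpos (h : Ctrl b X τ C T σ α f p) (hF0 : F 0 = 0) (hFT : F T = 0)
    (hF : ∀ t ∈ Icc 0 T, HasDerivAt F (2 * mom σ α t / wt σ t * f t ^ 2) t) {t : ℝ}
    (ht : t ∈ Icc 0 T) : F t ≤ 0 := by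
  have hmono : MonotoneOn (mom σ α) (Icc 0 T) :=
    monotoneOn_of_hasDerivAt_nonneg (fun x _ => hasDerivAt_mom σ α x)
      fun x hx => (h.small'.wt_pos x hx).le
  rcases le_total (mom σ α t) 0 with hA | hA
  · have := antitoneOn_of_hasDerivAt_nonpos (a := 0) (c := t)
      (fun x hx => hF x ⟨hx.1, hx.2.trans ht.2⟩) fun x hx => by
        have hx' : x ∈ Icc 0 T := ⟨hx.1, hx.2.trans ht.2⟩
        have h1 := hmono hx' ht hx.2
        exact mul_nonpos_of_nonpos_of_nonneg (div_nonpos_of_nonpos_of_nonneg (by linarith)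
          (h.small'.wt_pos x hx').le) (sq_nonneg _)
    rw [← hF0]
    exact this (left_mem_Icc.2 ht.1) (right_mem_Icc.2 ht.1) ht.1
  · have := monotoneOn_of_hasDerivAt_nonneg (a := t) (c := T)
      (fun x hx => hF x ⟨ht.1.trans hx.1, hx.2⟩) fun x hx => by
        have hx' : x ∈ Icc 0 T := ⟨ht.1.trans hx.1, hx.2⟩
        have h1 := hmono ht hx' hx.1
        have h2 : 0 ≤ mom σ α x := by linarith
        have h3 := (h.small'.wt_pos x hx').le
        positivity
    rw [← hFT]
    exact this (left_mem_Icc.2 ht.2) (right_mem_Icc.2 ht.2) ht.2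

/-- Integrate the current from `t` to `T` and compare `f` with its value at `t` by the Harnack
inequality. This crude bound is used only where `g` is exponentially small. -/
theorem neg_current_le (h : Ctrl b X τ C T σ α f p) (hFT : F T = 0)
    (hF : ∀ t ∈ Icc 0 T, HasDerivAt F (2 * mom σ α t / wt σ t * f t ^ 2) t) {t : ℝ}
    (ht : t ∈ Icc 0 T) : -F t ≤ 8 * T ^ 2 * C ^ 2 * f t ^ 2 := by
  have key := norm_image_sub_le_of_norm_deriv_le_segment' (f := F) (a := t) (b := T)
    (fun x hx => (hF x ⟨ht.1.trans hx.1, hx.2⟩).hasDerivWithinAt)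
    (C := 8 * T * C ^ 2 * f t ^ 2) (fun x hx => by
      have hx' : x ∈ Icc 0 T := ⟨ht.1.trans hx.1, hx.2.le⟩
      have h1 := h.abs_mom_le hx'
      have h2 := h.small'.wt_half x hx'
      have h3 := h.sq_harnack ht hx' hx.1
      rw [Real.norm_eq_abs, abs_mul, abs_div, abs_mul, abs_two,
        abs_of_pos (by linarith [h2.1] : 0 < wt σ x), abs_of_nonneg (sq_nonneg (f x))]
      have h4 : 2 * |mom σ α x| / wt σ x ≤ 8 * T := by
        rw [div_le_iff₀ (by linarith [h2.1])]
        nlinarith [h2.1, h.small.1]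
      calc 2 * |mom σ α x| / wt σ x * f x ^ 2 ≤ 8 * T * (C ^ 2 * f t ^ 2) :=
            mul_le_mul h4 h3 (sq_nonneg _) (by linarith [h.small.1])
        _ = _ := by ring) T (right_mem_Icc.2 ht.2)
  rw [hFT, zero_sub, norm_neg, Real.norm_eq_abs] at key
  have h5 : 8 * T * C ^ 2 * f t ^ 2 * (T - t) ≤ 8 * T * C ^ 2 * f t ^ 2 * T := by
    refine mul_le_mul_of_nonneg_left (by linarith [ht.1]) ?_
    have := h.small.pos.le
    positivity
  have h6 := neg_abs_le (F t)
  have h7 : 8 * T * C ^ 2 * f t ^ 2 * T = 8 * T ^ 2 * C ^ 2 * f t ^ 2 := by ring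
  linarith

/-- Up to curvature errors `F - bern` is constant and `F T = 0`, so `-F t` is close to `-bern t +
bern T`. The first term is handled by `neg_bern_le`. The second is at most `4 T² f(T)²`,
exponentially small relative to `f(t)²` because `t ≤ T / 2`. The two errors together consume half of
the gap. -/
theorem neg_current_le_half (h : Ctrl b X τ C T σ α f p) (hb : 1 < b) (hL : Large b C T)
    (hFT : F T = 0) (hF : ∀ t ∈ Icc 0 T, HasDerivAt F (2 * mom σ α t / wt σ t * f t ^ 2) t)
    {t : ℝ} (ht : t ∈ Icc 0 T) (htT : t ≤ T / 2) : -F t ≤ (1 - gap b T / 2) * f t ^ 2 := by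
  have hT := h.small.1
  have hTm : T ∈ Icc 0 T := right_mem_Icc.2 h.small.pos.le
  set d := gap b T with hd
  have hdT : d * T ^ 2 = (1 - 1 / b) / 100 := gap_mul hT
  obtain ⟨-, hσ, -⟩ := h.curvature_small hb hL
  have hb0 : 0 < b := by linarith
  set S := |σ| * (1 + T) ^ 2 with hS
  have hS0 : 0 ≤ S := by positivity
  -- comparison of the current with the conserved quantity
  have key := norm_image_sub_le_of_norm_deriv_le_segment' (f := fun t => F t - bern b σ α f p t)
    (a := t) (b := T)
    (fun x hx => ((hF x ⟨ht.1.trans hx.1, hx.2⟩).sub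
      (h.hasDerivAt_bern ⟨ht.1.trans hx.1, hx.2⟩)).hasDerivWithinAt)
    (C := 20 * S * C ^ 2 * f t ^ 2) (fun x hx => by
      have hx' : x ∈ Icc 0 T := ⟨ht.1.trans hx.1, hx.2.le⟩
      have h1 := h.abs_mom_le hx'
      have h2 := h.small'.wt_half x hx'
      have h3 := h.sq_harnack ht hx' hx.1
      have hw0 : 0 < wt σ x := by linarith [h2.1]
      have h4 := h.two_sub_bounds hx'
      have e : 2 * mom σ α x / wt σ x * f x ^ 2 - (2 * mom σ α x * wt σ x * f x ^ 2 +
          σ * wt σ x / b * (2 * f x ^ 2 - f x ^ 4)) =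
          2 * mom σ α x * ((1 + wt σ x) / wt σ x) * (σ * x) * f x ^ 2
          - σ * (wt σ x / b) * (2 * f x ^ 2 - f x ^ 4) := by
        have : σ * x = 1 - wt σ x := by unfold wt; ring
        rw [this]
        field_simp
        ring
      rw [e, Real.norm_eq_abs]
      refine (abs_sub _ _).trans ?_
      have e1 : |2 * mom σ α x * ((1 + wt σ x) / wt σ x) * (σ * x) * f x ^ 2|
          ≤ 12 * S * f x ^ 2 := by
        rw [abs_mul, abs_mul, abs_mul, abs_mul, abs_two, abs_mul σ, abs_of_nonneg hx'.1,
          abs_of_nonneg (sq_nonneg (f x)), abs_of_pos (by positivity : 0 < (1 + wt σ x) / wt σ x)]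
        refine mul_le_mul_of_nonneg_right ?_ (sq_nonneg _)
        have i1 : (1 + wt σ x) / wt σ x ≤ 3 := by
          rw [div_le_iff₀ hw0]; linarith [h2.1]
        have i2 : 2 * |mom σ α x| * ((1 + wt σ x) / wt σ x) ≤ 2 * (2 * T) * 3 :=
          mul_le_mul (by linarith) i1 (by positivity) (by linarith)
        have i3 : |σ| * x ≤ |σ| * (1 + T) :=
          mul_le_mul_of_nonneg_left (by linarith [hx'.2]) (abs_nonneg _)
        calc 2 * |mom σ α x| * ((1 + wt σ x) / wt σ x) * (|σ| * x) ≤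
              2 * (2 * T) * 3 * (|σ| * (1 + T)) :=
              mul_le_mul i2 i3 (mul_nonneg (abs_nonneg _) hx'.1) (by linarith)
          _ = 12 * (|σ| * (1 + T) * T) := by ring
          _ ≤ 12 * (|σ| * (1 + T) * (1 + T)) := by
              have : 0 ≤ |σ| * (1 + T) := by positivity
              nlinarith
          _ = 12 * S := by rw [hS]; ring
      have e2 : |σ * (wt σ x / b) * (2 * f x ^ 2 - f x ^ 4)| ≤ 4 * S * f x ^ 2 := by
        rw [abs_mul, abs_mul, abs_of_nonneg h4.1, abs_of_pos (by positivity : 0 < wt σ x / b)]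
        have i1 : wt σ x / b ≤ 2 := by rw [div_le_iff₀ hb0]; nlinarith [h2.2]
        have i2 : |σ| ≤ S := by
          rw [hS]
          exact le_mul_of_one_le_right (abs_nonneg _) (one_le_pow₀ (by linarith))
        calc |σ| * (wt σ x / b) * (2 * f x ^ 2 - f x ^ 4) ≤ S * 2 * (2 * f x ^ 2) :=
              mul_le_mul (mul_le_mul i2 i1 (by positivity) hS0) h4.2 h4.1 (by positivity)
          _ = _ := by ring
      calc _ ≤ 12 * S * f x ^ 2 + 4 * S * f x ^ 2 := add_le_add e1 e2
        _ ≤ 20 * S * f x ^ 2 := by nlinarith [mul_nonneg hS0 (sq_nonneg (f x))]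
        _ ≤ 20 * S * (C ^ 2 * f t ^ 2) := mul_le_mul_of_nonneg_left h3 (by positivity)
        _ = _ := by ring) T (right_mem_Icc.2 ht.2)
  simp only [hFT, Real.norm_eq_abs] at key
  -- the error terms
  have hd0 := gap_pos hb hT
  have hf2 := sq_nonneg (f t)
  have herr : 20 * S * C ^ 2 * f t ^ 2 * (T - t) ≤ d / 4 * f t ^ 2 := by
    have i1 : 20 * S * C ^ 2 * T ≤ d / 4 := by
      have j1 : S * T * T ^ 2 * T ≤ 1 / 100 := by
        refine le_trans (le_trans (le_of_eq ?_) (mul_le_mul_of_nonneg_right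
          (mul_le_mul_of_nonneg_left (by linarith : T ≤ 1 + T) hS0) (by positivity :
            0 ≤ T ^ 3))) ((le_of_eq ?_).trans hσ)
        · ring
        · rw [hS]; ring
      have j2 : 80 * C ^ 2 * (S * T * T ^ 2) ≤ (1 - 1 / b) / 100 := by
        have : 80 * C ^ 2 * (S * T * T ^ 2) ≤ (1 - 1 / b) * T * (S * T * T ^ 2) :=
          mul_le_mul_of_nonneg_right hL.lin (by positivity)
        have := omega_pos hb
        nlinarith
      rw [← hdT] at j2
      have : 80 * C ^ 2 * S * T ≤ d := by
        have : (80 * C ^ 2 * S * T) * T ^ 2 ≤ d * T ^ 2 := by linarith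
        exact le_of_mul_le_mul_right this (by positivity)
      linarith
    have i2 : 20 * S * C ^ 2 * f t ^ 2 * (T - t) ≤ 20 * S * C ^ 2 * f t ^ 2 * T :=
      mul_le_mul_of_nonneg_left (by linarith [ht.1]) (by positivity)
    nlinarith
  have hbT : bern b σ α f p T ≤ d / 4 * f t ^ 2 := by
    have i1 : bern b σ α f p T ≤ 4 * T ^ 2 * f T ^ 2 := by
      unfold bern
      have j1 := h.two_sub_bounds hTm
      have j2 : 0 ≤ wt σ T ^ 2 / (2 * b) * (2 * f T ^ 2 - f T ^ 4) :=
        mul_nonneg (by positivity) j1.1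
      have j3 : mom σ α T ^ 2 ≤ 4 * T ^ 2 := by
        have := pow_le_pow_left₀ (abs_nonneg _) (h.abs_mom_le hTm) 2
        rw [sq_abs] at this
        linarith
      have := mul_le_mul_of_nonneg_right j3 (sq_nonneg (f T))
      nlinarith [sq_nonneg (p T)]
    have hT2 : T / 2 ∈ Icc 0 T := ⟨by linarith, by linarith⟩
    have i2 := (h.sol.decay hb h.small' h.lower_phase.le h.hX (s := T / 2) (t := T)
      (by linarith [h.hτ, h.hτT]) (by linarith) le_rfl).2
    have i3 := h.harnack t ht (T / 2) hT2 htT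
    set E := Real.exp (-(T / 2)) with hE
    have hE0 : 0 < E := Real.exp_pos _
    have hE1 : E ≤ 1 := Real.exp_le_one_iff.2 (by linarith)
    rw [show T / 2 - T = -(T / 2) by ring] at i2
    have i4 : f T ≤ 2 * E * C * f t := by
      calc f T ≤ 2 * E * f (T / 2) := i2
        _ ≤ 2 * E * (C * f t) := mul_le_mul_of_nonneg_left i3 (by positivity)
        _ = _ := by ring
    have i5 : f T ^ 2 ≤ (2 * E * C * f t) ^ 2 := pow_le_pow_left₀ (h.sol.pos T hTm).le i4 2
    have i6 : 16 * T ^ 2 * E ^ 2 * C ^ 2 ≤ d / 4 := by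
      have j0 : 103200 * C ^ 8 * T ^ 6 * E ≤ 1 - 1 / b := hL.exp
      have hC0 : 0 < C := by linarith [h.hC]
      have j4 : 0 ≤ C ^ 8 * T ^ 6 * E := by positivity
      have j1 : C ^ 2 * T ^ 4 * E ≤ C ^ 8 * T ^ 6 * E := by
        have := pow_le_pow_right₀ h.hC (by norm_num : 2 ≤ 8)
        have := pow_le_pow_right₀ hT (by norm_num : 4 ≤ 6)
        gcongr
      have j2 : C ^ 2 * T ^ 4 * E ^ 2 ≤ C ^ 2 * T ^ 4 * E := by
        refine mul_le_mul_of_nonneg_left ?_ (by positivity)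
        rw [sq]; exact mul_le_of_le_one_left hE0.le hE1
      have j3 : (64 * T ^ 2 * E ^ 2 * C ^ 2) * T ^ 2 ≤ d * T ^ 2 := by
        rw [hdT]
        have : (64 * T ^ 2 * E ^ 2 * C ^ 2) * T ^ 2 = 64 * (C ^ 2 * T ^ 4 * E ^ 2) := by ring
        rw [this]
        linarith
      have := le_of_mul_le_mul_right j3 (by positivity)
      linarith
    calc bern b σ α f p T ≤ 4 * T ^ 2 * f T ^ 2 := i1
      _ ≤ 4 * T ^ 2 * (2 * E * C * f t) ^ 2 := mul_le_mul_of_nonneg_left i5 (by positivity)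
      _ = 16 * T ^ 2 * E ^ 2 * C ^ 2 * f t ^ 2 := by ring
      _ ≤ d / 4 * f t ^ 2 := mul_le_mul_of_nonneg_right i6 hf2
  have hneg := h.neg_bern_le hb hL ht
  have := (abs_le.1 key).2
  have := (abs_le.1 key).1
  have e : (1 - d / 2) * f t ^ 2 = (1 - d) * f t ^ 2 + d / 4 * f t ^ 2 + d / 4 * f t ^ 2 := by ring
  rw [e]
  linarith

end Current

/-- Coercivity of the functional with respect to the phase and the density. -/
theorem coercive (h : Ctrl b X τ C T σ α f p) (hb : 1 < b) (hL : Large b C T)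
    (hcur : ∫ t in (0 : ℝ)..T, 2 * mom σ α t / wt σ t * f t ^ 2 = 0)
    {σ' α' : ℝ} {g q : ℝ → ℝ} (h' : Ctrl b X τ C T σ' α' g q) :
    (α' - α) ^ 2 * ((1 - 1 / b) / (800 * T ^ 2 * C ^ 2)) +
      (∫ t in (0 : ℝ)..T, wt σ t / (2 * b) * (f t ^ 2 - g t ^ 2) ^ 2)
      ≤ J b T σ α' g - J b T σ α f := by
  have hT := h.small.1
  have hT0 := h.small.pos
  have hC0 : 0 < C := by linarith [h.hC]
  have hw' : ∀ t ∈ Icc 0 T, wt σ t ≠ 0 := fun t ht => (h.small'.wt_pos t ht).ne'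
  have hg := h'.sol.h1on hT0 h'.small'.wt_pos
  have hgc := h'.sol.continuousOn_f
  have c1 := (continuous_wt σ).continuousOn (s := Icc 0 T)
  have c2 := (continuous_mom σ α).continuousOn (s := Icc 0 T)
  obtain ⟨F, hF0, hF, hFT⟩ := exists_primitive hT0 (φ := fun t => 2 * mom σ α t / wt σ t * f t ^ 2)
    (((continuousOn_const.mul c2).div c1 hw').mul (h.sol.continuousOn_f.pow 2))
  rw [hcur] at hFT
  have hFc : ContinuousOn F (Icc 0 T) := fun t ht => (hF t ht).continuousAt.continuousWithinAt
  have key := h.sol.le_J_add_phase_sub hT0 h.small'.wt_pos hg (α' - α) hF0 hFT hF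
  rw [add_sub_cancel] at key
  refine le_trans (add_le_add_left ?_ _) key
  set δ := α' - α with hδ
  set d := gap b T with hd
  have hd0 : 0 < d := gap_pos hb hT
  have hdT : d * T ^ 2 = (1 - 1 / b) / 100 := gap_mul hT
  set E := Real.exp (-(T / 2)) with hE
  have hE0 : 0 < E := Real.exp_pos _
  -- Past `T / 2` the factor `1 - (F / f²)²` may be as negative as `-(8 T² C²)²`, but there `g² ≤ C²
  -- E exp (-t)`. The resulting loss is at most `R exp (-t)`, where `129 = 2 · 64 + 1`.
  set R := 129 * T ^ 4 * C ^ 6 * E with hR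
  have hR0 : 0 < R := by positivity
  -- pointwise lower bound
  have hpt : ∀ t ∈ Icc 0 T, δ ^ 2 * (d / 4 * g t ^ 2 - R * Real.exp (-t)) ≤
      δ ^ 2 / wt σ t * (1 - (F t / f t ^ 2) ^ 2) * g t ^ 2 := by
    intro t ht
    have hw := h.small'.wt_half t ht
    have hf := h.sol.pos t ht
    have hf2 : 0 < f t ^ 2 := by positivity
    have hFn := h.current_nonpos hF0 hFT hF ht
    have e : δ ^ 2 / wt σ t * (1 - (F t / f t ^ 2) ^ 2) * g t ^ 2 =
        δ ^ 2 * (1 / wt σ t * (1 - (F t / f t ^ 2) ^ 2) * g t ^ 2) := by ring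
    rw [e]
    refine mul_le_mul_of_nonneg_left ?_ (sq_nonneg _)
    set y := -(F t / f t ^ 2) with hy
    have hysq : (F t / f t ^ 2) ^ 2 = y ^ 2 := by rw [hy]; ring
    rw [hysq]
    have hy0 : 0 ≤ y := neg_nonneg.2 (div_nonpos_of_nonpos_of_nonneg hFn hf2.le)
    have hyF : y * f t ^ 2 = -F t := by rw [hy]; field_simp
    have hw1 : 1 / 2 ≤ 1 / wt σ t := by
      rw [le_div_iff₀ (by linarith [hw.1])]; linarith [hw.2]
    have hw2 : 1 / wt σ t ≤ 2 := by
      rw [div_le_iff₀ (by linarith [hw.1])]; linarith [hw.1]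
    rcases le_total t (T / 2) with htT | htT
    · have h1 := h.neg_current_le_half hb hL hFT hF ht htT
      rw [← hyF] at h1
      have h2 : y ≤ 1 - d / 2 := le_of_mul_le_mul_right h1 hf2
      have h3 : d / 2 ≤ 1 - y ^ 2 := by nlinarith
      have h4 : d / 4 ≤ 1 / wt σ t * (1 - y ^ 2) := by
        have := mul_le_mul hw1 h3 (by positivity) (by linarith)
        linarith
      have h5 := mul_le_mul_of_nonneg_right h4 (sq_nonneg (g t))
      have : 0 < R * Real.exp (-t) := by positivity
      linarith
    · have h1 := h.neg_current_le hFT hF ht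
      rw [← hyF] at h1
      have h2 : y ≤ 8 * T ^ 2 * C ^ 2 := le_of_mul_le_mul_right h1 hf2
      have h3 : y ^ 2 ≤ (8 * T ^ 2 * C ^ 2) ^ 2 := pow_le_pow_left₀ hy0 h2 2
      have h4 : g t ^ 2 ≤ C ^ 2 * E * Real.exp (-t) := by
        have i1 := pow_le_pow_left₀ (h'.sol.pos t ht).le (h'.le_exp t ht) 2
        have i2 : Real.exp (-t) ≤ E := Real.exp_le_exp.2 (by linarith)
        have i3 : (C * Real.exp (-t)) ^ 2 = C ^ 2 * Real.exp (-t) * Real.exp (-t) := by ring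
        rw [i3] at i1
        refine i1.trans (mul_le_mul_of_nonneg_right (mul_le_mul_of_nonneg_left i2 (sq_nonneg _))
          (Real.exp_pos _).le)
      have hd1 : d / 4 ≤ T ^ 4 * C ^ 4 := by
        have := gap_le hb hT
        have e1 : 1 ≤ T ^ 4 * C ^ 4 := by
          have := one_le_pow₀ hT (n := 4)
          have := one_le_pow₀ h.hC (n := 4)
          nlinarith
        have e2 : 0 < 1 / b := by positivity
        linarith
      have h5 : 1 / wt σ t * y ^ 2 ≤ 128 * (T ^ 4 * C ^ 4) := by
        calc 1 / wt σ t * y ^ 2 ≤ 2 * (8 * T ^ 2 * C ^ 2) ^ 2 :=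
              mul_le_mul hw2 h3 (sq_nonneg _) (by norm_num)
          _ = _ := by ring
      have h6 : (d / 4 + 1 / wt σ t * y ^ 2) * g t ^ 2 ≤
          (129 * (T ^ 4 * C ^ 4)) * (C ^ 2 * E * Real.exp (-t)) := by
        refine mul_le_mul (by linarith) h4 (sq_nonneg _) (by positivity)
      have h7 : (129 * (T ^ 4 * C ^ 4)) * (C ^ 2 * E * Real.exp (-t)) = R * Real.exp (-t) := by
        rw [hR]; ring
      have h8 : 0 ≤ 1 / wt σ t * g t ^ 2 := mul_nonneg (by linarith) (sq_nonneg _)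
      have h9 : 1 / wt σ t * (1 - y ^ 2) * g t ^ 2 =
        1 / wt σ t * g t ^ 2 - 1 / wt σ t * y ^ 2 * g t ^ 2 := by ring
      rw [h9]
      linarith
  have hq : ContinuousOn (fun t => F t / f t ^ 2) (Icc 0 T) :=
    hFc.div (h.sol.continuousOn_f.pow 2) fun t ht => pow_ne_zero _ (h.sol.pos t ht).ne'
  have hint : ∫ t in (0 : ℝ)..T, δ ^ 2 * (d / 4 * g t ^ 2 - R * Real.exp (-t)) ≤
      ∫ t in (0 : ℝ)..T, δ ^ 2 / wt σ t * (1 - (F t / f t ^ 2) ^ 2) * g t ^ 2 :=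
    intervalIntegral.integral_mono_on hT0.le
    (intervalIntegrable_of_continuousOn_Icc hT0.le (continuousOn_const.mul
      ((continuousOn_const.mul (hgc.pow 2)).sub
        (by fun_prop : Continuous fun t => R * Real.exp (-t)).continuousOn)))
    (intervalIntegrable_of_continuousOn_Icc hT0.le
      (((continuousOn_const.div c1 hw').mul (continuousOn_const.sub (hq.pow 2))).mul
        (hgc.pow 2))) hpt
  refine le_trans ?_ hint
  rw [intervalIntegral.integral_const_mul]
  refine mul_le_mul_of_nonneg_left ?_ (sq_nonneg _)
  have ig : IntervalIntegrable (fun t => d / 4 * g t ^ 2) volume 0 T :=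
    intervalIntegrable_of_continuousOn_Icc hT0.le (continuousOn_const.mul (hgc.pow 2))
  have ie : IntervalIntegrable (fun t => R * Real.exp (-t)) volume 0 T :=
    (by fun_prop : Continuous fun t => R * Real.exp (-t)).intervalIntegrable _ _
  have hsplit : ∫ t in (0 : ℝ)..T, (d / 4 * g t ^ 2 - R * Real.exp (-t)) =
      d / 4 * (∫ t in (0 : ℝ)..T, g t ^ 2) - R * ∫ t in (0 : ℝ)..T, Real.exp (-t) := by
    rw [intervalIntegral.integral_sub ig ie, intervalIntegral.integral_const_mul,
      intervalIntegral.integral_const_mul]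
  have hexp := integral_exp_neg_le_one (T := T)
  -- Already on `[0, 1]`, inside the boundary layer, `g ≥ 1 / C`.
  have hmass : 1 / C ^ 2 ≤ ∫ t in (0 : ℝ)..T, g t ^ 2 := by
    have hT1 : (1 : ℝ) ≤ T := hT
    have i1 : ∫ t in (0 : ℝ)..1, (1 / C ^ 2 : ℝ) ≤ ∫ t in (0 : ℝ)..1, g t ^ 2 := by
      apply intervalIntegral.integral_mono_on zero_le_one (by simp)
      · exact intervalIntegrable_of_continuousOn_Icc zero_le_one
          ((hgc.pow 2).mono (Icc_subset_Icc_right hT1))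
      · intro t ht
        have := h'.one_le t ⟨ht.1, by linarith [ht.2, h.hX, h.hτ]⟩
        rw [div_le_iff₀ (by positivity)]
        nlinarith
    have i2 : ∫ t in (0 : ℝ)..1, g t ^ 2 ≤ ∫ t in (0 : ℝ)..T, g t ^ 2 := by
      apply intervalIntegral.integral_mono_interval le_rfl zero_le_one hT1
      · exact Filter.Eventually.of_forall fun t => sq_nonneg _
      · exact intervalIntegrable_of_continuousOn_Icc hT0.le (hgc.pow 2)
    simp only [intervalIntegral.integral_const, sub_zero, one_smul] at i1
    exact i1.trans i2
  -- Half of the gain `d / (4 C²)` pays for `R`. This fixes the constant in `Large.exp`: `103200 =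
  -- 129 · 8 · 100`.
  have hRd : R ≤ d / (8 * C ^ 2) := by
    rw [le_div_iff₀ (by positivity)]
    have : (R * (8 * C ^ 2)) * T ^ 2 ≤ d * T ^ 2 := by
      rw [hdT, hR]
      have := hL.exp
      have e : 129 * T ^ 4 * C ^ 6 * E * (8 * C ^ 2) * T ^ 2 =
        (103200 * C ^ 8 * T ^ 6 * E) / 100 := by ring
      rw [e]
      linarith
    exact le_of_mul_le_mul_right this (by positivity)
  have hfin : (1 - 1 / b) / (800 * T ^ 2 * C ^ 2) = d / 4 * (1 / C ^ 2) - d / (8 * C ^ 2) := by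
    have : 1 - 1 / b = 100 * (d * T ^ 2) := by rw [hdT]; ring
    rw [this]
    field_simp
    ring
  rw [hfin]
  have h1 : d / 4 * (1 / C ^ 2) ≤ d / 4 * ∫ t in (0 : ℝ)..T, g t ^ 2 :=
    mul_le_mul_of_nonneg_left hmass (by positivity)
  have h2 : R * ∫ t in (0 : ℝ)..T, Real.exp (-t) ≤ R := mul_le_of_le_one_right hR0.le hexp
  rw [hsplit]
  linarith

end Ctrl

end

/-! ### Dependence of the energy on the curvature -/

noncomputable section

theorem abs_wt_sub (σ σ' : ℝ) {t : ℝ} (ht : 0 ≤ t) : |wt σ t - wt σ' t| = |σ - σ'| * t := by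
  have : wt σ t - wt σ' t = -((σ - σ') * t) := by unfold wt; ring
  rw [this, abs_neg, abs_mul, abs_of_nonneg ht]

theorem abs_mom_sub (σ σ' α : ℝ) (t : ℝ) :
    |mom σ α t - mom σ' α t| = |σ - σ'| * (t ^ 2 / 2) := by
  have : mom σ α t - mom σ' α t = -((σ - σ') * (t ^ 2 / 2)) := by unfold mom; ring
  rw [this, abs_neg, abs_mul, abs_of_nonneg (by positivity : (0:ℝ) ≤ t ^ 2 / 2)]

theorem abs_mom_le_of_small {X T σ α : ℝ} (hX : 2 ≤ X) (hs : Small (1 / 100) T σ) (hα : -X ≤ α)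
    (hα2 : α ≤ 2) {t : ℝ} (ht : t ∈ Icc 0 T) : |mom σ α t| ≤ (X + 1) * (1 + t) := by
  have h1 := hs.mom_bounds α ht
  rw [abs_le]
  constructor <;> nlinarith [h1.1, h1.2, ht.1]

/-- The potentials `A² / w` for two curvatures. -/
theorem abs_potential_sub_le {X T σ σ' α : ℝ} (hX : 2 ≤ X) (hs : Small (1 / 100) T σ)
    (hs' : Small (1 / 100) T σ') (hα : -X ≤ α) (hα2 : α ≤ 2) {t : ℝ} (ht : t ∈ Icc 0 T) :
    |mom σ α t ^ 2 / wt σ t - mom σ' α t ^ 2 / wt σ' t| ≤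
      12 * (X + 1) ^ 2 * (1 + t) ^ 3 * |σ - σ'| := by
  have hw := hs.wt_half t ht
  have hw' := hs'.wt_half t ht
  have hA := abs_mom_le_of_small hX hs hα hα2 ht
  have hA' := abs_mom_le_of_small hX hs' hα hα2 ht
  have hw0 : 0 < wt σ t := by linarith [hw.1]
  have hw0' : 0 < wt σ' t := by linarith [hw'.1]
  have d1 := abs_wt_sub σ σ' ht.1
  have d2 := abs_mom_sub σ σ' α t
  set D := |σ - σ'| with hD
  have hD0 : 0 ≤ D := abs_nonneg _
  have e : mom σ α t ^ 2 / wt σ t - mom σ' α t ^ 2 / wt σ' t =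
      (mom σ α t - mom σ' α t) * (mom σ α t + mom σ' α t) * (1 / wt σ t)
      - mom σ' α t ^ 2 * ((wt σ t - wt σ' t) * (1 / (wt σ t * wt σ' t))) := by
    field_simp
    ring
  have i1 : 1 / wt σ t ≤ 2 := by rw [div_le_iff₀ hw0]; linarith [hw.1]
  have i2 : 1 / (wt σ t * wt σ' t) ≤ 4 := by
    rw [div_le_iff₀ (by positivity)]; nlinarith [hw.1, hw'.1]
  set B := (X + 1) * (1 + t) with hB
  have hB0 : 0 ≤ B := by have := ht.1; positivity
  rw [e]
  refine (abs_sub _ _).trans ?_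
  rw [abs_mul, abs_mul, abs_mul, abs_mul, d1, d2, abs_of_nonneg (sq_nonneg (mom σ' α t)),
    abs_of_pos (by positivity : 0 < 1 / wt σ t),
    abs_of_pos (by positivity : 0 < 1 / (wt σ t * wt σ' t))]
  have i3 : |mom σ α t + mom σ' α t| ≤ 2 * B := (abs_add_le _ _).trans (by linarith)
  have i4 : mom σ' α t ^ 2 ≤ B ^ 2 := by
    rw [← sq_abs]; exact pow_le_pow_left₀ (abs_nonneg _) hA' 2
  have ht0 := ht.1
  calc D * (t ^ 2 / 2) * |mom σ α t + mom σ' α t| * (1 / wt σ t) +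
        mom σ' α t ^ 2 * (D * t * (1 / (wt σ t * wt σ' t)))
      ≤ D * (t ^ 2 / 2) * (2 * B) * 2 + B ^ 2 * (D * t * 4) := by
        gcongr
    _ = D * (2 * t ^ 2 * B + 4 * t * B ^ 2) := by ring
    _ ≤ D * (12 * (X + 1) ^ 2 * (1 + t) ^ 3) := by
        refine mul_le_mul_of_nonneg_left ?_ hD0
        have j1 : t ^ 2 * B ≤ (X + 1) ^ 2 * (1 + t) ^ 3 := by
          calc t ^ 2 * B ≤ (1 + t) ^ 2 * ((X + 1) ^ 2 * (1 + t)) := by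
                rw [hB]
                have : X + 1 ≤ (X + 1) ^ 2 := by nlinarith
                gcongr
                linarith
            _ = _ := by ring
        have j2 : t * B ^ 2 ≤ (X + 1) ^ 2 * (1 + t) ^ 3 := by
          calc t * B ^ 2 ≤ (1 + t) * B ^ 2 := by gcongr; linarith
            _ = _ := by rw [hB]; ring
        have j3 : 0 ≤ (X + 1) ^ 2 * (1 + t) ^ 3 := by positivity
        nlinarith
    _ = _ := by ring

theorem one_add_cube_mul_exp_le {t : ℝ} (ht : 0 ≤ t) :
    (1 + t) ^ 3 * Real.exp (-t) ≤ 18 := by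
  have h1 := Real.pow_div_factorial_le_exp (1 + t) (by linarith) 3
  have h2 : Real.exp (1 + t) = Real.exp 1 * Real.exp t := Real.exp_add _ _
  have h3 : (Nat.factorial 3 : ℝ) = 6 := by norm_num [Nat.factorial]
  rw [h3, div_le_iff₀ (by norm_num), h2] at h1
  have h4 : Real.exp 1 < 3 := Real.exp_one_lt_three
  have h5 : Real.exp t * Real.exp (-t) = 1 := by rw [← Real.exp_add]; simp
  calc (1 + t) ^ 3 * Real.exp (-t) ≤ Real.exp 1 * Real.exp t * 6 * Real.exp (-t) :=
        mul_le_mul_of_nonneg_right h1 (Real.exp_pos _).le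
    _ = 6 * Real.exp 1 * (Real.exp t * Real.exp (-t)) := by ring
    _ ≤ 18 := by rw [h5]; linarith

/-- Lipschitz constant of the energy with respect to the curvature. -/
def lipC (X C : ℝ) : ℝ := 18 * (4 * C ^ 2 + 12 * (X + 1) ^ 2 + 1) * C ^ 2

theorem lipC_pos {X C : ℝ} (hX : 2 ≤ X) (hC : 1 ≤ C) : 0 < lipC X C := by unfold lipC; positivity

namespace Ctrl

variable {b X τ C T σ α : ℝ} {f p : ℝ → ℝ}

/-- The coefficients change by at most `(1 + t)³ |σ - σ'|` up to constants, while `f` decays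
exponentially and `f'` is bounded by `(1 + t) f`. The polynomial weight is integrated away, hence
the Lipschitz constant does not depend on `T`. -/
theorem abs_J_sub_le (hb : 1 < b) {σ' : ℝ} (h : Ctrl b X τ C T σ' α f p)
    (hs : Small (1 / 100) T σ) :
    |J b T σ α f - J b T σ' α f| ≤ lipC X C * |σ - σ'| := by
  have hT0 := h.small.pos
  have hf1 := h.sol.h1on hT0 h.small'.wt_pos
  unfold J
  rw [← intervalIntegral.integral_sub (J_integrable b σ α hT0.le hs.wt_pos hf1)
    (J_integrable b σ' α hT0.le h.small'.wt_pos hf1)]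
  have hle : ∀ t ∈ Icc 0 T, |wt σ t * (deriv f t ^ 2 + mom σ α t ^ 2 / wt σ t ^ 2 * f t ^ 2
      - 1 / (2 * b) * (2 * f t ^ 2 - f t ^ 4)) - wt σ' t * (deriv f t ^ 2 +
      mom σ' α t ^ 2 / wt σ' t ^ 2 * f t ^ 2 - 1 / (2 * b) * (2 * f t ^ 2 - f t ^ 4))| ≤
      lipC X C * |σ - σ'| * Real.exp (-t) := by
    intro t ht
    have hw := hs.wt_half t ht
    have hw' := h.small'.wt_half t ht
    have hw0 : 0 < wt σ t := by linarith [hw.1]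
    have hw0' : 0 < wt σ' t := by linarith [hw'.1]
    have h1 := abs_potential_sub_le h.hX hs h.small' h.lower_phase.le h.phase_lt.le ht
    have h2 := abs_wt_sub σ σ' ht.1
    have h3 := h.two_sub_bounds ht
    have hf0 := h.sol.pos t ht
    have hd : deriv f t ^ 2 ≤ 4 * C ^ 2 * (1 + t) ^ 2 * f t ^ 2 := by
      rw [(h.sol.hf t ht).deriv]
      have i1 : |p t / wt σ' t| ≤ 2 * (C * (1 + t) * f t) := by
        rw [abs_div, abs_of_pos hw0', div_le_iff₀ hw0']
        have := h.abs_p_le t ht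
        have h0 : 0 ≤ C * (1 + t) * f t := (abs_nonneg _).trans this
        nlinarith [hw'.1]
      rw [← sq_abs]
      refine (pow_le_pow_left₀ (abs_nonneg _) i1 2).trans (le_of_eq ?_)
      ring
    set D := |σ - σ'| with hD
    have hD0 : 0 ≤ D := abs_nonneg _
    have e : wt σ t * (deriv f t ^ 2 + mom σ α t ^ 2 / wt σ t ^ 2 * f t ^ 2
      - 1 / (2 * b) * (2 * f t ^ 2 - f t ^ 4)) - wt σ' t * (deriv f t ^ 2 +
      mom σ' α t ^ 2 / wt σ' t ^ 2 * f t ^ 2 - 1 / (2 * b) * (2 * f t ^ 2 - f t ^ 4)) =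
      (wt σ t - wt σ' t) * deriv f t ^ 2 +
      (mom σ α t ^ 2 / wt σ t - mom σ' α t ^ 2 / wt σ' t) * f t ^ 2
      - (wt σ t - wt σ' t) * (1 / (2 * b) * (2 * f t ^ 2 - f t ^ 4)) := by
      field_simp
      ring
    rw [e]
    refine (abs_sub _ _).trans ((add_le_add_left (abs_add_le _ _) _).trans ?_)
    rw [abs_mul, abs_mul, abs_mul, h2, abs_of_nonneg (sq_nonneg (deriv f t)),
      abs_of_nonneg (sq_nonneg (f t)),
      abs_of_nonneg (mul_nonneg (by positivity) h3.1 : 0 ≤ 1 / (2 * b) * (2 * f t ^ 2 - f t ^ 4))]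
    have ht0 := ht.1
    have i2 : 1 / (2 * b) * (2 * f t ^ 2 - f t ^ 4) ≤ f t ^ 2 := by
      have : 1 / (2 * b) ≤ 1 / 2 := one_div_le_one_div_of_le (by norm_num) (by linarith)
      calc 1 / (2 * b) * (2 * f t ^ 2 - f t ^ 4) ≤ 1 / 2 * (2 * f t ^ 2) :=
            mul_le_mul this h3.2 h3.1 (by norm_num)
        _ = _ := by ring
    have i3 : D * t * deriv f t ^ 2 ≤ D * (1 + t) ^ 3 * (4 * C ^ 2) * f t ^ 2 := by
      calc D * t * deriv f t ^ 2 ≤ D * (1 + t) * (4 * C ^ 2 * (1 + t) ^ 2 * f t ^ 2) := by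
            gcongr; linarith
        _ = _ := by ring
    have i4 : D * t * (1 / (2 * b) * (2 * f t ^ 2 - f t ^ 4)) ≤ D * (1 + t) ^ 3 * f t ^ 2 := by
      have j1 : t ≤ (1 + t) ^ 3 := by
        have : (1 + t) ^ 1 ≤ (1 + t) ^ 3 := pow_le_pow_right₀ (by linarith) (by norm_num)
        linarith
      have i0 : 0 ≤ 1 / (2 * b) * (2 * f t ^ 2 - f t ^ 4) := mul_nonneg (by positivity) h3.1
      gcongr
    have i5 := mul_le_mul_of_nonneg_right h1 (sq_nonneg (f t))
    have i6 : f t ^ 2 ≤ C ^ 2 * (Real.exp (-t) * Real.exp (-t)) := by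
      refine (pow_le_pow_left₀ hf0.le (h.le_exp t ht) 2).trans (le_of_eq ?_)
      ring
    have i7 : (1 + t) ^ 3 * f t ^ 2 ≤ 18 * C ^ 2 * Real.exp (-t) := by
      calc (1 + t) ^ 3 * f t ^ 2 ≤ (1 + t) ^ 3 * (C ^ 2 * (Real.exp (-t) * Real.exp (-t))) := by
            gcongr
        _ = (1 + t) ^ 3 * Real.exp (-t) * (C ^ 2 * Real.exp (-t)) := by ring
        _ ≤ 18 * (C ^ 2 * Real.exp (-t)) :=
            mul_le_mul_of_nonneg_right (one_add_cube_mul_exp_le ht0) (by positivity)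
        _ = _ := by ring
    calc _ ≤ D * (1 + t) ^ 3 * (4 * C ^ 2) * f t ^ 2 +
          12 * (X + 1) ^ 2 * (1 + t) ^ 3 * D * f t ^ 2 + D * (1 + t) ^ 3 * f t ^ 2 :=
          add_le_add (add_le_add i3 i5) i4
      _ = (4 * C ^ 2 + 12 * (X + 1) ^ 2 + 1) * D * ((1 + t) ^ 3 * f t ^ 2) := by ring
      _ ≤ (4 * C ^ 2 + 12 * (X + 1) ^ 2 + 1) * D * (18 * C ^ 2 * Real.exp (-t)) :=
          mul_le_mul_of_nonneg_left i7 (by positivity)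
      _ = _ := by unfold lipC; ring
  have hnorm := intervalIntegral.norm_integral_le_of_norm_le hT0.le (μ := volume)
    (f := fun t => wt σ t * (deriv f t ^ 2 + mom σ α t ^ 2 / wt σ t ^ 2 * f t ^ 2
      - 1 / (2 * b) * (2 * f t ^ 2 - f t ^ 4)) - wt σ' t * (deriv f t ^ 2 +
      mom σ' α t ^ 2 / wt σ' t ^ 2 * f t ^ 2 - 1 / (2 * b) * (2 * f t ^ 2 - f t ^ 4)))
    (g := fun t => lipC X C * |σ - σ'| * Real.exp (-t))
    (Filter.Eventually.of_forall fun t ht => hle t (Ioc_subset_Icc_self ht))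
    ((by fun_prop : Continuous fun t => lipC X C * |σ - σ'| * Real.exp (-t)).intervalIntegrable _ _)
  refine hnorm.trans ?_
  rw [intervalIntegral.integral_const_mul]
  exact mul_le_of_le_one_right (mul_nonneg (lipC_pos h.hX h.hC).le (abs_nonneg _))
    integral_exp_neg_le_one

end Ctrl

/-- The phase `α` is optimal for the curvature parameter `σ`. -/
def IsOpt (b T σ α : ℝ) : Prop := -T / 2 ≤ α ∧ Emin b T σ α = Est b T σ

/-- The constants and the length `T` are such that the optimal energy is at most `-c` and the
solutions at optimal phases are under control, whenever `σ` is small. -/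
structure Setting (b X τ C c m T : ℝ) : Prop where
  hb : 1 < b
  hX : 2 ≤ X
  hC : 1 ≤ C
  hc : 0 < c
  hm : m ≤ mX X
  hT : 1 ≤ T
  large : Large b C T
  Est_le : ∀ σ, Small m T σ → Est b T σ ≤ -c
  phase : ∀ σ α, Small m T σ → -T / 2 ≤ α → Emin b T σ α < 0 → -X < α ∧ α < 2
  phase_room : -T / 2 < -X
  ctrl : ∀ σ α f p, Small m T σ → -X < α → α < 2 → Sol b T σ α f p → J b T σ α f ≤ -c →
    Ctrl b X τ C T σ α f p

namespace Setting

variable {b X τ C c m T σ α : ℝ}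

theorem small' (S : Setting b X τ C c m T) (hs : Small m T σ) : Small (1 / 100) T σ :=
  hs.mono (S.hm.trans (mX_le S.hX))

/-- Negative energy puts the optimal phase in `(-X, 2)`, in the interior of the admissible
half-line; the phase can then be varied in both directions and the total current vanishes. -/
theorem exists_ctrl (S : Setting b X τ C c m T) (hs : Small m T σ) (hα : IsOpt b T σ α) :
    ∃ f p, Ctrl b X τ C T σ α f p ∧ J b T σ α f = Est b T σ ∧
      ∫ t in (0 : ℝ)..T, 2 * mom σ α t / wt σ t * f t ^ 2 = 0 := by
  have hs' := S.small' hs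
  have hE := S.Est_le σ hs
  have hneg : Emin b T σ α < 0 := by rw [hα.2]; linarith [S.hc]
  obtain ⟨h1, h2⟩ := S.phase σ α hs hα.1 hneg
  obtain ⟨f, p, hfp⟩ := exists_sol_of_Emin_neg S.hb hs' hneg
  have hJ : J b T σ α f = Est b T σ := by
    rw [← hα.2, hfp.Emin_eq S.hb hs'.pos hs'.wt_half]
  refine ⟨f, p, S.ctrl σ α f p hs h1 h2 hfp (by rw [hJ]; exact hE), hJ, ?_⟩
  refine hfp.current_eq_zero S.hb hs'.pos hs'.wt_half (r := α - -T / 2)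
    (by linarith [S.phase_room]) fun δ hδ => ?_
  rw [hα.2]
  exact SurfaceSC.Est_le S.hb hs' (by linarith [(abs_lt.1 hδ).1])

/-- The optimal phase and density for `σ'` serve as trial state for `σ`. -/
theorem Est_le_add (S : Setting b X τ C c m T) {σ' : ℝ} (hs : Small m T σ) (hs' : Small m T σ') :
    Est b T σ ≤ Est b T σ' + lipC X C * |σ - σ'| := by
  obtain ⟨α', hα', hE'⟩ := exists_optimal_phase S.hb (S.small' hs')
  obtain ⟨g, q, hg, hJ, -⟩ := S.exists_ctrl hs' ⟨hα', hE'⟩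
  have h1 := hg.abs_J_sub_le S.hb (S.small' hs)
  have h2 := (SurfaceSC.Est_le S.hb (S.small' hs) hα').trans (Emin_le S.hb (S.small' hs).pos
    (S.small' hs).wt_half (hg.sol.h1on hg.small.pos hg.small'.wt_pos))
  have h3 := (abs_le.1 h1).2
  linarith

/-- Lipschitz dependence of the optimal energy on the curvature. -/
theorem abs_Est_sub_le (S : Setting b X τ C c m T) {σ' : ℝ} (hs : Small m T σ)
    (hs' : Small m T σ') : |Est b T σ - Est b T σ'| ≤ lipC X C * |σ - σ'| := by
  have h1 := S.Est_le_add hs hs'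
  have h2 := S.Est_le_add hs' hs
  rw [abs_sub_comm σ' σ] at h2
  rw [abs_le]
  constructor <;> linarith

/-- Stability of optimal pairs. -/
theorem stability (S : Setting b X τ C c m T) {σ' α' : ℝ} {f p g q : ℝ → ℝ} (hs : Small m T σ)
    (hs' : Small m T σ')
    (hf : Ctrl b X τ C T σ α f p) (hfJ : J b T σ α f = Est b T σ)
    (hcur : ∫ t in (0 : ℝ)..T, 2 * mom σ α t / wt σ t * f t ^ 2 = 0)
    (hg : Ctrl b X τ C T σ' α' g q) (hgJ : J b T σ' α' g = Est b T σ') :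
    (α' - α) ^ 2 * ((1 - 1 / b) / (800 * T ^ 2 * C ^ 2)) +
      (∫ t in (0 : ℝ)..T, wt σ t / (2 * b) * (f t ^ 2 - g t ^ 2) ^ 2)
      ≤ 2 * lipC X C * |σ - σ'| := by
  -- Both energies are compared at the same `σ`: the excess of `(α', g)` over `(α, f)` is the change
  -- of `J` at `g` from `σ'` to `σ` plus the difference of the optimal energies, each at most `lipC
  -- |σ - σ'|`.
  have h1 := hf.coercive S.hb S.large hcur hg
  have h2 := (abs_le.1 (hg.abs_J_sub_le S.hb (S.small' hs))).2
  have h3 := S.Est_le_add hs' hs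
  rw [abs_sub_comm σ' σ] at h3
  linarith

end Setting

end

/-! ### Negativity of the optimal energy below the critical field -/

noncomputable section

theorem HalfLineDomain.h1on {α : ℝ} {u : ℝ → ℝ} (hu : HalfLineDomain α u) {T : ℝ} (hT : 0 < T) :
    H1on T u := by
  refine ⟨hu.1 T hT, ?_⟩
  have h := hu.2.2.1.mono_measure (Measure.restrict_mono (Ioc_subset_Ioi_self : Ioc 0 T ⊆ Ioi 0) le_rfl)
  rwa [restrict_Ioc_eq_restrict_Icc] at h

theorem H1on.const_mul {T : ℝ} {u : ℝ → ℝ} (hu : H1on T u) (s : ℝ) :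
    H1on T (fun t => s * u t) := by
  refine ⟨hu.1.const_mul s, ?_⟩
  have : deriv (fun t => s * u t) = fun t => s * deriv u t := by
    ext t
    exact deriv_const_mul_field s
  rw [this]
  exact hu.2.const_mul s

/-- Functions in the form domain on the half-line are bounded. -/
theorem HalfLineDomain.exists_sq_le {α : ℝ} {u : ℝ → ℝ} (hu : HalfLineDomain α u) :
    ∃ B, 0 ≤ B ∧ ∀ t, 0 < t → u t ^ 2 ≤ B := by
  have i1 := hu.2.1.integrable_sq
  have i2 := hu.2.2.1.integrable_sq
  have hnn : 0 ≤ ∫ t in Ioi (0 : ℝ), (u t ^ 2 + deriv u t ^ 2) :=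
    integral_nonneg fun t => by positivity
  refine ⟨u 0 ^ 2 + ∫ t in Ioi (0 : ℝ), (u t ^ 2 + deriv u t ^ 2), by positivity, fun t ht => ?_⟩
  have hH := hu.h1on ht
  have key := integral_deriv_mul_sq ht hH (φ := fun _ => 1) (φ' := fun _ => 0)
    (fun t _ => hasDerivAt_const t 1) continuousOn_const
  have ii : IntervalIntegrable (fun t => u t ^ 2 + deriv u t ^ 2) volume 0 t := by
    rw [intervalIntegrable_iff_integrableOn_Ioc_of_le ht.le]
    exact IntegrableOn.mono_set (t := Ioi 0) (i1.add i2) Ioc_subset_Ioi_self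
  have i3 : IntervalIntegrable (fun t => 0 * u t ^ 2 + 2 * 1 * u t * deriv u t) volume 0 t := by
    have := IntervalIntegrable.mul_continuousOn_Icc ht.le hH.intervalIntegrable_deriv
      ((hH.continuousOn ht.le).const_smul (2 : ℝ))
    refine this.congr fun s _ => ?_
    simp
    ring
  have h1 : ∫ s in (0 : ℝ)..t, (0 * u s ^ 2 + 2 * 1 * u s * deriv u s) ≤
      ∫ s in (0 : ℝ)..t, (u s ^ 2 + deriv u s ^ 2) := by
    apply intervalIntegral.integral_mono_on ht.le i3 ii
    intro s _
    nlinarith [sq_nonneg (u s - deriv u s)]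
  have h2 : ∫ s in (0 : ℝ)..t, (u s ^ 2 + deriv u s ^ 2) ≤
      ∫ s in Ioi (0 : ℝ), (u s ^ 2 + deriv u s ^ 2) := by
    rw [intervalIntegral.integral_of_le ht.le]
    exact setIntegral_mono_set (i1.add i2) (Filter.Eventually.of_forall fun s => by positivity)
      Ioc_subset_Ioi_self.eventuallyLE
  linarith

/-- Below the critical temperature of surface superconductivity there is a normalized function
of energy less than `1 / b` in the form domain of the half-line operator. -/
theorem exists_halfLine_energy_lt {b : ℝ} (hb : 1 < b) (hb' : b < Theta0⁻¹) :
    ∃ α u, HalfLineDomain α u ∧ (∫ t in Ioi (0 : ℝ), u t ^ 2) = 1 ∧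
      ∫ t in Ioi (0 : ℝ), (deriv u t ^ 2 + (t + α) ^ 2 * u t ^ 2) < 1 / b := by
  have hpos : 0 < Theta0⁻¹ := by linarith
  have hT0 : 0 < Theta0 := inv_pos.1 hpos
  have hlt : Theta0 < 1 / b := by
    rw [lt_div_iff₀ (by linarith)]
    have := mul_lt_mul_of_pos_left hb' hT0
    rwa [mul_inv_cancel₀ hT0.ne'] at this
  -- For an empty set `sInf` would take the value `0`, contrary to `Theta0 > 0`, which follows from
  -- `b < Theta0⁻¹`.
  have hne : {E : ℝ | ∃ (α : ℝ) (u : ℝ → ℝ), HalfLineDomain α u ∧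
      (∫ t in Ioi (0 : ℝ), u t ^ 2) = 1 ∧
      E = ∫ t in Ioi (0 : ℝ), (deriv u t ^ 2 + (t + α) ^ 2 * u t ^ 2)}.Nonempty := by
    by_contra h
    rw [not_nonempty_iff_eq_empty] at h
    rw [Theta0, h, Real.sInf_empty] at hT0
    exact lt_irrefl _ hT0
  obtain ⟨E, ⟨α, u, hu, hu1, rfl⟩, hE⟩ := exists_lt_of_csInf_lt hne hlt
  exact ⟨α, u, hu, hu1, hE⟩

theorem mom_sq_div_wt_le {m T σ α : ℝ} (hm0 : 0 ≤ m) (hm : m ≤ 1 / 100) (hs : Small m T σ) {t : ℝ}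
    (ht : t ∈ Icc 0 T) : mom σ α t ^ 2 / wt σ t ≤ (1 + 4 * m) * (t + α) ^ 2 + 2 * m := by
  have hw := (hs.wt_bounds ht).1
  have hA := hs.mom_bounds α ht
  rw [div_le_iff₀ (by linarith)]
  set y := t + α with hy
  have h1 : mom σ α t ^ 2 ≤ (1 + m) * y ^ 2 + m := by
    set e := mom σ α t - y with he
    have e1 : -(m / 2) ≤ e := by linarith [hA.1]
    have e2 : e ≤ m / 2 := by linarith [hA.2]
    have e3 : mom σ α t = y + e := by rw [he]; ring
    have e4 : 2 * e * y ≤ m * (y ^ 2 + 1) / 2 := by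
      have := abs_le.2 ⟨e1, e2⟩
      calc 2 * e * y ≤ |2 * e * y| := le_abs_self _
        _ = 2 * (|e| * |y|) := by rw [abs_mul, abs_mul, abs_two]; ring
        _ ≤ 2 * (m / 2 * |y|) := by gcongr
        _ ≤ m * (y ^ 2 + 1) / 2 := by
            nlinarith [mul_nonneg hm0 (sq_nonneg (|y| - 1)), sq_abs y]
    have e5 : e ^ 2 ≤ m / 2 := by nlinarith
    rw [e3]
    nlinarith [mul_nonneg hm0 (sq_nonneg y)]
  refine h1.trans ?_
  have h2 : ((1 + 4 * m) * y ^ 2 + 2 * m) * (1 - m) ≤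
      ((1 + 4 * m) * y ^ 2 + 2 * m) * wt σ t :=
    mul_le_mul_of_nonneg_left hw (by positivity)
  refine le_trans ?_ h2
  have h3 : 0 ≤ m * y ^ 2 := by positivity
  nlinarith

/-- Pointwise energy density of the trial function `√q u`, with `w = wt`, `β = 1 / b`, `v = u'²`, `x
= u²`, `P = mom² / wt` and `Y = (t + α)²`. -/
theorem trial_density_le {m w β v x P Y B q : ℝ} (hm : m ≤ 1 / 100) (hβ0 : 0 ≤ β)
    (hβ1 : β ≤ 1) (hq : 0 ≤ q) (hw1 : 1 - m ≤ w) (hw2 : w ≤ 1 + m) (hv : 0 ≤ v) (hx : 0 ≤ x)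
    (hxB : x ≤ B) (hP : P ≤ (1 + 4 * m) * Y + 2 * m) :
    q * (w * v + P * x - w * β * x) + q * q * (w * β / 2 * (x * x)) ≤
      q * (1 + 4 * m) * (v + Y * x) + (q * (3 * m - β) + q * (q * B)) * x := by
  have hm0 : 0 ≤ m := by linarith
  have f1 : w * v ≤ (1 + 4 * m) * v := mul_le_mul_of_nonneg_right (by linarith) hv
  have f2 := mul_le_mul_of_nonneg_right hP hx
  have f3 : -(w * β * x) ≤ (m - β) * x := by
    have h : -(w * β) ≤ m - β := by nlinarith
    linarith [mul_le_mul_of_nonneg_right h hx]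
  have f4 : w * β / 2 * (x * x) ≤ B * x := by
    have g1 : w * β / 2 ≤ 1 := by nlinarith
    have g2 : x * x ≤ B * x := mul_le_mul_of_nonneg_right hxB hx
    exact (mul_le_of_le_one_left (mul_nonneg hx hx) g1).trans g2
  have f5 := mul_le_mul_of_nonneg_left (add_le_add (add_le_add f1 f2) f3) hq
  have f6 := mul_le_mul_of_nonneg_left f4 (mul_nonneg hq hq)
  linarith

/-- Superconductivity persists for small curvature. -/
theorem exists_Est_le {b : ℝ} (hb : 1 < b) (hb' : b < Theta0⁻¹) :
    ∃ c m T₀, 0 < c ∧ 0 < m ∧ ∀ T σ, T₀ ≤ T → Small m T σ → Est b T σ ≤ -c := by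
  obtain ⟨α, u, hu, hu1, hE⟩ := exists_halfLine_energy_lt hb hb'
  obtain ⟨B, hB0, hB⟩ := hu.exists_sq_le
  have i1 := hu.2.1.integrable_sq
  have i2 : Integrable (fun t => deriv u t ^ 2 + (t + α) ^ 2 * u t ^ 2)
      (volume.restrict (Ioi 0)) := by
    refine hu.2.2.1.integrable_sq.add ?_
    simpa only [mul_pow] using hu.2.2.2.integrable_sq
  set K := ∫ t in Ioi (0 : ℝ), (deriv u t ^ 2 + (t + α) ^ 2 * u t ^ 2) with hK
  have hK0 : 0 ≤ K := integral_nonneg fun t => by positivity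
  set d := 1 / b - K with hd
  have hd0 : 0 < d := by linarith
  have hb1 : 1 / b ≤ 1 := by rw [div_le_one (by linarith)]; exact hb.le
  have hb0 : 0 < 1 / b := by positivity
  -- The spectral gain `d = 1 / b - K` is spent in four equal parts: curvature (`7 m ≤ d / 4`), the
  -- quartic term (`q B ≤ d / 4`), truncation of the half-line (mass lost at most `d / 4`), and what
  -- remains, giving energy at most `-q d / 4`.
  set m := min (1 / 100) (d / 28) with hm
  have hm0 : 0 < m := by positivity
  have hm1 : m ≤ 1 / 100 := min_le_left _ _
  have hm2 : m ≤ d / 28 := min_le_right _ _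
  set q := d / (4 * (B + 1)) with hq
  have hq0 : 0 < q := by positivity
  have hqB : q * B ≤ d / 4 := by
    rw [hq, div_mul_eq_mul_div, div_le_div_iff₀ (by positivity) (by norm_num)]
    nlinarith
  have htend := intervalIntegral_tendsto_integral_Ioi 0 i1 Filter.tendsto_id
  rw [hu1] at htend
  obtain ⟨T₁, hT₁⟩ := Filter.eventually_atTop.1
    (htend.eventually_const_le (by linarith : 1 - d / 4 < 1))
  refine ⟨q * (d / 4), m, max T₁ (-2 * α), by positivity, hm0, fun T σ hT hs => ?_⟩
  have hs' := hs.mono hm1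
  have hT0 := hs.pos
  have hy1 := hT₁ T ((le_max_left _ _).trans hT)
  change 1 - d / 4 ≤ ∫ t in (0 : ℝ)..T, u t ^ 2 at hy1
  set y := ∫ t in (0 : ℝ)..T, u t ^ 2 with hy
  have hα : -T / 2 ≤ α := by linarith [(le_max_right _ _).trans hT]
  have hH := hu.h1on hT0
  set s := Real.sqrt q with hs_def
  have hsq : s ^ 2 = q := Real.sq_sqrt hq0.le
  have hH' := hH.const_mul s
  refine (Est_le hb hs' hα).trans ((Emin_le hb hT0 hs'.wt_half hH').trans ?_)
  have ii1 : IntervalIntegrable (fun t => u t ^ 2) volume 0 T := by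
    rw [intervalIntegrable_iff_integrableOn_Ioc_of_le hT0.le]
    exact IntegrableOn.mono_set i1 Ioc_subset_Ioi_self
  have ii2 : IntervalIntegrable (fun t => deriv u t ^ 2 + (t + α) ^ 2 * u t ^ 2) volume 0 T := by
    rw [intervalIntegrable_iff_integrableOn_Ioc_of_le hT0.le]
    exact IntegrableOn.mono_set i2 Ioc_subset_Ioi_self
  have hy2 : y ≤ 1 := by
    rw [← hu1, hy, intervalIntegral.integral_of_le hT0.le]
    exact setIntegral_mono_set i1 (Filter.Eventually.of_forall fun s => by positivity)
      Ioc_subset_Ioi_self.eventuallyLE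
  have hKT : ∫ t in (0 : ℝ)..T, (deriv u t ^ 2 + (t + α) ^ 2 * u t ^ 2) ≤ K := by
    rw [hK, intervalIntegral.integral_of_le hT0.le]
    exact setIntegral_mono_set i2 (Filter.Eventually.of_forall fun s => by positivity)
      Ioc_subset_Ioi_self.eventuallyLE
  have hJ : J b T σ α (fun t => s * u t) ≤ ∫ t in (0 : ℝ)..T,
      (q * (1 + 4 * m) * (deriv u t ^ 2 + (t + α) ^ 2 * u t ^ 2)
        + (q * (3 * m - 1 / b) + q * (q * B)) * u t ^ 2) := by
    -- Open interval, because the bound `u² ≤ B` was obtained for `t > 0` only.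
    apply intervalIntegral.integral_mono_on_of_le_Ioo hT0.le
      (J_integrable b σ α hT0.le hs'.wt_pos hH') ((ii2.const_mul _).add (ii1.const_mul _))
    intro t ht
    have ht' := Ioo_subset_Icc_self ht
    have hw := hs.wt_bounds ht'
    have hw0 := hs'.wt_pos t ht'
    have hder : deriv (fun t => s * u t) t = s * deriv u t := deriv_const_mul_field s
    have hmw := mom_sq_div_wt_le (α := α) hm0.le hm1 hs ht'
    have hBt := hB t ht.1
    have e : wt σ t * (deriv (fun t => s * u t) t ^ 2 + mom σ α t ^ 2 / wt σ t ^ 2 *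
          (s * u t) ^ 2 - 1 / (2 * b) * (2 * (s * u t) ^ 2 - (s * u t) ^ 4))
        = q * (wt σ t * deriv u t ^ 2 + mom σ α t ^ 2 / wt σ t * u t ^ 2
          - wt σ t * (1 / b) * u t ^ 2) + q * q * (wt σ t * (1 / b) / 2 * (u t ^ 2 * u t ^ 2)) := by
      rw [hder, ← hsq]
      field_simp
      ring
    rw [e]
    exact trial_density_le hm1 hb0.le hb1 hq0.le hw.1 hw.2 (sq_nonneg _) (sq_nonneg _) hBt hmw
  refine hJ.trans ?_
  rw [intervalIntegral.integral_add (ii2.const_mul _) (ii1.const_mul _),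
    intervalIntegral.integral_const_mul, intervalIntegral.integral_const_mul, ← hy]
  have k1 : q * (1 + 4 * m) * (∫ t in (0 : ℝ)..T, (deriv u t ^ 2 + (t + α) ^ 2 * u t ^ 2)) ≤
      q * (1 + 4 * m) * K := mul_le_mul_of_nonneg_left hKT (by positivity)
  have k2 : (1 + 4 * m) * K + (3 * m - 1 / b + q * B) * y ≤ -(d / 4) := by
    have hy0 : 0 ≤ y := intervalIntegral.integral_nonneg hT0.le fun t _ => sq_nonneg _
    have l1 : K ≤ 1 := by linarith
    have l2 : m * K ≤ m := mul_le_of_le_one_right hm0.le l1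
    have l3 : (3 * m + q * B) * y ≤ 3 * m + q * B :=
      mul_le_of_le_one_right (by positivity) hy2
    have l4 : 1 / b * (1 - y) ≤ 1 - y := mul_le_of_le_one_left (by linarith) hb1
    have l5 : (3 * m - 1 / b + q * B) * y = (3 * m + q * B) * y + 1 / b * (1 - y) - 1 / b := by ring
    rw [l5]
    linarith
  have k3 := mul_le_mul_of_nonneg_left k2 hq0.le
  linarith

end

/-! ### Reflection of the interval and mirror states -/

noncomputable section

theorem wt_reflect {T σ : ℝ} (hl : 1 - σ * T ≠ 0) (s : ℝ) :
    wt σ (T - s) = (1 - σ * T) * wt (-σ / (1 - σ * T)) s := by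
  unfold wt
  field_simp
  ring

theorem mom_reflect {T σ : ℝ} (hl : 1 - σ * T ≠ 0) (β s : ℝ) :
    mom σ β (T - s) =
      -((1 - σ * T) * mom (-σ / (1 - σ * T)) (-mom σ β T / (1 - σ * T)) s) := by
  have h1 : (1 - σ * T) * (-σ / (1 - σ * T)) = -σ := mul_div_cancel₀ _ hl
  have h2 : (1 - σ * T) * (-mom σ β T / (1 - σ * T)) = -mom σ β T := mul_div_cancel₀ _ hl
  generalize -σ / (1 - σ * T) = σ' at *
  generalize -mom σ β T / (1 - σ * T) = α' at *
  unfold mom at *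
  linear_combination h2 - s ^ 2 / 2 * h1

/-- The reflection `t ↦ T - t`. -/
theorem J_reflect {b T σ : ℝ} (hl : 1 - σ * T ≠ 0) (β : ℝ) (f : ℝ → ℝ) :
    J b T σ β f = (1 - σ * T) *
      J b T (-σ / (1 - σ * T)) (-mom σ β T / (1 - σ * T)) (fun s => f (T - s)) := by
  unfold J
  rw [← intervalIntegral.integral_const_mul]
  have h := intervalIntegral.integral_comp_sub_left (a := 0) (b := T)
    (fun t => wt σ t * (deriv f t ^ 2 + mom σ β t ^ 2 / wt σ t ^ 2 * f t ^ 2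
      - 1 / (2 * b) * (2 * f t ^ 2 - f t ^ 4))) T
  rw [sub_self, sub_zero] at h
  rw [← h]
  congr 1
  ext s
  rw [wt_reflect hl, mom_reflect hl, deriv_comp_const_sub, neg_sq, neg_sq, mul_pow, mul_pow,
    mul_div_mul_left _ _ (pow_ne_zero 2 hl), mul_assoc]

/-- The curvature terms on the two sides cancel, so the threshold `-T / 2` is exactly exchanged with
itself. -/
theorem reflect_phase_ge {T σ β : ℝ} (hl : 0 < 1 - σ * T) (hβ : β < -T / 2) :
    -T / 2 ≤ -mom σ β T / (1 - σ * T) := by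
  rw [le_div_iff₀ hl]
  unfold mom
  nlinarith

theorem Small.reflect {m T σ : ℝ} (hm : m ≤ 1 / 100) (hs : Small (m / 2) T σ) :
    Small m T (-σ / (1 - σ * T)) ∧ 1 / 2 ≤ 1 - σ * T := by
  have h := abs_le.1 (hs.abs_mul_le (right_mem_Icc.2 hs.pos.le))
  have hl : 1 / 2 ≤ 1 - σ * T := by linarith [h.2]
  refine ⟨⟨hs.1, ?_⟩, hl⟩
  rw [abs_div, abs_neg, abs_of_pos (by linarith : 0 < 1 - σ * T), div_mul_eq_mul_div,
    div_le_iff₀ (by linarith)]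
  have := hs.2
  have h0 : 0 ≤ |σ| * (1 + T) ^ 6 := mul_nonneg (abs_nonneg _) (pow_nonneg (by linarith [hs.1]) _)
  nlinarith

/-- The reflected minimizer is an admissible trial state for the curvature `-σ / (1 - σ T)`, at a
phase above `-T / 2`. -/
theorem Emin_ge_reflect {b T σ β m : ℝ} (hb : 1 < b) (hm : m ≤ 1 / 100) (hs : Small (m / 2) T σ)
    (hβ : β < -T / 2) (hE : Emin b T σ β < 0) :
    (1 - σ * T) * Est b T (-σ / (1 - σ * T)) ≤ Emin b T σ β := by
  obtain ⟨hs', hl⟩ := hs.reflect hm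
  have hl0 : 0 < 1 - σ * T := by linarith
  have hm0 : 0 ≤ m := by
    have := hs.2
    have h0 : 0 ≤ |σ| * (1 + T) ^ 6 := mul_nonneg (abs_nonneg _) (pow_nonneg (by linarith [hs.1]) _)
    linarith
  have hs1 : Small (1 / 100) T σ := hs.mono (by linarith)
  have hs2 := hs'.mono hm
  obtain ⟨f, p, hf⟩ := exists_sol_of_Emin_neg hb hs1 hE
  rw [hf.Emin_eq hb hs1.pos hs1.wt_half, J_reflect hl0.ne' β f]
  refine mul_le_mul_of_nonneg_left ?_ hl0.le
  refine (Est_le hb hs2 (reflect_phase_ge hl0 hβ)).trans (Emin_le hb hs.pos hs2.wt_half ?_)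
  have hmem : ∀ t ∈ Icc 0 T, T - t ∈ Icc 0 T := fun t ht =>
    ⟨by linarith [ht.2], by linarith [ht.1]⟩
  refine H1on_of_hasDerivAt hs.pos (φ' := fun t => -(p (T - t) / wt σ (T - t))) ?_ ?_
  · intro t ht
    simpa using (hf.hf _ (hmem t ht)).comp_const_sub T t
  · have hc : ContinuousOn (fun t => T - t) (Icc 0 T) := by fun_prop
    exact ((hf.continuousOn_p.comp hc hmem).div
      ((continuous_wt σ).continuousOn.comp hc fun _ _ => mem_univ _)
      fun t ht => (hs1.wt_pos _ (hmem t ht)).ne').neg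

/-- For positive curvature, the mirror states have strictly higher energy. -/
theorem Setting.Est_lt_Emin {b X τ C c m T σ β : ℝ} (S : Setting b X τ C c m T) (hσ : 0 < σ)
    (hs : Small (m / 2) T σ) (hT : 3 * lipC X C < c * T) (hβ : β < -T / 2) :
    Est b T σ < Emin b T σ β := by
  have hm : m ≤ 1 / 100 := S.hm.trans (mX_le S.hX)
  obtain ⟨hs', hl⟩ := hs.reflect hm
  have h0 : 0 ≤ |σ| * (1 + T) ^ 6 := mul_nonneg (abs_nonneg _) (pow_nonneg (by linarith [hs.1]) _)
  have hs1 : Small m T σ := hs.mono (by linarith [hs.2])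
  have hE := S.Est_le σ hs1
  rcases le_or_gt 0 (Emin b T σ β) with h | h
  · linarith [S.hc]
  -- With `σ'` the reflected curvature, `(1 - σ T) Est σ' ≥ Est σ' + c σ T`, because `Est σ' ≤ -c`,
  -- whereas `Est σ ≤ Est σ' + 3 lipC σ`. Strictness is the assumption `3 lipC < c T`.
  refine lt_of_lt_of_le ?_ (Emin_ge_reflect S.hb hm hs hβ h)
  have hl0 : 0 < 1 - σ * T := by linarith
  have h1 := S.Est_le_add hs1 hs'
  have hE' := S.Est_le _ hs'
  have h2 : |σ - -σ / (1 - σ * T)| ≤ 3 * σ := by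
    have e : σ / (1 - σ * T) ≤ 2 * σ := by rw [div_le_iff₀ hl0]; nlinarith
    have e0 : 0 ≤ σ / (1 - σ * T) := by positivity
    rw [neg_div, sub_neg_eq_add, abs_of_nonneg (by linarith)]
    linarith
  have hL := lipC_pos S.hX S.hC
  have h3 : lipC X C * |σ - -σ / (1 - σ * T)| ≤ lipC X C * (3 * σ) :=
    mul_le_mul_of_nonneg_left h2 (by linarith)
  have h4 : σ * T * c ≤ σ * T * (-Est b T (-σ / (1 - σ * T))) :=
    mul_le_mul_of_nonneg_left (by linarith) (mul_nonneg hσ.le hs.pos.le)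
  have h5 := mul_lt_mul_of_pos_left hT hσ
  linarith

end

/-! ### The linear system for the difference of two solutions -/

noncomputable section

/-- A one-dimensional Sobolev inequality. At a minimum point `u²` is at most its integral, since `T
≥ 1`, and from there `|(u²)'| ≤ u² + u'²` bounds the variation. -/
theorem sq_le_integral_of_hasDerivAt {T : ℝ} (hT : 1 ≤ T) {u u' : ℝ → ℝ}
    (hu : ∀ t ∈ Icc 0 T, HasDerivAt u (u' t) t) (hu' : ContinuousOn u' (Icc 0 T)) {t : ℝ}
    (ht : t ∈ Icc 0 T) : u t ^ 2 ≤ ∫ s in (0 : ℝ)..T, (2 * u s ^ 2 + u' s ^ 2) := by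
  have hT0 : 0 < T := by linarith
  have huc : ContinuousOn u (Icc 0 T) := fun s hs => (hu s hs).continuousAt.continuousWithinAt
  have c1 : ContinuousOn (fun x => u x ^ 2) (Icc 0 T) := huc.pow 2
  have c2 : ContinuousOn (fun x => u' x ^ 2) (Icc 0 T) := hu'.pow 2
  have c3 : ContinuousOn (fun x => u x ^ 2 + u' x ^ 2) (Icc 0 T) := c1.add c2
  obtain ⟨F, hF0, hF, hFT⟩ := exists_primitive hT0 c3
  obtain ⟨s, hs, hmin⟩ := isCompact_Icc.exists_isMinOn (nonempty_Icc.2 hT0.le) c1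
  have hder : ∀ x ∈ Icc 0 T, HasDerivAt (fun x => u x ^ 2) (2 * u x * u' x) x := fun x hx => by
    exact ((hu x hx).fun_pow 2).congr_deriv (by simp)
  have hFm : MonotoneOn F (Icc 0 T) := monotoneOn_of_hasDerivAt_nonneg hF fun x _ => by
    positivity
  have h1 : AntitoneOn (fun x => u x ^ 2 - F x) (Icc 0 T) :=
    antitoneOn_of_hasDerivAt_nonpos (fun x hx => (hder x hx).sub (hF x hx)) fun x _ => by
      nlinarith [sq_nonneg (u x - u' x)]
  have h2 : MonotoneOn (fun x => u x ^ 2 + F x) (Icc 0 T) :=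
    monotoneOn_of_hasDerivAt_nonneg (fun x hx => (hder x hx).add (hF x hx)) fun x _ => by
      nlinarith [sq_nonneg (u x + u' x)]
  have h0m := left_mem_Icc.2 hT0.le
  have hTm := right_mem_Icc.2 hT0.le
  have hb : ∀ x ∈ Icc 0 T, 0 ≤ F x ∧ F x ≤ F T := fun x hx =>
    ⟨hF0 ▸ hFm h0m hx hx.1, hFm hx hTm hx.2⟩
  have h3 : u t ^ 2 ≤ u s ^ 2 + F T := by
    rcases le_total s t with hst | hst
    · have := h1 hs ht hst
      simp only at this
      linarith [(hb t ht).2, (hb s hs).1]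
    · have := h2 ht hs hst
      simp only at this
      linarith [(hb s hs).2, (hb t ht).1]
  have i1 := intervalIntegrable_of_continuousOn_Icc hT0.le c1
  have i2 := intervalIntegrable_of_continuousOn_Icc hT0.le c2
  have h4 : u s ^ 2 ≤ ∫ x in (0 : ℝ)..T, u x ^ 2 := by
    have : ∫ x in (0 : ℝ)..T, u s ^ 2 ≤ ∫ x in (0 : ℝ)..T, u x ^ 2 :=
      intervalIntegral.integral_mono_on hT0.le (by simp) i1 fun x hx => hmin hx
    rw [intervalIntegral.integral_const, smul_eq_mul, sub_zero] at this
    nlinarith [sq_nonneg (u s)]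
  have h5 : ∫ x in (0 : ℝ)..T, (2 * u x ^ 2 + u' x ^ 2) =
      (∫ x in (0 : ℝ)..T, u x ^ 2) + F T := by
    rw [hFT, ← intervalIntegral.integral_add i1 (i1.add i2)]
    congr 1
    ext x
    ring
  rw [h5]
  linarith

theorem abs_le_mul_of_hasDerivAt {T M : ℝ} {z z' : ℝ → ℝ} (h0 : z 0 = 0)
    (hz : ∀ t ∈ Icc 0 T, HasDerivAt z (z' t) t) (hM : ∀ t ∈ Icc 0 T, |z' t| ≤ M) {t : ℝ}
    (ht : t ∈ Icc 0 T) : |z t| ≤ M * t := by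
  have h := norm_image_sub_le_of_norm_deriv_le_segment' (f := z) (f' := z') (a := 0) (b := T)
    (C := M) (fun x hx => (hz x hx).hasDerivWithinAt) (fun x hx => hM x (Ico_subset_Icc_self hx))
    t ht
  simpa [h0] using h

/-- The coefficient of the linearized equation of the difference of two solutions. -/
def diffPot (b σ α x y t : ℝ) : ℝ :=
  mom σ α t ^ 2 / wt σ t - wt σ t / b * (1 - x ^ 2 - x * y - y ^ 2)

/-- The momentum source in the equation of the difference of two solutions. -/
def diffFlux (σ σ' y t : ℝ) : ℝ := y * (1 / wt σ t - 1 / wt σ' t)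

/-- The source in the equation of the difference of two solutions. -/
def diffSource (b σ α σ' α' y t : ℝ) : ℝ := (pot b σ α y t - pot b σ' α' y t) * y

theorem abs_one_div_wt_sub_le {T σ σ' : ℝ} (hs : Small (1 / 100) T σ)
    (hs' : Small (1 / 100) T σ') {t : ℝ} (ht : t ∈ Icc 0 T) :
    |1 / wt σ t - 1 / wt σ' t| ≤ 4 * |σ - σ'| * (1 + T) := by
  have hw := hs.wt_half t ht
  have hw' := hs'.wt_half t ht
  have hw0 := hs.wt_pos t ht
  have hw0' := hs'.wt_pos t ht
  have e : 1 / wt σ t - 1 / wt σ' t = -((wt σ t - wt σ' t) * (1 / (wt σ t * wt σ' t))) := by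
    field_simp
    ring
  have i : 1 / (wt σ t * wt σ' t) ≤ 4 := by
    rw [div_le_iff₀ (by positivity)]; nlinarith [hw.1, hw'.1]
  rw [e, abs_neg, abs_mul, abs_wt_sub σ σ' ht.1,
    abs_of_pos (by positivity : 0 < 1 / (wt σ t * wt σ' t))]
  have ht0 := ht.1
  have hT := hs.pos
  calc |σ - σ'| * t * (1 / (wt σ t * wt σ' t)) ≤ |σ - σ'| * (1 + T) * 4 := by
        gcongr
        linarith [ht.2]
    _ = _ := by ring

/-- Young's inequality for the energy estimate, with `z = p - q`, `u = f - g`, `R` the flux error,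
`S` the source, `P` the linearized potential and `d2 = (f² - g²)²`. -/
theorem diff_density_le {C b w u z R S P d2 : ℝ} (hw : 1 / 2 ≤ w) (hw2 : w ≤ 2) (hb : 0 < b)
    (hP : u ^ 2 ≤ P * u ^ 2 + 3 * C ^ 2 * d2) (hd : 0 ≤ d2) :
    z ^ 2 / 4 + u ^ 2 / 2 ≤ (z / w * z + R * z + (P * u + S) * u) +
      12 * b * C ^ 2 * (w / (2 * b) * d2) + R ^ 2 + S ^ 2 := by
  have h1 : z ^ 2 / 2 ≤ z / w * z := by
    rw [div_mul_eq_mul_div, div_le_div_iff₀ (by norm_num) (by linarith)]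
    nlinarith [sq_nonneg z]
  have h2 : 12 * b * C ^ 2 * (w / (2 * b) * d2) = 6 * C ^ 2 * w * d2 := by
    field_simp
    ring
  have h3 : 3 * C ^ 2 * d2 ≤ 6 * C ^ 2 * w * d2 := by
    nlinarith [mul_nonneg (sq_nonneg C) hd]
  have h4 : -(z ^ 2 / 4 + R ^ 2) ≤ R * z := by nlinarith [sq_nonneg (z / 2 + R)]
  have h5 : -(u ^ 2 / 2 + S ^ 2) ≤ S * u := by nlinarith [sq_nonneg (u / 2 + S), sq_nonneg u]
  rw [h2]
  nlinarith

namespace Ctrl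

variable {b X τ C T σ α σ' α' : ℝ} {f p g q : ℝ → ℝ}

theorem hasDerivAt_sub_f (hf : Ctrl b X τ C T σ α f p) (hg : Ctrl b X τ C T σ' α' g q) {t : ℝ}
    (ht : t ∈ Icc 0 T) : HasDerivAt (fun t => f t - g t)
      ((p t - q t) / wt σ t + diffFlux σ σ' (q t) t) t := by
  refine ((hf.sol.hf t ht).sub (hg.sol.hf t ht)).congr_deriv ?_
  unfold diffFlux
  ring

theorem hasDerivAt_sub_p (hf : Ctrl b X τ C T σ α f p) (hg : Ctrl b X τ C T σ' α' g q) {t : ℝ}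
    (ht : t ∈ Icc 0 T) : HasDerivAt (fun t => p t - q t)
      (diffPot b σ α (f t) (g t) t * (f t - g t) + diffSource b σ α σ' α' (g t) t) t := by
  refine ((hf.sol.hp t ht).sub (hg.sol.hp t ht)).congr_deriv ?_
  unfold diffPot diffSource pot
  ring

/-- The linearized potential is at least `1` past the layer. Inside it may be as low as `-2`, but
there `f ≥ 1 / C` turns the defect into control of `f - g`, and three copies of it restore
positivity. -/
theorem le_diffPot (hb : 1 < b) (hf : Ctrl b X τ C T σ α f p) (hg : Ctrl b X τ C T σ' α' g q)
    {t : ℝ} (ht : t ∈ Icc 0 T) : (f t - g t) ^ 2 ≤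
      diffPot b σ α (f t) (g t) t * (f t - g t) ^ 2 + 3 * C ^ 2 * (f t ^ 2 - g t ^ 2) ^ 2 := by
  have hw := hf.small'.wt_half t ht
  have hw0 := hf.small'.wt_pos t ht
  have hf0 := hf.sol.pos t ht
  have hg0 := hg.sol.pos t ht
  have hwb : 0 ≤ wt σ t / b := by positivity
  rcases le_total t τ with h | h
  · have h1 : -2 ≤ diffPot b σ α (f t) (g t) t := by
      have e1 : wt σ t / b ≤ 2 := by rw [div_le_iff₀ (by linarith)]; nlinarith [hw.2]
      have e2 : wt σ t / b * (1 - f t ^ 2 - f t * g t - g t ^ 2) ≤ wt σ t / b * 1 := by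
        refine mul_le_mul_of_nonneg_left ?_ hwb
        nlinarith [mul_pos hf0 hg0]
      have e3 : 0 ≤ mom σ α t ^ 2 / wt σ t := by positivity
      unfold diffPot
      linarith
    have h2 : (f t - g t) ^ 2 ≤ C ^ 2 * (f t ^ 2 - g t ^ 2) ^ 2 := by
      have e1 := hf.one_le t ⟨ht.1, h⟩
      have e2 : 1 ≤ C * (f t + g t) := by nlinarith [hf.hC]
      have e3 : 1 ≤ (C * (f t + g t)) ^ 2 := one_le_pow₀ e2
      calc (f t - g t) ^ 2 ≤ (C * (f t + g t)) ^ 2 * (f t - g t) ^ 2 :=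
            le_mul_of_one_le_left (sq_nonneg _) e3
        _ = _ := by ring
    nlinarith [sq_nonneg (f t - g t)]
  · have h1 : 1 ≤ diffPot b σ α (f t) (g t) t := by
      have e1 := pot_ge_two hb hf.small' hf.lower_phase.le ht (by linarith [hf.hτ]) (f t)
      have e2 : 0 ≤ wt σ t / b * (f t * g t + g t ^ 2) := by positivity
      have e3 : diffPot b σ α (f t) (g t) t = pot b σ α (f t) t +
          wt σ t / b * (f t * g t + g t ^ 2) := by unfold diffPot pot; ring
      rw [e3]
      linarith
    have h2 : 0 ≤ 3 * C ^ 2 * (f t ^ 2 - g t ^ 2) ^ 2 := by positivity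
    nlinarith [sq_nonneg (f t - g t)]

theorem abs_diffPot_le (hb : 1 < b) (hf : Ctrl b X τ C T σ α f p)
    (hg : Ctrl b X τ C T σ' α' g q) {t : ℝ} (ht : t ∈ Icc 0 T) :
    |diffPot b σ α (f t) (g t) t| ≤ (2 * (X + 1) ^ 2 + 4) * (1 + T) ^ 2 := by
  have hw := hf.small'.wt_half t ht
  have hw0 := hf.small'.wt_pos t ht
  have hf0 := hf.sol.pos t ht
  have hg0 := hg.sol.pos t ht
  have hf1 := hf.sol.le_one t ht
  have hg1 := hg.sol.le_one t ht
  have hT := hf.small.1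
  have hA := abs_mom_le_of_small hf.hX hf.small' hf.lower_phase.le hf.phase_lt.le ht
  have hA2 : mom σ α t ^ 2 ≤ (X + 1) ^ 2 * (1 + T) ^ 2 := by
    rw [← sq_abs, ← mul_pow]
    refine pow_le_pow_left₀ (abs_nonneg _) (hA.trans ?_) 2
    have := hf.hX
    gcongr
    exact ht.2
  have e1 : mom σ α t ^ 2 / wt σ t ≤ 2 * (X + 1) ^ 2 * (1 + T) ^ 2 := by
    rw [div_le_iff₀ hw0]
    have : 0 ≤ (X + 1) ^ 2 * (1 + T) ^ 2 := by positivity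
    nlinarith [hw.1]
  have e0 : 0 ≤ mom σ α t ^ 2 / wt σ t := by positivity
  have e2 : |wt σ t / b * (1 - f t ^ 2 - f t * g t - g t ^ 2)| ≤ 2 * 2 := by
    rw [abs_mul, abs_of_nonneg (by positivity : 0 ≤ wt σ t / b)]
    refine mul_le_mul ?_ ?_ (abs_nonneg _) (by norm_num)
    · rw [div_le_iff₀ (by linarith)]; nlinarith [hw.2]
    · rw [abs_le]; constructor <;> nlinarith [mul_pos hf0 hg0]
  have e3 : (1 : ℝ) ≤ (1 + T) ^ 2 := one_le_pow₀ (by linarith)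
  unfold diffPot
  refine (abs_sub _ _).trans ?_
  rw [abs_of_nonneg e0]
  nlinarith

theorem abs_diffFlux_le (hf : Ctrl b X τ C T σ α f p) (hg : Ctrl b X τ C T σ' α' g q) {t : ℝ}
    (ht : t ∈ Icc 0 T) : |diffFlux σ σ' (q t) t| ≤ 4 * C * (1 + T) ^ 2 * |σ - σ'| := by
  have h1 := abs_one_div_wt_sub_le hf.small' hg.small' ht
  have hC := hf.hC
  have ht0 := ht.1
  have hT := hf.small.pos
  have h2 : |q t| ≤ C * (1 + T) := by
    refine (hg.abs_p_le t ht).trans ?_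
    calc C * (1 + t) * g t ≤ C * (1 + T) * 1 := by
          have := hg.sol.pos t ht
          gcongr
          · exact ht.2
          · exact hg.sol.le_one t ht
      _ = _ := by ring
  unfold diffFlux
  rw [abs_mul]
  calc |q t| * |1 / wt σ t - 1 / wt σ' t| ≤ C * (1 + T) * (4 * |σ - σ'| * (1 + T)) :=
        mul_le_mul h2 h1 (abs_nonneg _) (by positivity)
    _ = _ := by ring

theorem abs_diffSource_le (hb : 1 < b) (hf : Ctrl b X τ C T σ α f p)
    (hg : Ctrl b X τ C T σ' α' g q) {t : ℝ} (ht : t ∈ Icc 0 T) :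
    |diffSource b σ α σ' α' (g t) t| ≤ (12 * (X + 1) ^ 2 + 1) * (1 + T) ^ 3 * |σ - σ'| +
      4 * (X + 1) * (1 + T) * |α - α'| := by
  have h1 := abs_potential_sub_le hf.hX hf.small' hg.small' hf.lower_phase.le hf.phase_lt.le ht
  have hA1 := abs_mom_le_of_small hf.hX hg.small' hf.lower_phase.le hf.phase_lt.le ht
  have hA2 := abs_mom_le_of_small hf.hX hg.small' hg.lower_phase.le hg.phase_lt.le ht
  have hw' := hg.small'.wt_half t ht
  have hw0' := hg.small'.wt_pos t ht
  have hg0 := hg.sol.pos t ht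
  have hg1 := hg.sol.le_one t ht
  have ht0 := ht.1
  have hX := hf.hX
  have hT := hf.small.pos
  have hD := abs_nonneg (σ - σ')
  have h2 : |mom σ' α t ^ 2 / wt σ' t - mom σ' α' t ^ 2 / wt σ' t| ≤
      4 * (X + 1) * (1 + T) * |α - α'| := by
    have e : mom σ' α t ^ 2 / wt σ' t - mom σ' α' t ^ 2 / wt σ' t =
        (α - α') * (mom σ' α t + mom σ' α' t) * (1 / wt σ' t) := by
      have : α - α' = mom σ' α t - mom σ' α' t := by unfold mom; ring
      rw [this]
      ring
    have e1 : 1 / wt σ' t ≤ 2 := by rw [div_le_iff₀ hw0']; linarith [hw'.1]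
    have e2 : |mom σ' α t + mom σ' α' t| ≤ 2 * ((X + 1) * (1 + T)) := by
      refine (abs_add_le _ _).trans ?_
      have : (X + 1) * (1 + t) ≤ (X + 1) * (1 + T) := by gcongr; exact ht.2
      linarith
    rw [e, abs_mul, abs_mul, abs_of_pos (by positivity : 0 < 1 / wt σ' t)]
    calc |α - α'| * |mom σ' α t + mom σ' α' t| * (1 / wt σ' t)
        ≤ |α - α'| * (2 * ((X + 1) * (1 + T))) * 2 := by gcongr
      _ = _ := by ring
  have h3 : |(wt σ t - wt σ' t) / b * (1 - g t ^ 2)| ≤ (1 + T) ^ 3 * |σ - σ'| := by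
    rw [abs_mul, abs_div, abs_wt_sub σ σ' ht0, abs_of_pos (by linarith : 0 < b)]
    have e1 : |1 - g t ^ 2| ≤ 1 := by rw [abs_le]; constructor <;> nlinarith
    have e2 : |σ - σ'| * t / b ≤ |σ - σ'| * t := div_le_self (by positivity) hb.le
    have e3 : t ≤ (1 + T) ^ 3 := by
      have : (1 + T) ^ 1 ≤ (1 + T) ^ 3 := pow_le_pow_right₀ (by linarith) (by norm_num)
      linarith [ht.2]
    calc |σ - σ'| * t / b * |1 - g t ^ 2| ≤ |σ - σ'| * t * 1 :=
          mul_le_mul e2 e1 (abs_nonneg _) (by positivity)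
      _ ≤ |σ - σ'| * (1 + T) ^ 3 * 1 := by gcongr
      _ = _ := by ring
  have e : pot b σ α (g t) t - pot b σ' α' (g t) t =
      (mom σ α t ^ 2 / wt σ t - mom σ' α t ^ 2 / wt σ' t) +
      (mom σ' α t ^ 2 / wt σ' t - mom σ' α' t ^ 2 / wt σ' t) -
      (wt σ t - wt σ' t) / b * (1 - g t ^ 2) := by unfold pot; ring
  have h4 : 12 * (X + 1) ^ 2 * (1 + t) ^ 3 * |σ - σ'| ≤
      12 * (X + 1) ^ 2 * (1 + T) ^ 3 * |σ - σ'| := by gcongr; exact ht.2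
  unfold diffSource
  rw [abs_mul, abs_of_pos hg0]
  refine (mul_le_of_le_one_right (abs_nonneg _) hg1).trans ?_
  rw [e]
  refine (abs_sub _ _).trans ?_
  have := abs_add_le (mom σ α t ^ 2 / wt σ t - mom σ' α t ^ 2 / wt σ' t)
    (mom σ' α t ^ 2 / wt σ' t - mom σ' α' t ^ 2 / wt σ' t)
  linarith

/-- The energy estimate for the difference of two solutions. -/
theorem integral_diff_le (hb : 1 < b) (hf : Ctrl b X τ C T σ α f p)
    (hg : Ctrl b X τ C T σ' α' g q) {M : ℝ}
    (hR : ∀ t ∈ Icc 0 T, |diffFlux σ σ' (q t) t| ≤ M)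
    (hS : ∀ t ∈ Icc 0 T, |diffSource b σ α σ' α' (g t) t| ≤ M) :
    ∫ t in (0 : ℝ)..T, ((p t - q t) ^ 2 / 4 + (f t - g t) ^ 2 / 2) ≤
      12 * b * C ^ 2 * (∫ t in (0 : ℝ)..T, wt σ t / (2 * b) * (f t ^ 2 - g t ^ 2) ^ 2) +
        2 * M ^ 2 * T := by
  have hT := hf.small.pos
  have cf := hf.sol.continuousOn_f
  have cp := hf.sol.continuousOn_p
  have cg := hg.sol.continuousOn_f
  have cq := hg.sol.continuousOn_p
  have cw := (continuous_wt σ).continuousOn (s := Icc 0 T)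
  have cw' := (continuous_wt σ').continuousOn (s := Icc 0 T)
  have cm := (continuous_mom σ α).continuousOn (s := Icc 0 T)
  have cm' := (continuous_mom σ' α').continuousOn (s := Icc 0 T)
  have hw : ∀ t ∈ Icc 0 T, wt σ t ≠ 0 := fun t ht => (hf.small'.wt_pos t ht).ne'
  have hw' : ∀ t ∈ Icc 0 T, wt σ' t ≠ 0 := fun t ht => (hg.small'.wt_pos t ht).ne'
  have cE : ContinuousOn (fun t => ((p t - q t) / wt σ t + diffFlux σ σ' (q t) t) * (p t - q t) +
      (f t - g t) * (diffPot b σ α (f t) (g t) t * (f t - g t) +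
        diffSource b σ α σ' α' (g t) t)) (Icc 0 T) := by
    unfold diffFlux diffPot diffSource pot
    fun_prop (disch := assumption)
  -- The system is tested with `f - g`: the integrand is the derivative of `(f - g) (p - q)`, which
  -- vanishes at both ends by the Neumann conditions.
  have h0 : ∫ t in (0 : ℝ)..T, (((p t - q t) / wt σ t + diffFlux σ σ' (q t) t) * (p t - q t) +
      (f t - g t) * (diffPot b σ α (f t) (g t) t * (f t - g t) +
        diffSource b σ α σ' α' (g t) t)) = 0 := by
    rw [intervalIntegral.integral_eq_sub_of_hasDerivAt
      (f := fun t => (f t - g t) * (p t - q t))]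
    · simp [hf.sol.p0, hf.sol.pT, hg.sol.p0, hg.sol.pT]
    · intro t ht
      rw [uIcc_of_le hT.le] at ht
      exact (hf.hasDerivAt_sub_f hg ht).mul (hf.hasDerivAt_sub_p hg ht)
    · exact intervalIntegrable_of_continuousOn_Icc hT.le cE
  have cQ : ContinuousOn (fun t => wt σ t / (2 * b) * (f t ^ 2 - g t ^ 2) ^ 2) (Icc 0 T) := by
    fun_prop
  have iE := intervalIntegrable_of_continuousOn_Icc hT.le cE
  have iQ := (intervalIntegrable_of_continuousOn_Icc hT.le cQ).const_mul (12 * b * C ^ 2)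
  have iM : IntervalIntegrable (fun _ : ℝ => 2 * M ^ 2) volume 0 T := by simp
  have hint : ∫ t in (0 : ℝ)..T, ((p t - q t) ^ 2 / 4 + (f t - g t) ^ 2 / 2) ≤
      ∫ t in (0 : ℝ)..T, ((((p t - q t) / wt σ t + diffFlux σ σ' (q t) t) * (p t - q t) +
      (f t - g t) * (diffPot b σ α (f t) (g t) t * (f t - g t) +
        diffSource b σ α σ' α' (g t) t)) +
        12 * b * C ^ 2 * (wt σ t / (2 * b) * (f t ^ 2 - g t ^ 2) ^ 2) + 2 * M ^ 2) := by
    apply intervalIntegral.integral_mono_on hT.le _ ((iE.add iQ).add iM)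
    · intro t ht
      have hwh := hf.small'.wt_half t ht
      have h1 := diff_density_le (b := b) (z := p t - q t) (R := diffFlux σ σ' (q t) t)
        (S := diffSource b σ α σ' α' (g t) t) hwh.1 hwh.2 (by linarith) (hf.le_diffPot hb hg ht)
        (sq_nonneg _)
      have h2 := pow_le_pow_left₀ (abs_nonneg _) (hR t ht) 2
      have h3 := pow_le_pow_left₀ (abs_nonneg _) (hS t ht) 2
      rw [sq_abs] at h2 h3
      refine h1.trans ?_
      linarith
    · exact intervalIntegrable_of_continuousOn_Icc hT.le (by fun_prop)
  rw [intervalIntegral.integral_add (iE.add iQ) iM, intervalIntegral.integral_add iE iQ, h0,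
    intervalIntegral.integral_const_mul, intervalIntegral.integral_const, smul_eq_mul] at hint
  linarith

end Ctrl

end

/-! ### Hölder dependence of optimal phases and densities -/

noncomputable section

/-- A solution at an optimal phase. -/
structure OptSol (b X τ C T σ α : ℝ) (f p : ℝ → ℝ) : Prop where
  ctrl : Ctrl b X τ C T σ α f p
  energy_eq : J b T σ α f = Est b T σ
  current : ∫ t in (0 : ℝ)..T, 2 * mom σ α t / wt σ t * f t ^ 2 = 0

variable {b X τ C T σ α σ' α' : ℝ} {f p g q : ℝ → ℝ}

/-- Quantitative closeness of two solutions with nearby phases and curvatures. -/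
theorem Ctrl.abs_sub_le (hb : 1 < b) (hf : Ctrl b X τ C T σ α f p)
    (hg : Ctrl b X τ C T σ' α' g q) {h K : ℝ} (hh : 0 ≤ h) (hK : 1 ≤ K)
    (hR : ∀ t ∈ Icc 0 T, |diffFlux σ σ' (q t) t| ≤ K * (1 + T) ^ 3 * h)
    (hS : ∀ t ∈ Icc 0 T, |diffSource b σ α σ' α' (g t) t| ≤ K * (1 + T) ^ 3 * h)
    (hQ : 12 * b * C ^ 2 * (∫ t in (0 : ℝ)..T, wt σ t / (2 * b) * (f t ^ 2 - g t ^ 2) ^ 2) ≤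
      K ^ 2 * h ^ 2) {t : ℝ} (ht : t ∈ Icc 0 T) :
    |f t - g t| ≤ 12 * K * (1 + T) ^ 4 * h ∧
      |p t - q t| ≤ 13 * K * (2 * (X + 1) ^ 2 + 4) * (1 + T) ^ 7 * h := by
  have hT1 := hf.small.1
  have hT := hf.small.pos
  set Y := 1 + T with hY
  have hY1 : 1 ≤ Y := by linarith
  set N := K * Y ^ 3 * h with hN
  have hN0 : 0 ≤ N := by positivity
  have cf := hf.sol.continuousOn_f
  have cp := hf.sol.continuousOn_p
  have cg := hg.sol.continuousOn_f
  have cq := hg.sol.continuousOn_p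
  have cw := (continuous_wt σ).continuousOn (s := Icc 0 T)
  have cw' := (continuous_wt σ').continuousOn (s := Icc 0 T)
  have hw : ∀ t ∈ Icc 0 T, wt σ t ≠ 0 := fun t ht => (hf.small'.wt_pos t ht).ne'
  have hw' : ∀ t ∈ Icc 0 T, wt σ' t ≠ 0 := fun t ht => (hg.small'.wt_pos t ht).ne'
  have hI := (hf.integral_diff_le hb hg hR hS).trans (add_le_add_left hQ _)
  have cR : ContinuousOn (fun t => diffFlux σ σ' (q t) t) (Icc 0 T) := by
    unfold diffFlux
    fun_prop (disch := assumption)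
  have cu' : ContinuousOn (fun t => (p t - q t) / wt σ t + diffFlux σ σ' (q t) t) (Icc 0 T) := by
    fun_prop (disch := assumption)
  have key : ∀ t ∈ Icc 0 T, |f t - g t| ≤ 12 * K * Y ^ 4 * h := by
    intro t ht
    have h1 := sq_le_integral_of_hasDerivAt hT1 (fun t ht => hf.hasDerivAt_sub_f hg ht) cu' ht
    have h2 : ∫ t in (0 : ℝ)..T, (2 * (f t - g t) ^ 2 +
        ((p t - q t) / wt σ t + diffFlux σ σ' (q t) t) ^ 2) ≤
        ∫ t in (0 : ℝ)..T, (32 * ((p t - q t) ^ 2 / 4 + (f t - g t) ^ 2 / 2) + 2 * N ^ 2) := by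
      apply intervalIntegral.integral_mono_on hT.le
      · exact intervalIntegrable_of_continuousOn_Icc hT.le (by fun_prop)
      · exact intervalIntegrable_of_continuousOn_Icc hT.le (by fun_prop)
      intro s hs
      have hwh := hf.small'.wt_half s hs
      have e1 : ((p s - q s) / wt σ s) ^ 2 ≤ 4 * (p s - q s) ^ 2 := by
        rw [div_pow, div_le_iff₀ (by nlinarith [hwh.1])]
        have : 1 / 4 ≤ wt σ s ^ 2 := by nlinarith [hwh.1]
        nlinarith [sq_nonneg (p s - q s)]
      have e2 := pow_le_pow_left₀ (abs_nonneg _) (hR s hs) 2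
      rw [sq_abs] at e2
      have e3 := add_sq_le (a := (p s - q s) / wt σ s) (b := diffFlux σ σ' (q s) s)
      nlinarith [sq_nonneg (f s - g s)]
    have i1 : IntervalIntegrable (fun t => (p t - q t) ^ 2 / 4 + (f t - g t) ^ 2 / 2) volume 0 T :=
      intervalIntegrable_of_continuousOn_Icc hT.le (by fun_prop)
    rw [intervalIntegral.integral_add (i1.const_mul _) (by simp),
      intervalIntegral.integral_const_mul, intervalIntegral.integral_const, smul_eq_mul] at h2
    have h3 : (f t - g t) ^ 2 ≤ 32 * (K ^ 2 * h ^ 2 + 2 * N ^ 2 * T) + (T - 0) * (2 * N ^ 2) := by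
      linarith
    have h4 : 32 * (K ^ 2 * h ^ 2 + 2 * N ^ 2 * T) + (T - 0) * (2 * N ^ 2) ≤
        (12 * K * Y ^ 4 * h) ^ 2 := by
      have e1 : N ^ 2 * T ≤ K ^ 2 * h ^ 2 * Y ^ 8 := by
        calc N ^ 2 * T ≤ N ^ 2 * Y := by gcongr; linarith
          _ = K ^ 2 * h ^ 2 * Y ^ 7 := by rw [hN]; ring
          _ ≤ K ^ 2 * h ^ 2 * Y ^ 8 := by gcongr; norm_num
      have e2 : K ^ 2 * h ^ 2 * 1 ≤ K ^ 2 * h ^ 2 * Y ^ 8 := by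
        gcongr; exact one_le_pow₀ hY1
      have e3 : (12 * K * Y ^ 4 * h) ^ 2 = 144 * (K ^ 2 * h ^ 2 * Y ^ 8) := by ring
      have e4 : 0 ≤ K ^ 2 * h ^ 2 * Y ^ 8 := by positivity
      rw [e3]
      linarith
    exact abs_le_of_sq_le_sq (h3.trans h4) (by positivity)
  refine ⟨key t ht, ?_⟩
  set A := 2 * (X + 1) ^ 2 + 4 with hA
  have hA1 : 1 ≤ A := by rw [hA]; nlinarith [sq_nonneg (X + 1)]
  -- Once `f - g` is bounded uniformly, `p - q` follows by integrating its equation from `0`, where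
  -- it vanishes.
  have h5 := abs_le_mul_of_hasDerivAt (M := 13 * K * A * Y ^ 6 * h) (z := fun t => p t - q t)
    (by simp [hf.sol.p0, hg.sol.p0]) (fun t ht => hf.hasDerivAt_sub_p hg ht) (fun s hs => ?_) ht
  · refine h5.trans ?_
    calc 13 * K * A * Y ^ 6 * h * t ≤ 13 * K * A * Y ^ 6 * h * Y := by
          gcongr; linarith [ht.2]
      _ = _ := by ring
  · refine (abs_add_le _ _).trans ?_
    rw [abs_mul]
    have e1 : |diffPot b σ α (f s) (g s) s| * |f s - g s| ≤ A * Y ^ 2 * (12 * K * Y ^ 4 * h) :=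
      mul_le_mul (hf.abs_diffPot_le hb hg hs) (key s hs) (abs_nonneg _) (by positivity)
    have e2 : N ≤ A * K * Y ^ 6 * h := by
      calc N = 1 * K * Y ^ 3 * h := by rw [hN]; ring
        _ ≤ A * K * Y ^ 6 * h := by gcongr; norm_num
    have := hS s hs
    linarith

/-- Solutions at optimal phases are Hölder continuous functions of the curvature. -/
theorem exists_optSol_sub_le (hb : 1 < b) (hX : 2 ≤ X) (hC : 1 ≤ C) : ∃ K, 1 ≤ K ∧
    ∀ {τ c m T σ α σ' α' f p g q}, Setting b X τ C c m T → Small m T σ → Small m T σ' →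
    |σ - σ'| ≤ 1 → OptSol b X τ C T σ α f p → OptSol b X τ C T σ' α' g q →
    |α - α'| ≤ K * (1 + T) ^ 7 * Real.sqrt |σ - σ'| ∧ ∀ t ∈ Icc 0 T,
      |f t - g t| ≤ K * (1 + T) ^ 7 * Real.sqrt |σ - σ'| ∧
      |p t - q t| ≤ K * (1 + T) ^ 7 * Real.sqrt |σ - σ'| := by
  have hL := lipC_pos hX hC
  have hω : 0 < 1 - 1 / b := Ctrl.omega_pos hb
  set L := lipC X C with hLd
  -- This solves the stability estimate for the phases, which reads `(α - α')² ≤ K₁² T² |σ - σ'|`.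
  -- The constant `K₂` below collects the coefficients of the flux, the source (including its phase
  -- part) and the defect.
  set K₁ := Real.sqrt (1600 * L * C ^ 2 / (1 - 1 / b)) with hK₁
  have hK₁sq : K₁ ^ 2 = 1600 * L * C ^ 2 / (1 - 1 / b) := Real.sq_sqrt (by positivity)
  have hK₁0 : 0 ≤ K₁ := Real.sqrt_nonneg _
  set K₂ := 4 * C + (12 * (X + 1) ^ 2 + 1) + 4 * (X + 1) * K₁ + 24 * b * C ^ 2 * L with hK₂
  have hK₂1 : 1 ≤ K₂ := by
    have : 0 ≤ (12 * (X + 1) ^ 2 + 1) + 4 * (X + 1) * K₁ + 24 * b * C ^ 2 * L := by positivity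
    linarith
  set A := 2 * (X + 1) ^ 2 + 4 with hA
  have hA1 : 1 ≤ A := by rw [hA]; nlinarith [sq_nonneg (X + 1)]
  refine ⟨13 * K₂ * A + K₁, by nlinarith, fun {τ c m T σ α σ' α' f p g q} S hs hs' hD1 hf hg => ?_⟩
  have hst := S.stability hs hs' hf.ctrl hf.energy_eq hf.current hg.ctrl hg.energy_eq
  have hT1 := S.hT
  have hT : 0 < T := by linarith
  set D := |σ - σ'| with hD
  have hD0 : 0 ≤ D := abs_nonneg _
  set h := Real.sqrt D with hh
  have hh0 : 0 ≤ h := Real.sqrt_nonneg _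
  have hsq : h ^ 2 = D := Real.sq_sqrt hD0
  have hDh : D ≤ h := by
    have : h ≤ 1 := Real.sqrt_le_one.2 hD1
    nlinarith
  have hQ0 : 0 ≤ ∫ t in (0 : ℝ)..T, wt σ t / (2 * b) * (f t ^ 2 - g t ^ 2) ^ 2 :=
    intervalIntegral.integral_nonneg hT.le fun t ht => by
      have := hf.ctrl.small'.wt_pos t ht
      positivity
  set Q := ∫ t in (0 : ℝ)..T, wt σ t / (2 * b) * (f t ^ 2 - g t ^ 2) ^ 2 with hQ
  have hδ : |α - α'| ≤ K₁ * T * h := by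
    refine abs_le_of_sq_le_sq ?_ (by positivity)
    have h1 : (α' - α) ^ 2 * ((1 - 1 / b) / (800 * T ^ 2 * C ^ 2)) ≤ 2 * L * D := by linarith
    rw [← mul_div_assoc, div_le_iff₀ (by positivity)] at h1
    rw [mul_pow, mul_pow, hK₁sq, hsq, div_mul_eq_mul_div, div_mul_eq_mul_div, le_div_iff₀ hω]
    linarith
  have hQle : Q ≤ 2 * L * D := by
    have : 0 ≤ (α' - α) ^ 2 * ((1 - 1 / b) / (800 * T ^ 2 * C ^ 2)) := by positivity
    linarith
  set Y := 1 + T with hY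
  have hY1 : 1 ≤ Y := by linarith
  have hYp : Y ^ 2 ≤ Y ^ 3 := pow_le_pow_right₀ hY1 (by norm_num)
  have key := fun t ht => Ctrl.abs_sub_le hb hf.ctrl hg.ctrl (h := h) (K := K₂) hh0 hK₂1 (t := t)
    (fun s hs => ?_) (fun s hs => ?_) ?_ ht
  · have hY7 : Y ^ 4 ≤ Y ^ 7 := pow_le_pow_right₀ hY1 (by norm_num)
    refine ⟨hδ.trans ?_, fun t ht => ⟨(key t ht).1.trans ?_, (key t ht).2.trans ?_⟩⟩
    · have : T ≤ Y ^ 7 := by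
        have : Y ^ 1 ≤ Y ^ 7 := pow_le_pow_right₀ hY1 (by norm_num)
        linarith
      calc K₁ * T * h ≤ K₁ * Y ^ 7 * h := by gcongr
        _ ≤ (13 * K₂ * A + K₁) * Y ^ 7 * h := by
            gcongr
            have : 0 ≤ 13 * K₂ * A := by positivity
            linarith
    · have : 12 * K₂ ≤ 13 * K₂ * A + K₁ := by nlinarith
      gcongr
    · gcongr
      linarith
  · refine (hf.ctrl.abs_diffFlux_le hg.ctrl hs).trans ?_
    calc 4 * C * Y ^ 2 * D ≤ 4 * C * Y ^ 3 * h := by gcongr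
      _ ≤ K₂ * Y ^ 3 * h := by
          gcongr
          have : 0 ≤ (12 * (X + 1) ^ 2 + 1) + 4 * (X + 1) * K₁ + 24 * b * C ^ 2 * L := by positivity
          linarith
  · refine (hf.ctrl.abs_diffSource_le hb hg.ctrl hs).trans ?_
    calc (12 * (X + 1) ^ 2 + 1) * Y ^ 3 * D + 4 * (X + 1) * Y * |α - α'|
        ≤ (12 * (X + 1) ^ 2 + 1) * Y ^ 3 * h + 4 * (X + 1) * Y * (K₁ * Y * h) := by
          gcongr
          refine hδ.trans ?_
          gcongr
          linarith
      _ = (12 * (X + 1) ^ 2 + 1) * Y ^ 3 * h + 4 * (X + 1) * K₁ * (Y ^ 2) * h := by ring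
      _ ≤ (12 * (X + 1) ^ 2 + 1) * Y ^ 3 * h + 4 * (X + 1) * K₁ * (Y ^ 3) * h := by gcongr
      _ = ((12 * (X + 1) ^ 2 + 1) + 4 * (X + 1) * K₁) * Y ^ 3 * h := by ring
      _ ≤ K₂ * Y ^ 3 * h := by
          gcongr
          have : 0 ≤ 4 * C + 24 * b * C ^ 2 * L := by positivity
          linarith
  · rw [hsq]
    calc 12 * b * C ^ 2 * Q ≤ 12 * b * C ^ 2 * (2 * L * D) := by gcongr
      _ = 24 * b * C ^ 2 * L * D := by ring
      _ ≤ K₂ ^ 2 * D := by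
          gcongr
          have e0 : 24 * b * C ^ 2 * L ≤ K₂ := by
            have : 0 ≤ 4 * C + (12 * (X + 1) ^ 2 + 1) + 4 * (X + 1) * K₁ := by positivity
            linarith
          nlinarith

end

/-! ### Derivatives of all orders by bootstrapping the equations -/

noncomputable section

section Close

variable {ι : Type*} {T η : ι → ℝ} {F G H L : ι → ℝ → ℝ}

/-- Two families of functions on `[0, T]` are bounded by powers of `1 + T`, and their difference is
bounded by a power of `1 + T` times `η`. -/
def CloseZero (T η : ι → ℝ) (F G : ι → ℝ → ℝ) : Prop :=
  ∃ (C : ℝ) (a : ℕ), 0 ≤ C ∧ ∀ i, ∀ t ∈ Icc 0 (T i), |F i t| ≤ C * (1 + T i) ^ a ∧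
    |G i t| ≤ C * (1 + T i) ^ a ∧ |F i t - G i t| ≤ C * (1 + T i) ^ a * η i

/-- `CloseZero` for the derivatives up to order `n`. -/
def Close (T η : ι → ℝ) : ℕ → (ι → ℝ → ℝ) → (ι → ℝ → ℝ) → Prop
  | 0, F, G => CloseZero T η F G
  | n + 1, F, G => CloseZero T η F G ∧ ∃ F₁ G₁ : ι → ℝ → ℝ,
      (∀ i, ∀ t ∈ Icc 0 (T i), HasDerivWithinAt (F i) (F₁ i t) (Icc 0 (T i)) t) ∧
      (∀ i, ∀ t ∈ Icc 0 (T i), HasDerivWithinAt (G i) (G₁ i t) (Icc 0 (T i)) t) ∧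
      Close T η n F₁ G₁

theorem CloseZero.add (hT : ∀ i, 0 ≤ T i) (hη : ∀ i, 0 ≤ η i) (h₁ : CloseZero T η F G)
    (h₂ : CloseZero T η H L) :
    CloseZero T η (fun i t => F i t + H i t) (fun i t => G i t + L i t) := by
  obtain ⟨C₁, a₁, hC₁, h₁⟩ := h₁
  obtain ⟨C₂, a₂, hC₂, h₂⟩ := h₂
  refine ⟨C₁ + C₂, a₁ + a₂, by positivity, fun i t ht => ?_⟩
  obtain ⟨f1, f2, f3⟩ := h₁ i t ht
  obtain ⟨g1, g2, g3⟩ := h₂ i t ht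
  have hY : 1 ≤ 1 + T i := by linarith [hT i]
  have e1 : C₁ * (1 + T i) ^ a₁ ≤ C₁ * (1 + T i) ^ (a₁ + a₂) :=
    mul_le_mul_of_nonneg_left (pow_le_pow_right₀ hY (by lia)) hC₁
  have e2 : C₂ * (1 + T i) ^ a₂ ≤ C₂ * (1 + T i) ^ (a₁ + a₂) :=
    mul_le_mul_of_nonneg_left (pow_le_pow_right₀ hY (by lia)) hC₂
  have e3 := mul_le_mul_of_nonneg_right e1 (hη i)
  have e4 := mul_le_mul_of_nonneg_right e2 (hη i)
  refine ⟨(abs_add_le _ _).trans (by linarith), (abs_add_le _ _).trans (by linarith), ?_⟩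
  have e5 : F i t + H i t - (G i t + L i t) = (F i t - G i t) + (H i t - L i t) := by ring
  rw [e5]
  exact (abs_add_le _ _).trans (by linarith)

theorem CloseZero.mul (h₁ : CloseZero T η F G) (h₂ : CloseZero T η H L) :
    CloseZero T η (fun i t => F i t * H i t) (fun i t => G i t * L i t) := by
  obtain ⟨C₁, a₁, hC₁, h₁⟩ := h₁
  obtain ⟨C₂, a₂, hC₂, h₂⟩ := h₂
  refine ⟨2 * (C₁ * C₂), a₁ + a₂, by positivity, fun i t ht => ?_⟩
  obtain ⟨f1, f2, f3⟩ := h₁ i t ht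
  obtain ⟨g1, g2, g3⟩ := h₂ i t ht
  have e1 : C₁ * (1 + T i) ^ a₁ * (C₂ * (1 + T i) ^ a₂) = C₁ * C₂ * (1 + T i) ^ (a₁ + a₂) := by
    ring
  have k1 := mul_le_mul f1 g1 (abs_nonneg _) ((abs_nonneg _).trans f1)
  have k2 := mul_le_mul f2 g2 (abs_nonneg _) ((abs_nonneg _).trans f2)
  have k3 := mul_le_mul f1 g3 (abs_nonneg _) ((abs_nonneg _).trans f1)
  have k4 := mul_le_mul g2 f3 (abs_nonneg _) ((abs_nonneg _).trans g2)
  have k0 : 0 ≤ C₁ * C₂ * (1 + T i) ^ (a₁ + a₂) := by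
    rw [← e1]; exact mul_nonneg ((abs_nonneg _).trans f1) ((abs_nonneg _).trans g1)
  refine ⟨?_, ?_, ?_⟩
  · rw [abs_mul]; linarith
  · rw [abs_mul]; linarith
  · have e2 : F i t * H i t - G i t * L i t =
        F i t * (H i t - L i t) + L i t * (F i t - G i t) := by ring
    rw [e2]
    refine (abs_add_le _ _).trans ?_
    rw [abs_mul, abs_mul]
    refine (add_le_add k3 k4).trans (le_of_eq ?_)
    ring

theorem Close.of_succ {n : ℕ} (h : Close T η (n + 1) F G) : Close T η n F G := by
  induction n generalizing F G with
  | zero => exact h.1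
  | succ n ih =>
    obtain ⟨h0, F₁, G₁, hF, hG, h1⟩ := h
    exact ⟨h0, F₁, G₁, hF, hG, ih h1⟩

theorem Close.add (hT : ∀ i, 0 ≤ T i) (hη : ∀ i, 0 ≤ η i) {n : ℕ} (h₁ : Close T η n F G)
    (h₂ : Close T η n H L) :
    Close T η n (fun i t => F i t + H i t) (fun i t => G i t + L i t) := by
  induction n generalizing F G H L with
  | zero => exact CloseZero.add hT hη h₁ h₂
  | succ n ih =>
    obtain ⟨h0, F₁, G₁, hF, hG, h1⟩ := h₁
    obtain ⟨k0, H₁, L₁, hH, hL, k1⟩ := h₂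
    exact ⟨h0.add hT hη k0, _, _, fun i t ht => (hF i t ht).fun_add (hH i t ht),
      fun i t ht => (hG i t ht).fun_add (hL i t ht), ih h1 k1⟩

theorem Close.mul (hT : ∀ i, 0 ≤ T i) (hη : ∀ i, 0 ≤ η i) {n : ℕ} (h₁ : Close T η n F G)
    (h₂ : Close T η n H L) :
    Close T η n (fun i t => F i t * H i t) (fun i t => G i t * L i t) := by
  induction n generalizing F G H L with
  | zero => exact CloseZero.mul h₁ h₂
  | succ n ih =>
    have h₁' := h₁.of_succ
    have h₂' := h₂.of_succ
    obtain ⟨h0, F₁, G₁, hF, hG, h1⟩ := h₁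
    obtain ⟨k0, H₁, L₁, hH, hL, k1⟩ := h₂
    exact ⟨h0.mul k0, _, _, fun i t ht => (hF i t ht).fun_mul (hH i t ht),
      fun i t ht => (hG i t ht).fun_mul (hL i t ht), (ih h1 h₂').add hT hη (ih h₁' k1)⟩

theorem CloseZero.const {x y : ι → ℝ} {C : ℝ} (hx : ∀ i, |x i| ≤ C)
    (hy : ∀ i, |y i| ≤ C) (hη : ∀ i, 0 ≤ η i) (hxy : ∀ i, |x i - y i| ≤ η i) :
    CloseZero T η (fun i _ => x i) (fun i _ => y i) := by
  refine ⟨|C| + 1, 0, by positivity, fun i t _ => ?_⟩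
  have hC : C ≤ |C| + 1 := (le_abs_self C).trans (by linarith)
  simp only [pow_zero, mul_one]
  refine ⟨(hx i).trans hC, (hy i).trans hC, (hxy i).trans ?_⟩
  exact le_mul_of_one_le_left (hη i) (by linarith [abs_nonneg C])

theorem CloseZero.fixed (hη : ∀ i, 0 ≤ η i) (r : ℝ) :
    CloseZero T η (fun _ _ => r) (fun _ _ => r) :=
  CloseZero.const (C := |r|) (fun _ => le_rfl) (fun _ => le_rfl) hη fun i => by simpa using hη i

/-- Curvatures and phases vary with the index but not with `t`, so their derivatives vanish and only
order zero needs an estimate. -/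
theorem CloseZero.close_const (hη : ∀ i, 0 ≤ η i) {x y : ι → ℝ}
    (h : CloseZero T η (fun i _ => x i) (fun i _ => y i)) (n : ℕ) :
    Close T η n (fun i _ => x i) (fun i _ => y i) := by
  induction n generalizing x y with
  | zero => exact h
  | succ n ih =>
    exact ⟨h, fun _ _ => 0, fun _ _ => 0, fun i t _ => hasDerivWithinAt_const _ _ _,
      fun i t _ => hasDerivWithinAt_const _ _ _, ih (CloseZero.fixed hη 0)⟩

theorem Close.fixed (hη : ∀ i, 0 ≤ η i) (n : ℕ) (r : ℝ) :
    Close T η n (fun _ _ => r) (fun _ _ => r) :=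
  (CloseZero.fixed hη r).close_const hη n

theorem Close.id (hη : ∀ i, 0 ≤ η i) (n : ℕ) : Close T η n (fun _ t => t) (fun _ t => t) := by
  have h0 : CloseZero T η (fun _ t => t) (fun _ t => t) := by
    refine ⟨1, 1, zero_le_one, fun i t ht => ?_⟩
    have h1 : |t| ≤ 1 * (1 + T i) ^ 1 := by
      rw [abs_of_nonneg ht.1]
      linarith [ht.2]
    refine ⟨h1, h1, ?_⟩
    rw [sub_self, abs_zero]
    exact mul_nonneg ((abs_nonneg _).trans h1) (hη i)
  cases n with
  | zero => exact h0
  | succ n =>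
    exact ⟨h0, fun _ _ => 1, fun _ _ => 1, fun i t _ => hasDerivWithinAt_id _ _,
      fun i t _ => hasDerivWithinAt_id _ _, Close.fixed hη n 1⟩

theorem Close.exists_iteratedDerivWithin_le (hT : ∀ i, 0 < T i) {n : ℕ} (h : Close T η n F G) :
    ∃ (C : ℝ) (a : ℕ), 0 ≤ C ∧ ∀ i, ∀ t ∈ Icc 0 (T i),
      |iteratedDerivWithin n (F i) (Icc 0 (T i)) t - iteratedDerivWithin n (G i) (Icc 0 (T i)) t| ≤
        C * (1 + T i) ^ a * η i := by
  induction n generalizing F G with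
  | zero =>
    obtain ⟨C, a, hC, h⟩ := h
    refine ⟨C, a, hC, fun i t ht => ?_⟩
    simpa using (h i t ht).2.2
  | succ n ih =>
    obtain ⟨-, F₁, G₁, hF, hG, h1⟩ := h
    obtain ⟨C, a, hC, h⟩ := ih h1
    refine ⟨C, a, hC, fun i t ht => ?_⟩
    have hu := uniqueDiffOn_Icc (hT i)
    rw [iteratedDerivWithin_succ', iteratedDerivWithin_succ',
      iteratedDerivWithin_congr (g := F₁ i) (fun s hs => (hF i s hs).derivWithin (hu s hs)) ht,
      iteratedDerivWithin_congr (g := G₁ i) (fun s hs => (hG i s hs).derivWithin (hu s hs)) ht]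
    exact h i t ht

end Close

/-- Joint induction: each of `f'` and `p'` is a smooth expression in `t`, `f`, `p`, so both
functions gain one derivative together. -/
theorem Sol.contDiffOn_nat {b T σ α : ℝ} {f p : ℝ → ℝ} (h : Sol b T σ α f p) (hT : 0 < T)
    (hw : ∀ t ∈ Icc 0 T, 0 < wt σ t) (n : ℕ) :
    ContDiffOn ℝ n f (Icc 0 T) ∧ ContDiffOn ℝ n p (Icc 0 T) := by
  have hu := uniqueDiffOn_Icc hT
  have hw' : ∀ t ∈ Icc 0 T, wt σ t ≠ 0 := fun t ht => (hw t ht).ne'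
  induction n with
  | zero =>
    simp only [Nat.cast_zero, contDiffOn_zero]
    exact ⟨h.continuousOn_f, h.continuousOn_p⟩
  | succ n ih =>
    obtain ⟨i1, i2⟩ := ih
    have cw : ContDiffOn ℝ n (wt σ) (Icc 0 T) := by unfold wt; fun_prop
    have cm : ContDiffOn ℝ n (mom σ α) (Icc 0 T) := by unfold mom; fun_prop
    constructor
    · rw [Nat.cast_succ, contDiffOn_succ_iff_derivWithin hu]
      refine ⟨fun t ht => (h.hf t ht).differentiableAt.differentiableWithinAt, by simp, ?_⟩
      exact (i2.div cw hw').congr fun t ht => (h.hf t ht).hasDerivWithinAt.derivWithin (hu t ht)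
    · rw [Nat.cast_succ, contDiffOn_succ_iff_derivWithin hu]
      refine ⟨fun t ht => (h.hp t ht).differentiableAt.differentiableWithinAt, by simp, ?_⟩
      exact ((((cm.pow 2).div cw hw').sub ((cw.div_const b).mul (contDiffOn_const.sub
        (i1.pow 2)))).mul i1).congr fun t ht =>
          (h.hp t ht).hasDerivWithinAt.derivWithin (hu t ht)

theorem Sol.contDiffOn {b T σ α : ℝ} {f p : ℝ → ℝ} (h : Sol b T σ α f p) (hT : 0 < T)
    (hw : ∀ t ∈ Icc 0 T, 0 < wt σ t) : ContDiffOn ℝ ∞ f (Icc 0 T) :=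
  contDiffOn_infty.2 fun n => (h.contDiffOn_nat hT hw n).1

/-- Two curvatures together with solutions at optimal phases. -/
structure OptPair (b X τ C c m : ℝ) where
  T : ℝ
  σ : ℝ
  σ' : ℝ
  α : ℝ
  α' : ℝ
  f : ℝ → ℝ
  p : ℝ → ℝ
  g : ℝ → ℝ
  q : ℝ → ℝ
  setting : Setting b X τ C c m T
  small : Small m T σ
  small' : Small m T σ'
  le_one : |σ - σ'| ≤ 1
  left : OptSol b X τ C T σ α f p
  right : OptSol b X τ C T σ' α' g q

namespace OptPair

variable {b X τ C c m : ℝ}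

/-- The size of the difference of the solutions. -/
def η (x : OptPair b X τ C c m) : ℝ := Real.sqrt |x.σ - x.σ'|

theorem η_nonneg (x : OptPair b X τ C c m) : 0 ≤ x.η := Real.sqrt_nonneg _

theorem abs_sub_le_η (x : OptPair b X τ C c m) : |x.σ - x.σ'| ≤ x.η := by
  have h1 : x.η ≤ 1 := Real.sqrt_le_one.2 x.le_one
  have h2 : x.η ^ 2 = |x.σ - x.σ'| := Real.sq_sqrt (abs_nonneg _)
  nlinarith [x.η_nonneg]

theorem T_pos (x : OptPair b X τ C c m) : 0 < x.T := by linarith [x.setting.hT]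

theorem abs_σ_le_one {m T σ : ℝ} (hs : Small m T σ) (hm : m ≤ 1) : |σ| ≤ 1 := by
  have := hs.abs_mul_pow_le (j := 0) (by norm_num)
  rw [pow_zero, mul_one] at this
  linarith

theorem m_le (x : OptPair b X τ C c m) : m ≤ 1 / 100 :=
  x.setting.hm.trans (mX_le x.setting.hX)

theorem close_add {n : ℕ} {F G H L : OptPair b X τ C c m → ℝ → ℝ}
    (h₁ : Close T η n F G) (h₂ : Close T η n H L) :
    Close T η n (fun i t => F i t + H i t) (fun i t => G i t + L i t) :=
  h₁.add (fun i => i.T_pos.le) η_nonneg h₂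

theorem close_mul {n : ℕ} {F G H L : OptPair b X τ C c m → ℝ → ℝ}
    (h₁ : Close T η n F G) (h₂ : Close T η n H L) :
    Close T η n (fun i t => F i t * H i t) (fun i t => G i t * L i t) :=
  h₁.mul (fun i => i.T_pos.le) η_nonneg h₂

theorem close_fixed (n : ℕ) (r : ℝ) : Close (T : OptPair b X τ C c m → ℝ) η n (fun _ _ => r)
    (fun _ _ => r) := Close.fixed η_nonneg n r

theorem close_σ (n : ℕ) : Close (T : OptPair b X τ C c m → ℝ) η n (fun i _ => i.σ)
    (fun i _ => i.σ') :=
  (CloseZero.const (C := 1) (fun i => abs_σ_le_one i.small (by linarith [i.m_le]))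
    (fun i => abs_σ_le_one i.small' (by linarith [i.m_le])) η_nonneg
    fun i => i.abs_sub_le_η).close_const η_nonneg n

theorem close_wt (n : ℕ) : Close (T : OptPair b X τ C c m → ℝ) η n (fun i t => wt i.σ t)
    (fun i t => wt i.σ' t) := by
  have h := close_add (close_fixed (b := b) (X := X) (τ := τ) (C := C) (c := c) (m := m) n 1)
    (close_mul (close_mul (close_fixed n (-1)) (close_σ n)) (Close.id η_nonneg n))
  convert h using 3 <;> (unfold wt; ring)

/-- The derivative of `1 / wt` is `σ (1 / wt)²`, a product of functions already known to be close,
so the induction closes on itself. -/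
theorem close_inv_wt (n : ℕ) : Close (T : OptPair b X τ C c m → ℝ) η n
    (fun i t => 1 / wt i.σ t) (fun i t => 1 / wt i.σ' t) := by
  have hb : ∀ {T σ t : ℝ}, Small (1 / 100) T σ → t ∈ Icc 0 T → |1 / wt σ t| ≤ 2 := by
    intro T σ t hs ht
    have hw := hs.wt_half t ht
    have hw0 := hs.wt_pos t ht
    rw [abs_of_pos (by positivity), div_le_iff₀ hw0]
    linarith [hw.1]
  have hd : ∀ {T σ t : ℝ}, Small (1 / 100) T σ → t ∈ Icc 0 T →
      HasDerivWithinAt (fun t => 1 / wt σ t) (σ * (1 / wt σ t * (1 / wt σ t))) (Icc 0 T) t := by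
    intro T σ t hs ht
    have hw0 := (hs.wt_pos t ht).ne'
    have := ((hasDerivAt_wt σ t).fun_inv hw0).hasDerivWithinAt (s := Icc 0 T)
    simp only [one_div]
    refine this.congr_deriv ?_
    field_simp
  have h0 : CloseZero (T : OptPair b X τ C c m → ℝ) η
      (fun i t => 1 / wt i.σ t) (fun i t => 1 / wt i.σ' t) := by
    refine ⟨4, 1, by norm_num, fun i t ht => ?_⟩
    have hs := i.small.mono i.m_le
    have hs' := i.small'.mono i.m_le
    have hT := i.T_pos
    refine ⟨(hb hs ht).trans (by linarith), (hb hs' ht).trans (by linarith), ?_⟩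
    refine (abs_one_div_wt_sub_le hs hs' ht).trans ?_
    calc 4 * |i.σ - i.σ'| * (1 + i.T) ≤ 4 * i.η * (1 + i.T) := by
          gcongr; exact i.abs_sub_le_η
      _ = _ := by ring
  induction n with
  | zero => exact h0
  | succ n ih =>
    exact ⟨h0, _, _, fun i t ht => hd (i.small.mono i.m_le) ht,
      fun i t ht => hd (i.small'.mono i.m_le) ht, close_mul (close_σ n) (close_mul ih ih)⟩

/-- The base case of the bootstrap, supplied by the Hölder estimate. Taking `OptPair` itself as
index set makes the constants uniform in `T`, the curvatures and the solutions. -/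
theorem closeZero_of_optSol (hb : 1 < b) (hX : 2 ≤ X) (hC : 1 ≤ C) :
    CloseZero (T : OptPair b X τ C c m → ℝ) η (fun i _ => i.α) (fun i _ => i.α') ∧
    CloseZero (T : OptPair b X τ C c m → ℝ) η f g ∧
    CloseZero (T : OptPair b X τ C c m → ℝ) η p q := by
  obtain ⟨K, hK, h⟩ := exists_optSol_sub_le hb hX hC
  have hY : ∀ i : OptPair b X τ C c m, 1 ≤ (1 + i.T) ^ 7 := fun i =>
    one_le_pow₀ (by linarith [i.T_pos])
  have le₁ : ∀ (i : OptPair b X τ C c m) {A : ℝ}, 0 ≤ A → A ≤ A * (1 + i.T) ^ 7 :=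
    fun i A hA => le_mul_of_one_le_right hA (hY i)
  have le₂ : ∀ (i : OptPair b X τ C c m) {A B : ℝ}, B ≤ A →
      B * (1 + i.T) ^ 7 * i.η ≤ A * (1 + i.T) ^ 7 * i.η := by
    intro i A B hAB
    have := i.η_nonneg
    have := i.T_pos
    gcongr
  refine ⟨⟨X + K, 7, by linarith, fun i t _ => ?_⟩, ⟨1 + K, 7, by linarith, fun i t ht => ?_⟩,
    ⟨C + K, 7, by linarith, fun i t ht => ?_⟩⟩
  · have hα : ∀ {σ α : ℝ} {f p : ℝ → ℝ}, OptSol b X τ C i.T σ α f p →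
        |α| ≤ (X + K) * (1 + i.T) ^ 7 := by
      intro σ α f p hf
      refine le_trans ?_ (le₁ i (by linarith))
      rw [abs_le]
      constructor <;> linarith [hf.ctrl.lower_phase, hf.ctrl.phase_lt]
    refine ⟨hα i.left, hα i.right, ?_⟩
    exact (h i.setting i.small i.small' i.le_one i.left i.right).1.trans (le₂ i (by linarith))
  · have hα : ∀ {σ α : ℝ} {f p : ℝ → ℝ}, OptSol b X τ C i.T σ α f p →
        |f t| ≤ (1 + K) * (1 + i.T) ^ 7 := by
      intro σ α f p hf
      refine le_trans ?_ (le₁ i (by linarith))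
      rw [abs_of_pos (hf.ctrl.sol.pos t ht)]
      linarith [hf.ctrl.sol.le_one t ht]
    refine ⟨hα i.left, hα i.right, ?_⟩
    exact ((h i.setting i.small i.small' i.le_one i.left i.right).2 t ht).1.trans
      (le₂ i (by linarith))
  · have hα : ∀ {σ α : ℝ} {f p : ℝ → ℝ}, OptSol b X τ C i.T σ α f p →
        |p t| ≤ (C + K) * (1 + i.T) ^ 7 := by
      intro σ α f p hf
      have h0 := hf.ctrl.sol.pos t ht
      have hT := i.T_pos
      have ht0 := ht.1
      calc |p t| ≤ C * (1 + t) * f t := hf.ctrl.abs_p_le t ht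
        _ ≤ C * (1 + i.T) * 1 := by
            gcongr
            · exact ht.2
            · exact hf.ctrl.sol.le_one t ht
        _ = C * (1 + i.T) ^ 1 := by ring
        _ ≤ (C + K) * (1 + i.T) ^ 7 := by
            gcongr
            · linarith
            · linarith
            · norm_num
    refine ⟨hα i.left, hα i.right, ?_⟩
    exact ((h i.setting i.small i.small' i.le_one i.left i.right).2 t ht).2.trans
      (le₂ i (by linarith))

theorem close_mom (hb : 1 < b) (hX : 2 ≤ X) (hC : 1 ≤ C) (n : ℕ) :
    Close (T : OptPair b X τ C c m → ℝ) η n (fun i t => mom i.σ i.α t)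
      (fun i t => mom i.σ' i.α' t) := by
  have hid : Close (T : OptPair b X τ C c m → ℝ) η n (fun _ t => t) (fun _ t => t) :=
    Close.id η_nonneg n
  have hα := (closeZero_of_optSol (τ := τ) (c := c) (m := m) hb hX hC).1.close_const η_nonneg n
  have h := close_add (close_add hid hα)
    (close_mul (close_mul (close_fixed n (-1 / 2)) (close_σ n)) (close_mul hid hid))
  convert h using 3 <;> (unfold mom; ring)

/-- The equations express `f'` and `p'` as polynomials in quantities close up to order `n`: `mom`,
`wt`, `1 / wt`, `f` and `p`. Closeness up to order `n + 1` follows for `f` and `p` together. -/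
theorem close_sol (hb : 1 < b) (hX : 2 ≤ X) (hC : 1 ≤ C) (n : ℕ) :
    Close (T : OptPair b X τ C c m → ℝ) η n f g ∧ Close (T : OptPair b X τ C c m → ℝ) η n p q := by
  have h0 := closeZero_of_optSol (τ := τ) (c := c) (m := m) hb hX hC
  induction n with
  | zero => exact h0.2
  | succ n ih =>
    obtain ⟨i1, i2⟩ := ih
    have hm := close_mom (τ := τ) (c := c) (m := m) hb hX hC n
    refine ⟨⟨h0.2.1, _, _, fun i t ht => (i.left.ctrl.sol.hf t ht).hasDerivWithinAt,
      fun i t ht => (i.right.ctrl.sol.hf t ht).hasDerivWithinAt, ?_⟩,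
      ⟨h0.2.2, _, _, fun i t ht => (i.left.ctrl.sol.hp t ht).hasDerivWithinAt,
      fun i t ht => (i.right.ctrl.sol.hp t ht).hasDerivWithinAt, ?_⟩⟩
    · have h := close_mul i2 (close_inv_wt n)
      convert h using 3 <;> ring
    · have h := close_mul (close_add (close_mul (close_mul hm hm) (close_inv_wt n))
        (close_mul (close_mul (close_fixed n (-1 / b)) (close_wt n))
          (close_add (close_fixed n 1) (close_mul (close_fixed n (-1)) (close_mul i1 i1))))) i1
      convert h using 3 <;> ring

theorem exists_iteratedDerivWithin_le (hb : 1 < b) (hX : 2 ≤ X) (hC : 1 ≤ C) (n : ℕ) :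
    ∃ (K : ℝ) (a : ℕ), 0 ≤ K ∧ ∀ i : OptPair b X τ C c m, ∀ t ∈ Icc 0 i.T,
      |iteratedDerivWithin n i.f (Icc 0 i.T) t - iteratedDerivWithin n i.g (Icc 0 i.T) t| ≤
        K * (1 + i.T) ^ a * i.η :=
  (close_sol hb hX hC n).1.exists_iteratedDerivWithin_le T_pos

end OptPair

end

/-! ### Choice of constants and transfer to the original functional -/

noncomputable section

theorem eventually_large {b : ℝ} (hb : 1 < b) (C : ℝ) : ∀ᶠ T in Filter.atTop, Large b C T := by
  have hω := Ctrl.omega_pos hb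
  have h1 : ∀ᶠ T : ℝ in Filter.atTop, 80 * C ^ 2 ≤ (1 - 1 / b) * T :=
    (Filter.tendsto_id.const_mul_atTop hω).eventually_ge_atTop _
  have h2 : Filter.Tendsto (fun T : ℝ => 103200 * C ^ 8 * 64 *
      ((T / 2) ^ 6 * Real.exp (-(T / 2)))) Filter.atTop (nhds 0) := by
    have := ((Real.tendsto_pow_mul_exp_neg_atTop_nhds_zero 6).comp
      (Filter.tendsto_id.atTop_div_const (by norm_num : (0 : ℝ) < 2))).const_mul
        (103200 * C ^ 8 * 64)
    rwa [mul_zero] at this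
  filter_upwards [h1, h2.eventually_le_const hω] with T h3 h4
  refine ⟨h3, le_trans (le_of_eq ?_) h4⟩
  ring

/-- For long intervals all the assumptions of the perturbation theory are satisfied. -/
theorem exists_setting {b : ℝ} (hb : 1 < b) (hb' : b < Theta0⁻¹) :
    ∃ X τ C c m T₁, 2 ≤ X ∧ 1 ≤ C ∧ 0 < m ∧ ∀ T, T₁ ≤ T →
      Setting b X τ C c m T ∧ 3 * lipC X C < c * T := by
  have hω : 0 < 1 - 1 / b ^ 2 := by
    rw [sub_pos, div_lt_one (by positivity)]
    exact one_lt_pow₀ hb (by norm_num)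
  -- The order of choice matters: `X` depends on `b`, the energy bound `c` on the half-line trial
  -- function, `τ` and `C` on `X` and `c`, and the minimal length `T₁` comes last.
  obtain ⟨X, hX, hXb⟩ : ∃ X : ℝ, 2 ≤ X ∧ 7 ≤ X ^ 2 * (1 - 1 / b ^ 2) :=
    ((Filter.eventually_ge_atTop 2).and (((Filter.tendsto_pow_atTop two_ne_zero).atTop_mul_const
      hω).eventually_ge_atTop 7)).exists
  obtain ⟨c, m₀, T₀, hc, hm₀, hE⟩ := exists_Est_le hb hb'
  obtain ⟨τ, C, -, hC, hctrl⟩ := exists_ctrl hb hX hc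
  have hlip : ∀ᶠ T : ℝ in Filter.atTop, 3 * lipC X C < c * T :=
    (Filter.tendsto_id.const_mul_atTop hc).eventually_gt_atTop _
  have hev : ∀ᶠ T : ℝ in Filter.atTop, 1 ≤ T ∧ T₀ ≤ T ∧ 2 * X + 1 ≤ T ∧ 2 * τ ≤ T ∧
      Large b C T ∧ 3 * lipC X C < c * T := by
    filter_upwards [Filter.eventually_ge_atTop 1, Filter.eventually_ge_atTop T₀,
      Filter.eventually_ge_atTop (2 * X + 1), Filter.eventually_ge_atTop (2 * τ),
      eventually_large hb C, hlip] with T h1 h2 h3 h4 h5 h6 using ⟨h1, h2, h3, h4, h5, h6⟩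
  obtain ⟨T₁, hT₁⟩ := Filter.eventually_atTop.1 hev
  refine ⟨X, τ, C, c, min (mX X) m₀, T₁, hX, hC, lt_min (mX_pos hX) hm₀, fun T hT => ?_⟩
  obtain ⟨h1, h2, h3, h4, h5, h6⟩ := hT₁ T hT
  have hsX : ∀ {σ}, Small (min (mX X) m₀) T σ → Small (mX X) T σ :=
    fun hs => hs.mono (min_le_left _ _)
  exact ⟨⟨hb, hX, hC, hc, min_le_left _ _, h1, h5,
    fun σ hs => hE T σ h2 (hs.mono (min_le_right _ _)),
    fun σ α hs hα hneg => phase_bounds hb ((hsX hs).mono (mX_le hX)) hX hXb h3 hα hneg,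
    by linarith,
    fun σ α f p hs => hctrl T σ α f p h4 (hsX hs)⟩, h6⟩

/-- The choice of the threshold for `ε`. -/
theorem exists_threshold {c₀ M m : ℝ} (hc₀ : 0 < c₀) (hm : 0 < m) (T₁ : ℝ) :
    ∃ ε₀, 0 < ε₀ ∧ ε₀ < 1 ∧ ∀ ε, 0 < ε → ε < ε₀ → T₁ ≤ tEps c₀ ε ∧ 1 ≤ tEps c₀ ε ∧
      1 ≤ |Real.log ε| ∧ ε * M * (1 + tEps c₀ ε) ^ 6 ≤ m ∧ ε * (2 * M) ≤ 1 := by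
  have h1 : Filter.Tendsto (fun L : ℝ => c₀ * L) Filter.atTop Filter.atTop :=
    Filter.tendsto_id.const_mul_atTop hc₀
  have h2 : Filter.Tendsto (fun L : ℝ => |M| * (1 + c₀) ^ 6 * (L ^ 6 * Real.exp (-L)))
      Filter.atTop (nhds 0) := by
    have := (Real.tendsto_pow_mul_exp_neg_atTop_nhds_zero 6).const_mul (|M| * (1 + c₀) ^ 6)
    rwa [mul_zero] at this
  have h3 : Filter.Tendsto (fun L : ℝ => Real.exp (-L) * (2 * M)) Filter.atTop (nhds 0) := by
    have := Real.tendsto_exp_neg_atTop_nhds_zero.mul_const (2 * M)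
    rwa [zero_mul] at this
  obtain ⟨L₀, hL₀⟩ := Filter.eventually_atTop.1 ((h1.eventually_ge_atTop (max T₁ 1)).and
    ((Filter.eventually_ge_atTop 1).and ((h2.eventually_le_const hm).and
      (h3.eventually_le_const zero_lt_one))))
  refine ⟨Real.exp (-max L₀ 1), Real.exp_pos _, ?_, fun ε hε hεlt => ?_⟩
  · rw [Real.exp_lt_one_iff, neg_lt_zero]
    exact lt_max_of_lt_right zero_lt_one
  have hlog : Real.log ε < -max L₀ 1 := (Real.log_lt_iff_lt_exp hε).2 hεlt
  have habs : |Real.log ε| = -Real.log ε := abs_of_neg (by linarith [le_max_right L₀ 1])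
  have hexp : Real.exp (-|Real.log ε|) = ε := by rw [habs, neg_neg, Real.exp_log hε]
  obtain ⟨k1, k2, k3, k4⟩ := hL₀ |Real.log ε| (by linarith [le_max_left L₀ 1])
  rw [hexp] at k3 k4
  refine ⟨(le_max_left _ _).trans k1, (le_max_right _ _).trans k1, k2, le_trans ?_ k3, k4⟩
  have h4 : 1 + tEps c₀ ε ≤ (1 + c₀) * |Real.log ε| := by unfold tEps; linarith
  have h5 : 0 ≤ 1 + tEps c₀ ε := by unfold tEps; positivity
  calc ε * M * (1 + tEps c₀ ε) ^ 6 ≤ ε * |M| * ((1 + c₀) * |Real.log ε|) ^ 6 := by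
        gcongr
        exact le_abs_self M
    _ = _ := by ring

/-- The exponent is raised by one so that the final power of `|log ε|` is strictly positive even for
`a = 0`. -/
theorem one_add_tEps_pow_le {c₀ ε : ℝ} (hc₀ : 0 < c₀) (hL : 1 ≤ |Real.log ε|) (a : ℕ) :
    (1 + tEps c₀ ε) ^ a ≤ (1 + c₀) ^ (a + 1) * |Real.log ε| ^ ((a : ℝ) + 1) := by
  have h1 : 1 + tEps c₀ ε ≤ (1 + c₀) * |Real.log ε| := by unfold tEps; linarith
  have h2 : 1 ≤ 1 + tEps c₀ ε := by
    have : 0 ≤ tEps c₀ ε := by unfold tEps; positivity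
    linarith
  have h3 : |Real.log ε| ^ ((a : ℝ) + 1) = |Real.log ε| ^ (a + 1) := by
    rw [← Nat.cast_succ, Real.rpow_natCast]
  calc (1 + tEps c₀ ε) ^ a ≤ (1 + tEps c₀ ε) ^ (a + 1) := pow_le_pow_right₀ h2 (by lia)
    _ ≤ ((1 + c₀) * |Real.log ε|) ^ (a + 1) := pow_le_pow_left₀ (by linarith) h1 _
    _ = _ := by rw [h3, mul_pow]

theorem Setting.exists_optSol {b X τ C c m T σ α : ℝ} (S : Setting b X τ C c m T)
    (hs : Small m T σ) (hα : IsOpt b T σ α) : ∃ f p, OptSol b X τ C T σ α f p := by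
  obtain ⟨f, p, h1, h2, h3⟩ := S.exists_ctrl hs hα
  exact ⟨f, p, h1, h2, h3⟩

theorem isOpt_of_isOptimalPhase {b c₀ ε k α : ℝ} (h : IsOptimalPhase b c₀ ε k α) :
    IsOpt b (tEps c₀ ε) (ε * k) α := by
  obtain ⟨h1, h2⟩ := h
  rw [E1D_eq_Emin, EStar_eq_Est] at h2
  exact ⟨h1, h2⟩

/-- By uniqueness of nonnegative minimizers at a fixed phase, an arbitrary optimal density coincides
on the interval with the solution found by shooting, and inherits its estimates. -/
theorem Setting.exists_optSol_of_isOptimalPair {b X τ C c m c₀ ε k α : ℝ} {f : ℝ → ℝ}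
    (S : Setting b X τ C c m (tEps c₀ ε)) (hs : Small m (tEps c₀ ε) (ε * k))
    (h : IsOptimalPair b c₀ ε k α f) :
    ∃ g q, OptSol b X τ C (tEps c₀ ε) (ε * k) α g q ∧ EqOn f g (IEps c₀ ε) := by
  have hα := isOpt_of_isOptimalPhase h.1
  obtain ⟨g, q, hg⟩ := S.exists_optSol hs hα
  obtain ⟨h1, h2, h3⟩ := h.2
  have hs' := S.small' hs
  refine ⟨g, q, hg, fun t ht => hg.ctrl.sol.eq_of_J_le S.hb hs'.pos hs'.wt_half h1 h2 ?_ t ht⟩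
  rw [← energy_eq_J, h3, hg.energy_eq, ← hα.2, E1D_eq_Emin]

theorem Setting.exists_isOptimalPair {b X τ C c m c₀ ε k : ℝ}
    (S : Setting b X τ C c m (tEps c₀ ε)) (hs : Small m (tEps c₀ ε) (ε * k)) :
    ∃ α f, IsOptimalPair b c₀ ε k α f := by
  have hs' := S.small' hs
  obtain ⟨α, hα⟩ := exists_optimal_phase S.hb hs'
  obtain ⟨f, p, hf⟩ := S.exists_optSol hs hα
  refine ⟨α, f, ⟨hα.1, by rw [E1D_eq_Emin, EStar_eq_Est, hα.2]⟩,
    hf.ctrl.sol.h1on hs'.pos hs'.wt_pos, fun t ht => (hf.ctrl.sol.pos t ht).le, ?_⟩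
  rw [energy_eq_J, E1D_eq_Emin, hf.energy_eq, hα.2]

end

end SurfaceSC

open SurfaceSC in
theorem proposition3p1 (b : ℝ) (hb : 1 < b) (hb' : b < SurfaceSC.Theta0⁻¹) :
    ∃ c₁ : ℝ, 0 < c₁ ∧ ∀ c₀ : ℝ, c₁ ≤ c₀ → ∀ M : ℝ, 0 < M →
      ∃ ε₀ : ℝ, 0 < ε₀ ∧ ε₀ < 1 ∧
        -- well-posedness of the minimization problem
        (∀ ε : ℝ, 0 < ε → ε < ε₀ → ∀ k : ℝ, |k| ≤ M →
          (∃ (α : ℝ) (f : ℝ → ℝ), SurfaceSC.IsOptimalPair b c₀ ε k α f) ∧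
          (∀ (α : ℝ) (f : ℝ → ℝ), SurfaceSC.IsOptimalPair b c₀ ε k α f →
            ContDiffOn ℝ ∞ f (SurfaceSC.IEps c₀ ε)) ∧
          -- for positive curvature, minimizing over all real phases gives the same result
          (0 < k → ∀ β : ℝ, β ∉ SurfaceSC.phases c₀ ε →
            SurfaceSC.EStar b c₀ ε k < SurfaceSC.E1D b c₀ ε k β)) ∧
        -- dependence of the optimal energy on the curvature
        (∃ C a : ℝ, 0 < C ∧ 0 < a ∧ ∀ ε : ℝ, 0 < ε → ε < ε₀ →
          ∀ k k' : ℝ, |k| ≤ M → |k'| ≤ M →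
            |SurfaceSC.EStar b c₀ ε k - SurfaceSC.EStar b c₀ ε k'| ≤
              C * (ε * |k - k'|) * |Real.log ε| ^ a) ∧
        -- dependence of the optimal phase on the curvature
        (∃ C a : ℝ, 0 < C ∧ 0 < a ∧ ∀ ε : ℝ, 0 < ε → ε < ε₀ →
          ∀ k k' : ℝ, |k| ≤ M → |k'| ≤ M → ∀ α α' : ℝ,
            SurfaceSC.IsOptimalPhase b c₀ ε k α →
            SurfaceSC.IsOptimalPhase b c₀ ε k' α' →
            |α - α'| ≤ C * Real.sqrt (ε * |k - k'|) * |Real.log ε| ^ a) ∧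
        -- dependence of the optimal density and all its derivatives on the curvature
        (∀ n : ℕ, ∃ C a : ℝ, 0 < C ∧ 0 < a ∧ ∀ ε : ℝ, 0 < ε → ε < ε₀ →
          ∀ k k' : ℝ, |k| ≤ M → |k'| ≤ M → ∀ (α α' : ℝ) (f f' : ℝ → ℝ),
            SurfaceSC.IsOptimalPair b c₀ ε k α f →
            SurfaceSC.IsOptimalPair b c₀ ε k' α' f' →
            eLpNorm (fun t => iteratedDerivWithin n f (SurfaceSC.IEps c₀ ε) t -
                iteratedDerivWithin n f' (SurfaceSC.IEps c₀ ε) t) ⊤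
                (volume.restrict (SurfaceSC.IEps c₀ ε)) ≤
              ENNReal.ofReal
                (C * Real.sqrt (ε * |k - k'|) * |Real.log ε| ^ a)) := by
  obtain ⟨X, τ, C, c, m, T₁, hX, hC, hm, hS⟩ := exists_setting hb hb'
  -- Any positive threshold would serve: for fixed `c₀ > 0` the length `T` tends to infinity as `ε →
  -- 0`, and only `T ≥ T₁` and smallness of `ε M (1 + T)⁶` and `ε M` are needed.
  refine ⟨1, one_pos, fun c₀ hc₁ M hM => ?_⟩
  have hc₀ : 0 < c₀ := by linarith
  obtain ⟨ε₀, hε₀, hε₀1, hε₀'⟩ := exists_threshold (M := M) hc₀ (half_pos hm) T₁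
  have hset : ∀ {ε}, 0 < ε → ε < ε₀ → Setting b X τ C c m (tEps c₀ ε) :=
    fun h0 h1 => (hS _ (hε₀' _ h0 h1).1).1
  have hL : ∀ {ε}, 0 < ε → ε < ε₀ → 1 ≤ |Real.log ε| := fun h0 h1 => (hε₀' _ h0 h1).2.2.1
  -- Half of the admissible curvature is kept in reserve, because reflection can double it.
  have hsm2 : ∀ {ε k}, 0 < ε → ε < ε₀ → |k| ≤ M → Small (m / 2) (tEps c₀ ε) (ε * k) := by
    intro ε k h0 h1 hk
    obtain ⟨-, k2, -, k4, -⟩ := hε₀' ε h0 h1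
    refine ⟨k2, le_trans ?_ k4⟩
    rw [abs_mul, abs_of_pos h0]
    have : 0 ≤ 1 + tEps c₀ ε := by linarith
    gcongr
  have hsm : ∀ {ε k}, 0 < ε → ε < ε₀ → |k| ≤ M → Small m (tEps c₀ ε) (ε * k) :=
    fun h0 h1 hk => (hsm2 h0 h1 hk).mono (by linarith)
  have habs : ∀ {ε}, 0 < ε → ∀ k k' : ℝ, |ε * k - ε * k'| = ε * |k - k'| := by
    intro ε h0 k k'
    rw [← mul_sub, abs_mul, abs_of_pos h0]
  have hle1 : ∀ {ε k k'}, 0 < ε → ε < ε₀ → |k| ≤ M → |k'| ≤ M → |ε * k - ε * k'| ≤ 1 := by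
    intro ε k k' h0 h1 hk hk'
    rw [habs h0]
    refine le_trans ?_ (hε₀' ε h0 h1).2.2.2.2
    have := abs_sub k k'
    gcongr
    linarith
  refine ⟨ε₀, hε₀, hε₀1, fun ε h0 h1 k hk => ⟨(hset h0 h1).exists_isOptimalPair (hsm h0 h1 hk),
    fun α f hf => ?_, fun hk0 β hβ => ?_⟩, ?_, ?_, fun n => ?_⟩
  · obtain ⟨g, q, hg, hfg⟩ := (hset h0 h1).exists_optSol_of_isOptimalPair (hsm h0 h1 hk) hf
    exact (hg.ctrl.sol.contDiffOn hg.ctrl.small.pos hg.ctrl.small'.wt_pos).congr hfg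
  · rw [EStar_eq_Est, E1D_eq_Emin]
    exact (hset h0 h1).Est_lt_Emin (mul_pos h0 hk0) (hsm2 h0 h1 hk) (hS _ (hε₀' _ h0 h1).1).2
      (not_le.1 hβ)
  -- The energy estimate loses no logarithm; the factor `|log ε| ≥ 1` is added only to match the
  -- form of the bound.
  · refine ⟨lipC X C, 1, lipC_pos hX hC, one_pos, fun ε h0 h1 k k' hk hk' => ?_⟩
    rw [EStar_eq_Est, EStar_eq_Est, Real.rpow_one]
    refine ((hset h0 h1).abs_Est_sub_le (hsm h0 h1 hk) (hsm h0 h1 hk')).trans ?_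
    rw [habs h0]
    exact le_mul_of_one_le_right (mul_nonneg (lipC_pos hX hC).le (by positivity)) (hL h0 h1)
  · obtain ⟨K, hK, h⟩ := exists_optSol_sub_le hb hX hC
    refine ⟨K * (1 + c₀) ^ 8, (7 : ℕ) + 1, by positivity, by positivity,
      fun ε h0 h1 k k' hk hk' α α' hα hα' => ?_⟩
    obtain ⟨f, p, hf⟩ := (hset h0 h1).exists_optSol (hsm h0 h1 hk) (isOpt_of_isOptimalPhase hα)
    obtain ⟨g, q, hg⟩ := (hset h0 h1).exists_optSol (hsm h0 h1 hk') (isOpt_of_isOptimalPhase hα')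
    refine (h (hset h0 h1) (hsm h0 h1 hk) (hsm h0 h1 hk') (hle1 h0 h1 hk hk') hf hg).1.trans ?_
    rw [habs h0]
    calc K * (1 + tEps c₀ ε) ^ 7 * Real.sqrt (ε * |k - k'|)
        ≤ K * ((1 + c₀) ^ 8 * |Real.log ε| ^ (((7 : ℕ) : ℝ) + 1)) * Real.sqrt (ε * |k - k'|) := by
          gcongr
          exact one_add_tEps_pow_le hc₀ (hL h0 h1) 7
      _ = _ := by ring
  · obtain ⟨K, a, hK, h⟩ := OptPair.exists_iteratedDerivWithin_le (τ := τ) (c := c) (m := m)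
      hb hX hC n
    -- `K + 1` instead of `K`, which is only known to be nonnegative.
    refine ⟨(K + 1) * (1 + c₀) ^ (a + 1), (a : ℝ) + 1, by positivity, by positivity,
      fun ε h0 h1 k k' hk hk' α α' f f' hf hf' => ?_⟩
    obtain ⟨g, q, hg, hfg⟩ := (hset h0 h1).exists_optSol_of_isOptimalPair (hsm h0 h1 hk) hf
    obtain ⟨g', q', hg', hfg'⟩ := (hset h0 h1).exists_optSol_of_isOptimalPair (hsm h0 h1 hk') hf'
    have key := h ⟨tEps c₀ ε, ε * k, ε * k', α, α', g, q, g', q', hset h0 h1, hsm h0 h1 hk,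
      hsm h0 h1 hk', hle1 h0 h1 hk hk', hg, hg'⟩
    rw [eLpNorm_exponent_top]
    refine eLpNormEssSup_le_of_ae_bound ?_
    filter_upwards [ae_restrict_mem (measurableSet_Icc (a := (0 : ℝ)) (b := tEps c₀ ε))] with t ht
    rw [Real.norm_eq_abs, iteratedDerivWithin_congr hfg ht, iteratedDerivWithin_congr hfg' ht]
    refine (key t ht).trans ?_
    change K * (1 + tEps c₀ ε) ^ a * Real.sqrt |ε * k - ε * k'| ≤ _
    rw [habs h0]
    calc K * (1 + tEps c₀ ε) ^ a * Real.sqrt (ε * |k - k'|)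
        ≤ (K + 1) * ((1 + c₀) ^ (a + 1) * |Real.log ε| ^ ((a : ℝ) + 1)) *
          Real.sqrt (ε * |k - k'|) := by
          have hT : 0 ≤ 1 + tEps c₀ ε := by linarith [(hε₀' ε h0 h1).2.1]
          gcongr
          · linarith
          · exact one_add_tEps_pow_le hc₀ (hL h0 h1) a
      _ = _ := by ring
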